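/- **Setting.** A plumbing is a finite tree $\Gamma$ with vertex set $V$, $s=|V|$, and integer weights $m_v$; $M$ is its linking matrix ($M_{vv}=m_v$, $M_{vw}=1$ if $v,w$ are adjacent, $0$ otherwise), assumed invertible; $\pi$ and $\sigma$ are its number of positive eigenvalues and its signature, and $\delta=(\deg v)_v$. A $\mathrm{Spin}^c$ structure is a class $a\in(2\mathbb Z^s+\delta)/2M\mathbb Z^s$. A vertex is *high-valency* if $\deg w=2+p_w\ge 3$; $V_h$ is the set of these. Continued fractions $[m_1,\dots,m_k]=m_1-1/(m_2-1/(\cdots-1/m_k))$ are evaluated in $\mathbb Q\cup\{\infty\}$ with $1/0=\infty$, $1/\infty=0$. For a finite set of vertices (or a single integer, regarded as a one-vertex plumbing), $\pi(\cdot)$ denotes the number of positive eigenvalues of its linking matrix. A *branch* from $w\in V_h$ to a vertex $v$ of degree $1$ is a path from $w$ to $v$ with all interior vertices of degree $2$; $I_w$ is the set of such $v$. If the continued fraction of the weights from $w$ to $v$ (both included) is an integer $k$ (*pseudo branch*), put $\varphi(v)=(-1)^{\pi(\Gamma_{wv})-\pi(k)}$, where $\Gamma_{wv}$ consists of all vertices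 of the path; otherwise put $\varphi(v)=0$. A *pseudo bridge* is a path between two distinct $w_1,w_2\in V_h$ with at least one interior vertex, all interior vertices of degree $2$, whose interior weights have continued fraction $0$; $\pi(\Gamma_{w_1,w_2})$ refers to its interior vertices. Let $\mathcal S$ be the set of $\xi\in\{\pm1\}^{V_h}$ with $\xi_{w_1}\xi_{w_2}=(-1)^{\pi(\Gamma_{w_1,w_2})+1}$ for every pseudo bridge. With $A(r,p)=\frac{(r+1)\cdots(r+p-1)}{(p-1)!}$ and $\mathcal D_v^{s}=z_vt^{s}-z_v^{-1}t^{-s}$ let $$\mathcal D_w|_{\xi_w}=c_w\sum_{r\ge0}A(r,p_w)\,t^{2r+p_w}z_w^{\xi_w(2r+p_w)}\prod_{v\in I_w}\mathcal D_v^{\xi_w\varphi(v)},\qquad c_w=(-1)^{p_w}\text{ if }\xi_w=1,\quad c_w=1\text{ if }\xi_w=-1,$$ $$\hat Z_a(q,t)=(-1)^{\pi}q^{\frac{3\sigma-\sum_v m_v}{4}}\ \mathrm{CT}_{z}\Big\{\frac1{|\mathcal S|}\sum_{\xi\in\mathcal S}\prod_{w\in V_h}\mathcal D_w|_{\xi_w}\cdot\sum_{\ell\in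 2M\mathbb Z^s+a}q^{-\frac{(\ell,M^{-1}\ell)}4}\prod_v z_v^{\ell_v}\Big\},$$ where $\mathrm{CT}_z$ is the constant term in the $z_v$; if $V_h=\emptyset$, the averaged product is replaced by $\prod_v(z_v-z_v^{-1})^{2-\deg v}$. The coefficient of each $q^n$ ($n\in\mathbb Q$) is a formal Laurent series in $t$. The *recovered series* is $\sum_n c_nq^n$ if for every $n$ the coefficient of $q^n$ converges for $0<t<1$ and tends to the real number $c_n$ as $t\to1^-$; in this case the limit $t\to1^-$ of $\hat Z_a(q,t)$ is said to be finite. The *Neumann moves* are the following operations ($\varepsilon=\pm1$) and their inverses, with the indicated correspondence of $\mathrm{Spin}^c$ structures. (a) Replace an edge joining vertices of weights $m_1,m_2$ by a chain $(m_1+\varepsilon)-\varepsilon-(m_2+\varepsilon)$; $a=(\alpha_1,\alpha_2)$, split along the edge, becomes $(\alpha_1,0,-\varepsilon\alpha_2)$. (b) Attach a new vertex of weight $\varepsilon$ to a vertex $v$ and add $\varepsilon$ to the weight of $v$; $(\alpha,a_v)$ becomes $(\alpha,a_v+1,\varepsilon)$. (c) Replace a vertex $v$ of weight $m_1+m_2$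 by a chain $m_1-0-m_2$, distributing the edges at $v$ arbitrarily among the two ends; $(\alpha_1,x-y,\alpha_2)$ becomes $(\alpha_1,x,0,y,-\alpha_2)$, where $\alpha_1,\alpha_2$ are the parts of $a$ on the subtrees attached to the first and to the second end. **Proposition.** Let $(\Gamma,a)$ and $(\Gamma',a')$ be plumbings with $\mathrm{Spin}^c$ structures, $M(\Gamma)$ invertible, related by a finite sequence of arbitrary Neumann moves in which every plumbing, reduced or not, has at most two high-valency vertices. If the limit $t\to1^-$ of $\hat Z_a(q,t)$ for $\Gamma$ is finite, then so is that of $\hat Z_{a'}(q,t)$ for $\Gamma'$, and the two recovered series are equal. -/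

import Mathlib

universe u

open Filter Topology

noncomputable section

/-! ### Eigenvalue counts and continued fractions -/

/-- The number of positive eigenvalues, with multiplicity, of a (symmetric) integer matrix. -/
def posEigenCount {n : Type*} [Fintype n] [DecidableEq n] (A : Matrix n n ℤ) : ℕ :=
  ((A.map (Int.cast : ℤ → ℝ)).charpoly.roots.filter (fun x => 0 < x)).card

/-- The number of negative eigenvalues, with multiplicity, of a (symmetric) integer matrix. -/
def negEigenCount {n : Type*} [Fintype n] [DecidableEq n] (A : Matrix n n ℤ) : ℕ :=
  ((A.map (Int.cast : ℤ → ℝ)).charpoly.roots.filter (fun x => x < 0)).card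

/-- The signature of a symmetric integer matrix. -/
def matrixSignature {n : Type*} [Fintype n] [DecidableEq n] (A : Matrix n n ℤ) : ℤ :=
  (posEigenCount A : ℤ) - (negEigenCount A : ℤ)

/-- `m - 1/x` in `ℚ ∪ {∞}`, with `1/0 = ∞`, `1/∞ = 0` and `m - ∞ = ∞`. -/
def subInv (m : ℤ) : OnePoint ℚ → OnePoint ℚ
  | OnePoint.infty => ((m : ℚ) : OnePoint ℚ)
  | OnePoint.some x => if x = 0 then OnePoint.infty else (((m : ℚ) - x⁻¹ : ℚ) : OnePoint ℚ)

/-- The continued fraction `m₁ - 1/(m₂ - 1/(⋯ - 1/mₖ))`, evaluated in `ℚ ∪ {∞}`; the empty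
continued fraction is `∞`, so that `[m] = m - 1/∞ = m`. -/
def contFrac : List ℤ → OnePoint ℚ
  | [] => OnePoint.infty
  | m :: l => subInv m (contFrac l)

/-- `A(r, p) = (r+1)(r+2)⋯(r+p-1) / (p-1)!`, for `p ≥ 1`. -/
def expansionCoeff (r p : ℕ) : ℕ := (r + p - 1).choose (p - 1)

/-! ### Laurent series in `t` over the Laurent polynomials in the variables `z_v` -/

/-- Laurent polynomials in the variables `z_v`, `v ∈ V`, with integer coefficients. -/
abbrev ZLaurent (V : Type u) : Type u := AddMonoidAlgebra ℤ (V → ℤ)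

/-- Formal Laurent series in `t` whose coefficients are Laurent polynomials in the `z_v`. -/
abbrev TSeries (V : Type u) : Type u := LaurentSeries (ZLaurent V)

/-- The monomial `t ^ k * ∏ v, z_v ^ (e v)`. -/
def tMonomial {V : Type u} (k : ℤ) (e : V → ℤ) : TSeries V :=
  HahnSeries.single k (AddMonoidAlgebra.single e (1 : ℤ))

/-- `z_v t^s - z_v⁻¹ t^(-s)`: for `s = 1, -1, 0` this is `z_v t - 1/(z_v t)`, `z_v/t - t/z_v`,
`z_v - 1/z_v`, respectively. -/
def leafFactor {V : Type u} [DecidableEq V] (v : V) (s : ℤ) : TSeries V :=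
  tMonomial s (Pi.single v 1) - tMonomial (-s) (Pi.single v (-1))

/-- The expansion `∑_r A(r,p) t^(2r+p) z_w^(2r+p)` times `(-1)^p` (for `ξ = 1`), or
`∑_r A(r,p) t^(2r+p) z_w^(-2r-p)` (for `ξ = -1`). -/
def highFactor {V : Type u} [DecidableEq V] (w : V) (p : ℕ) (ξ : ℤˣ) : TSeries V :=
  HahnSeries.ofPowerSeries ℤ (ZLaurent V) <| PowerSeries.mk fun k =>
    if p ≤ k ∧ 2 ∣ k - p then
      AddMonoidAlgebra.single (Pi.single w ((ξ : ℤ) * (k : ℤ)))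
        ((if ξ = 1 then (-1 : ℤ) ^ p else 1) * (expansionCoeff ((k - p) / 2) p : ℤ))
    else 0

/-! ### Plumbing trees -/

/-- A plumbing graph on the vertex set `V`: a tree with integer weights at the vertices. -/
structure Plumbing (V : Type u) where
  graph : SimpleGraph V
  isTree : graph.IsTree
  weight : V → ℤ

namespace Plumbing

section Path

variable {V : Type u} (Γ : Plumbing V)

/-- The unique path between two vertices of the tree. -/
def path (w v : V) : Γ.graph.Walk w v := (Γ.isTree.existsUnique_path w v).choose

/-- The list of vertices, endpoints included, on the path from `w` to `v`. -/
def pathVerts (w v : V) : List V := (Γ.path w v).support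

/-- The list of vertices strictly between `w` and `v` (for `w ≠ v`). -/
def interiorVerts (w v : V) : List V := (Γ.pathVerts w v).tail.dropLast

end Path

variable {V : Type u} [Fintype V] [DecidableEq V] (Γ : Plumbing V)

open Classical in
/-- The linking matrix. -/
def linkingMatrix : Matrix V V ℤ :=
  Matrix.of fun v w => if v = w then Γ.weight v else if Γ.graph.Adj v w then 1 else 0

/-- The linking matrix of the part of the plumbing formed by the vertices in the list `l`. -/
def subLinkingMatrix (l : List V) : Matrix l.toFinset l.toFinset ℤ :=
  Γ.linkingMatrix.submatrix Subtype.val Subtype.val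

open Classical in
/-- The degree of a vertex. -/
def deg (v : V) : ℕ := Γ.graph.degree v

/-- High-valency vertices. -/
def IsHigh (v : V) : Prop := 3 ≤ Γ.deg v

/-- The type of high-valency vertices. -/
abbrev High : Type u := {w : V // Γ.IsHigh w}

open Classical in
/-- The number of high-valency vertices. -/
def highCount : ℕ := Fintype.card Γ.High

/-- The path from `w` to `v` is a branch: it starts at a high-valency vertex, passes only through
vertices of valency two, and ends at a vertex of valency one. -/
def IsBranch (w v : V) : Prop :=
  Γ.IsHigh w ∧ Γ.deg v = 1 ∧ ∀ x ∈ Γ.interiorVerts w v, Γ.deg x = 2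

/-- The path between `w₁` and `w₂` is a pseudo bridge: it joins two high-valency vertices, has at
least one interior vertex, all its interior vertices have valency two, and the continued fraction
of their weights is zero. -/
def IsPseudoBridge (w₁ w₂ : V) : Prop :=
  Γ.IsHigh w₁ ∧ Γ.IsHigh w₂ ∧ w₁ ≠ w₂ ∧ Γ.interiorVerts w₁ w₂ ≠ [] ∧
    (∀ x ∈ Γ.interiorVerts w₁ w₂, Γ.deg x = 2) ∧
    contFrac ((Γ.interiorVerts w₁ w₂).map Γ.weight) = ((0 : ℚ) : OnePoint ℚ)

open Classical in
/-- The sign `φ(v)` of the branch from `w` to `v`: if the continued fraction of the weights along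
the branch (from `w` to `v`, both included) is an integer `k`, i.e. the branch is a pseudo branch,
it is `(-1) ^ (π(branch) - π(k))`, where `π` counts positive eigenvalues of linking matrices and
`k` is regarded as a one-vertex plumbing; otherwise it is `0`. -/
def branchSign (w v : V) : ℤ :=
  if h : ∃ k : ℤ, contFrac ((Γ.pathVerts w v).map Γ.weight) = (((k : ℚ)) : OnePoint ℚ) then
    (((-1 : ℤˣ) ^ ((posEigenCount (Γ.subLinkingMatrix (Γ.pathVerts w v)) : ℤ) -
      (posEigenCount !![h.choose] : ℤ)) : ℤˣ) : ℤ)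
  else 0

open Classical in
/-- The set `𝒮` of chambers: sign vectors `ξ` on the high-valency vertices such that
`ξ_{w₁} ξ_{w₂} = (-1) ^ (π + 1)` for each pseudo bridge, where `π` is the number of positive
eigenvalues of the linking matrix of the chain of valency-two vertices of the bridge. -/
def chambers : Finset (Γ.High → ℤˣ) :=
  Finset.univ.filter fun ξ => ∀ w₁ w₂ : Γ.High, Γ.IsPseudoBridge w₁ w₂ →
    ξ w₁ * ξ w₂ =
      (-1) ^ (posEigenCount (Γ.subLinkingMatrix (Γ.interiorVerts (w₁ : V) (w₂ : V))) + 1)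

open Classical in
/-- The discriminant function of the high-valency vertex `w` (of degree `2 + p`) with sign `ξ`. -/
def discriminant (w : V) (ξ : ℤˣ) : TSeries V :=
  highFactor w (Γ.deg w - 2) ξ *
    ∏ v ∈ Finset.univ.filter (fun v => Γ.IsBranch w v),
      leafFactor v ((ξ : ℤ) * Γ.branchSign w v)

/-- `∏ v, (z_v - 1/z_v) ^ (2 - deg v)` for a plumbing all of whose vertices have degree at
most two. -/
def lowDiscriminant : TSeries V := ∏ v, leafFactor v 0 ^ (2 - Γ.deg v)

/-- Two vectors differ by an element of `2 M ℤ^V`. On `2 ℤ^V + δ`, with `δ` the vector of degrees,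
the classes of this relation are the Spin^c structures. -/
def SpincEquiv (a b : V → ℤ) : Prop := ∃ n : V → ℤ, b = a + 2 • Γ.linkingMatrix.mulVec n

/-- The total exponent `(3σ - ∑ m_v)/4 - (ℓ, M⁻¹ ℓ)/4` of `q` contributed by `ℓ`. -/
def qExponent (l : V → ℤ) : ℚ :=
  (3 * (matrixSignature Γ.linkingMatrix : ℚ) - ((∑ v, Γ.weight v : ℤ) : ℚ)) / 4 -
    (dotProduct (fun v => (l v : ℚ))
      ((Γ.linkingMatrix.map (Int.cast : ℤ → ℚ))⁻¹.mulVec fun v => (l v : ℚ))) / 4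

open Classical in
/-- The coefficient of `q^n t^k` in `q^{(3σ - ∑ m_v)/4} CT_z { D(z,t) Θ_a(z) }`, where
`Θ_a(z) = ∑_{ℓ ∈ 2Mℤ^V + a} q^{-(ℓ, M⁻¹ℓ)/4} ∏ v, z_v^{ℓ_v}`: the monomial `z^e` of the
`t^k`-coefficient of `D` pairs with the term `ℓ = -e` of the theta function. -/
def ctTheta (a : V → ℤ) (D : TSeries V) (n : ℚ) (k : ℤ) : ℤ :=
  (D.coeff k).coeff.sum fun e c => if Γ.SpincEquiv a (-e) ∧ Γ.qExponent (-e) = n then c else 0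

open Classical in
/-- The coefficient of `q^n t^k` in the `(q,t)`-series `Ẑ_a(q,t)`. If there is no high-valency
vertex, it is the coefficient of the `q`-series `Ẑ_a(q)` (which only has `k = 0` terms). -/
def zHatCoeff (a : V → ℤ) (n : ℚ) (k : ℤ) : ℚ :=
  (-1) ^ posEigenCount Γ.linkingMatrix *
    (if Γ.highCount = 0 then (Γ.ctTheta a Γ.lowDiscriminant n k : ℚ)
    else ((∑ ξ ∈ Γ.chambers, Γ.ctTheta a (∏ w : Γ.High, Γ.discriminant w (ξ w)) n k : ℤ) : ℚ) /
      (Γ.chambers.card : ℚ))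

/-- The limit `t → 1⁻` of `Ẑ_a(q,t)` is finite and equal to `∑ n, c n * q^n`: for each `n`, the
coefficient of `q^n` is a Laurent series in `t` convergent for `0 < t < 1`, whose sum tends to the
real number `c n` as `t → 1⁻`. -/
def IsRecovered (a : V → ℤ) (c : ℚ → ℝ) : Prop :=
  ∀ n : ℚ, (∀ t ∈ Set.Ioo (0 : ℝ) 1, Summable fun k : ℤ => (Γ.zHatCoeff a n k : ℝ) * t ^ k) ∧
    Tendsto (fun t : ℝ => ∑' k : ℤ, (Γ.zHatCoeff a n k : ℝ) * t ^ k) (𝓝[<] 1) (𝓝 (c n))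

end Plumbing

/-! ### Plumbings with a Spin^c structure, and the Neumann moves -/

/-- A finite plumbing tree together with a representative `a ∈ 2 ℤ^V + δ` of a Spin^c structure,
where `δ` is the vector of degrees. -/
structure SpincPlumbing where
  V : Type u
  [fintypeV : Fintype V]
  [decEqV : DecidableEq V]
  Γ : Plumbing V
  a : V → ℤ
  parity : ∀ v, (2 : ℤ) ∣ a v - (Γ.deg v : ℤ)

attribute [instance] SpincPlumbing.fintypeV SpincPlumbing.decEqV

/-- `v` lies on the side of `y` after the edge `xy` has been removed from the tree `G`. -/
def FarSide {V : Type u} (G : SimpleGraph V) (x y v : V) : Prop :=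
  (G.deleteEdges {s(x, y)}).Reachable y v

/-- Insert a new vertex `none` in the middle of the edge `v₁ v₂`. -/
def subdivideGraph {V : Type u} (G : SimpleGraph V) (v₁ v₂ : V) : SimpleGraph (Option V) :=
  SimpleGraph.fromRel fun x y =>
    match x, y with
    | some x, some y => (G.deleteEdges {s(v₁, v₂)}).Adj x y
    | none, some y => y = v₁ ∨ y = v₂
    | _, none => False

/-- Attach a new vertex `none` of valency one to the vertex `v`. -/
def pendantGraph {V : Type u} (G : SimpleGraph V) (v : V) : SimpleGraph (Option V) :=
  SimpleGraph.fromRel fun x y =>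
    match x, y with
    | some x, some y => G.Adj x y
    | none, some y => y = v
    | _, none => False

/-- Replace the vertex `v` by a chain `v₁ - v₀ - v₂`, where `v₁ = inl v` keeps the neighbours of
`v` outside `A`, `v₀ = inr false`, and `v₂ = inr true` is attached to the neighbours in `A`. -/
def splitGraph {V : Type u} (G : SimpleGraph V) (v : V) (A : Set V) : SimpleGraph (V ⊕ Bool) :=
  SimpleGraph.fromRel fun x y =>
    match x, y with
    | Sum.inl x, Sum.inl y => G.Adj x y ∧ ¬ (x = v ∧ y ∈ A) ∧ ¬ (y = v ∧ x ∈ A)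
    | Sum.inr false, Sum.inl y => y = v
    | Sum.inr true, Sum.inl y => y ∈ A
    | Sum.inr false, Sum.inr true => True
    | _, _ => False

/-- Neumann move of blowing up an edge: the edge `v₁ v₂` is replaced by a chain
`(m₁ + ε) - ε - (m₂ + ε)`, `ε = ±1`. The Spin^c vector `(α₁, α₂)`, split along the edge, becomes
`(α₁, 0, α₂)` if `ε = -1` and `(α₁, 0, -α₂)` if `ε = 1`. -/
def MoveA (P P' : SpincPlumbing.{u}) : Prop :=
  ∃ (v₁ v₂ : P.V) (ε : ℤˣ) (f : subdivideGraph P.Γ.graph v₁ v₂ ≃g P'.Γ.graph) (b : P'.V → ℤ),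
    P.Γ.graph.Adj v₁ v₂ ∧
    P'.Γ.weight (f none) = ε ∧
    P'.Γ.weight (f (some v₁)) = P.Γ.weight v₁ + ε ∧
    P'.Γ.weight (f (some v₂)) = P.Γ.weight v₂ + ε ∧
    (∀ v, v ≠ v₁ → v ≠ v₂ → P'.Γ.weight (f (some v)) = P.Γ.weight v) ∧
    b (f none) = 0 ∧
    (∀ v, ¬ FarSide P.Γ.graph v₁ v₂ v → b (f (some v)) = P.a v) ∧
    (∀ v, FarSide P.Γ.graph v₁ v₂ v → b (f (some v)) = -(ε : ℤ) * P.a v) ∧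
    P'.Γ.SpincEquiv b P'.a

/-- Neumann move of blowing up a vertex: a vertex of weight `ε = ±1` is attached to `v`, and the
weight of `v` is increased by `ε`. The Spin^c vector `(α, a_v)` becomes `(α, a_v + 1, ε)`. -/
def MoveB (P P' : SpincPlumbing.{u}) : Prop :=
  ∃ (v : P.V) (ε : ℤˣ) (f : pendantGraph P.Γ.graph v ≃g P'.Γ.graph) (b : P'.V → ℤ),
    P'.Γ.weight (f none) = ε ∧
    P'.Γ.weight (f (some v)) = P.Γ.weight v + ε ∧
    (∀ x, x ≠ v → P'.Γ.weight (f (some x)) = P.Γ.weight x) ∧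
    b (f none) = ε ∧
    b (f (some v)) = P.a v + 1 ∧
    (∀ x, x ≠ v → b (f (some x)) = P.a x) ∧
    P'.Γ.SpincEquiv b P'.a

/-- Neumann move of splitting a vertex: a vertex `v` of weight `m₁ + m₂` is replaced by a chain
`m₁ - 0 - m₂`, the edges at `v` being distributed among the two ends. The Spin^c vector
`(α₁, x - y, α₂)` becomes `(α₁, x, 0, y, -α₂)`. -/
def MoveC (P P' : SpincPlumbing.{u}) : Prop :=
  ∃ (v : P.V) (A : Set P.V) (f : splitGraph P.Γ.graph v A ≃g P'.Γ.graph) (b : P'.V → ℤ),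
    A ⊆ P.Γ.graph.neighborSet v ∧
    P'.Γ.weight (f (Sum.inr false)) = 0 ∧
    P'.Γ.weight (f (Sum.inl v)) + P'.Γ.weight (f (Sum.inr true)) = P.Γ.weight v ∧
    (∀ x, x ≠ v → P'.Γ.weight (f (Sum.inl x)) = P.Γ.weight x) ∧
    b (f (Sum.inr false)) = 0 ∧
    b (f (Sum.inl v)) - b (f (Sum.inr true)) = P.a v ∧
    (∀ x, x ≠ v → (∀ y ∈ A, ¬ FarSide P.Γ.graph v y x) → b (f (Sum.inl x)) = P.a x) ∧
    (∀ y ∈ A, ∀ x, FarSide P.Γ.graph v y x → b (f (Sum.inl x)) = -P.a x) ∧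
    P'.Γ.SpincEquiv b P'.a

/-- `P'` is obtained from `P` by one Neumann move that creates vertices. -/
def NeumannMove (P P' : SpincPlumbing.{u}) : Prop := MoveA P P' ∨ MoveB P P' ∨ MoveC P P'

/-- Two plumbings with Spin^c structures are related by a finite sequence of Neumann moves and
inverse Neumann moves in which all plumbings have at most two high-valency vertices. -/
def NeumannRelated (P Q : SpincPlumbing.{u}) : Prop :=
  Relation.EqvGen
    (fun P P' => NeumannMove P P' ∧ P.Γ.highCount ≤ 2 ∧ P'.Γ.highCount ≤ 2) P Q

end

/-! Each Neumann move is a unimodular change of variables for the theta function. The new vertices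
span a block `Q` of the linking matrix of `Γ'` with integral inverse, and the Schur complement of
`Q` is the linking matrix of `Γ` conjugated by signs `τ`. Completing the square (`BlockReduction`)
shows that determinants vanish together, that positive and negative indices add, that the classes
mod `2Mℤ^V` correspond, and that the quadratic form splits. On exponents that can occur in the
discriminant (`Admissible`) the remaining term is a constant absorbed by `3σ - ∑ m_v`, and the
projection of exponents is a monomial substitution `z_{v'} ↦ z_{κ v'}^{τ v'}`. Thus the two theta
functions agree after this substitution (`ThetaReduction`), and the sign `∏ τ_v^{deg v}` which it
produces in the discriminant is the change of `(-1)^π`.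

It remains to compare discriminants. Sign vectors are transported by `ξ ↦ τ ξ`. Continued fractions
along branches and bridges are unchanged by a move, while the parity of the number of positive
eigenvalues of a chain changes exactly by the signs `τ` at its ends (`ChainRel`, resting on the
inertia computation `IsPathList.hasPosIndex_vertexSpan`). So pseudo bridges, chambers and leaf
exponents correspond. A new leaf at a high vertex contributes the inverse of one factor of the
expansion there (`leafFactor_mul_highFactor`), and a vertex split into two high ends gives two
expansions in the same chamber, whose product is the expansion at the original vertex
(`highFactor_mul_highFactor`). In all these cases the coefficients of `q^n t^k` agree, so
convergence and limits do too.

The exception is a leaf created at a vertex of degree two, which becomes high. The `t`-series can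
then change, but the original plumbing has at most one high vertex `w`. There the exponent of `q` is
a nonconstant quadratic polynomial in the exponent of `z_w`, because the linking matrix is
invertible (`finite_setOf_qExponent_eq`). Hence each coefficient of `q^n` is a Laurent polynomial in
`t`, whose value at `1` does not depend on the powers of `t` in the leaf factors. Chambers are
stable under negation, so both averages equal the mean over `ξ_w = ±1`. Invertibility of the
intermediate plumbings is carried along by `SameRecovered`. -/

noncomputable section
set_option linter.unusedSectionVars false

/-! ### Sylvester's law of inertia -/

section Inertia

open Module

variable {E : Type*} [AddCommGroup E] [Module ℝ E]
  {E' : Type*} [AddCommGroup E'] [Module ℝ E']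

/-- The restriction of the form `B` to the subspace `W` has positive index of inertia `p`. -/
def HasPosIndex (B : LinearMap.BilinForm ℝ E) (W : Submodule ℝ E) (p : ℕ) : Prop :=
  ∃ P N : Submodule ℝ E, P ⊔ N = W ∧ (∀ x ∈ P, x ≠ 0 → 0 < B x x) ∧ (∀ x ∈ N, B x x ≤ 0) ∧
    finrank ℝ P = p

variable {B : LinearMap.BilinForm ℝ E} {B' : LinearMap.BilinForm ℝ E'}

/-- A positive definite space meets a nonpositive one only in zero. Hence `dim P + dim N' ≤ dim W ≤
dim P' + dim N'`. -/
theorem HasPosIndex.le [FiniteDimensional ℝ E] {W : Submodule ℝ E} {p q : ℕ}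
    (hp : HasPosIndex B W p) (hq : HasPosIndex B W q) : p ≤ q := by
  obtain ⟨P, N, hW, hP, hN, rfl⟩ := hp
  obtain ⟨P', N', hW', hP', hN', rfl⟩ := hq
  have hdisj : P ⊓ N' = ⊥ := by
    rw [eq_bot_iff]
    intro x hx
    by_contra hx0
    have h1 := hP x hx.1 (by simpa using hx0)
    have h2 := hN' x hx.2
    linarith
  have h1 := Submodule.finrank_sup_add_finrank_inf_eq P N'
  rw [hdisj, finrank_bot] at h1
  have h2 := Submodule.finrank_sup_add_finrank_inf_eq P' N'
  have h3 : finrank ℝ (P ⊔ N' : Submodule ℝ E) ≤ finrank ℝ (P' ⊔ N' : Submodule ℝ E) := by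
    apply Submodule.finrank_mono
    rw [hW']
    exact sup_le (hW ▸ le_sup_left) (hW' ▸ le_sup_right)
  omega

theorem HasPosIndex.unique [FiniteDimensional ℝ E] {W : Submodule ℝ E} {p q : ℕ}
    (hp : HasPosIndex B W p) (hq : HasPosIndex B W q) : p = q :=
  le_antisymm (hp.le hq) (hq.le hp)

/-- On orthogonal subspaces the form is additive, so the positive parts and the nonpositive parts
can be joined separately. -/
theorem HasPosIndex.sup [FiniteDimensional ℝ E] (hB : ∀ x y, B x y = B y x)
    {W₁ W₂ : Submodule ℝ E} {p q : ℕ}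
    (hp : HasPosIndex B W₁ p) (hq : HasPosIndex B W₂ q) (h : ∀ x ∈ W₁, ∀ y ∈ W₂, B x y = 0) :
    HasPosIndex B (W₁ ⊔ W₂) (p + q) := by
  obtain ⟨P, N, hW, hP, hN, rfl⟩ := hp
  obtain ⟨P', N', hW', hP', hN', rfl⟩ := hq
  have hPW : P ≤ W₁ := hW ▸ le_sup_left
  have hNW : N ≤ W₁ := hW ▸ le_sup_right
  have hPW' : P' ≤ W₂ := hW' ▸ le_sup_left
  have hNW' : N' ≤ W₂ := hW' ▸ le_sup_right
  refine ⟨P ⊔ P', N ⊔ N', ?_, ?_, ?_, ?_⟩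
  · rw [← hW, ← hW']
    exact sup_sup_sup_comm P P' N N'
  · intro z hz hz0
    obtain ⟨x, hx, y, hy, rfl⟩ := Submodule.mem_sup.1 hz
    have h1 := h x (hPW hx) y (hPW' hy)
    have h2 : B (x + y) (x + y) = B x x + B y y := by
      simp [hB y x, h1]
    rw [h2]
    by_cases hx0 : x = 0
    · have hy0 : y ≠ 0 := by rintro rfl; simp [hx0] at hz0
      simpa [hx0] using hP' y hy hy0
    · have := hP x hx hx0
      by_cases hy0 : y = 0
      · simpa [hy0] using this
      · linarith [hP' y hy hy0]
  · intro z hz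
    obtain ⟨x, hx, y, hy, rfl⟩ := Submodule.mem_sup.1 hz
    have h1 := h x (hNW hx) y (hNW' hy)
    have h2 : B (x + y) (x + y) = B x x + B y y := by
      simp [hB y x, h1]
    rw [h2]
    linarith [hN x hx, hN' y hy]
  · have hd : P ⊓ P' = ⊥ := by
      rw [eq_bot_iff]
      intro x hx
      by_contra hx0
      have h1 := hP x hx.1 (by simpa using hx0)
      have h2 := h x (hPW hx.1) x (hPW' hx.2)
      linarith
    have h1 := Submodule.finrank_sup_add_finrank_inf_eq P P'
    rw [hd, finrank_bot] at h1
    omega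

/-- The map `f` need not be injective: preserving a form that is definite on `P` already makes it
injective on `P`, which is all that the dimension count needs. -/
theorem HasPosIndex.map {W : Submodule ℝ E} {p : ℕ}
    (hp : HasPosIndex B W p) (f : E →ₗ[ℝ] E') (hf : ∀ x y, B' (f x) (f y) = B x y) :
    HasPosIndex B' (W.map f) p := by
  obtain ⟨P, N, hW, hP, hN, rfl⟩ := hp
  refine ⟨P.map f, N.map f, ?_, ?_, ?_, ?_⟩
  · rw [← hW, Submodule.map_sup]
  · rintro _ ⟨x, hx, rfl⟩ hx0
    rw [hf]
    exact hP x hx (by rintro rfl; simp at hx0)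
  · rintro _ ⟨x, hx, rfl⟩
    rw [hf]
    exact hN x hx
  · rw [← LinearMap.range_domRestrict]
    apply LinearMap.finrank_range_of_inj
    rintro ⟨x, hx⟩ ⟨y, hy⟩ hxy
    simp only [LinearMap.domRestrict_apply] at hxy
    by_contra hne
    have h1 := hP (x - y) (P.sub_mem hx hy) (sub_ne_zero.2 fun h => hne (Subtype.ext h))
    rw [← hf, map_sub, hxy, sub_self] at h1
    simp at h1

theorem hasPosIndex_bot : HasPosIndex B ⊥ 0 :=
  ⟨⊥, ⊥, by simp, by simp, by simp, by simp⟩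

open Classical in
theorem hasPosIndex_span_singleton (x : E) :
    HasPosIndex B (Submodule.span ℝ {x}) (if 0 < B x x then 1 else 0) := by
  split_ifs with h
  · refine ⟨Submodule.span ℝ {x}, ⊥, by simp, ?_, by simp, ?_⟩
    · intro y hy hy0
      obtain ⟨c, rfl⟩ := Submodule.mem_span_singleton.1 hy
      have hc : c ≠ 0 := by rintro rfl; simp at hy0
      have : B (c • x) (c • x) = c ^ 2 * B x x := by simp; ring
      rw [this]
      positivity
    · apply finrank_span_singleton
      rintro rfl
      simp at h
  · refine ⟨⊥, Submodule.span ℝ {x}, by simp, by simp, ?_, by simp⟩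
    intro y hy
    obtain ⟨c, rfl⟩ := Submodule.mem_span_singleton.1 hy
    have : B (c • x) (c • x) = c ^ 2 * B x x := by simp; ring
    rw [this]
    nlinarith [sq_nonneg c]

/-- Since `n` is null, the square of `x + c n` is an affine function of `c` with slope `2 B x n ≠
0`; it takes the values `1` and `-1`, at two vectors which span the plane. -/
theorem hasPosIndex_hyperbolic (hB : ∀ x y, B x y = B y x) {x n : E} (hn : B n n = 0)
    (hx : B x n ≠ 0) : HasPosIndex B (Submodule.span ℝ {x, n}) 1 := by
  have key : ∀ c : ℝ, B (x + c • n) (x + c • n) = B x x + 2 * c * B x n := by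
    intro c
    simp [hB n x, hn]
    ring
  set c₁ := (1 - B x x) / (2 * B x n) with hc₁
  set c₂ := (-1 - B x x) / (2 * B x n) with hc₂
  have h1 : B (x + c₁ • n) (x + c₁ • n) = 1 := by
    rw [key, hc₁]; field_simp; ring
  have h2 : B (x + c₂ • n) (x + c₂ • n) = -1 := by
    rw [key, hc₂]; field_simp; ring
  have h12 : c₁ - c₂ ≠ 0 := by
    rw [hc₁, hc₂, ← sub_div]
    apply div_ne_zero
    · ring_nf; norm_num
    · simpa using hx
  refine ⟨Submodule.span ℝ {x + c₁ • n}, Submodule.span ℝ {x + c₂ • n}, ?_, ?_, ?_, ?_⟩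
  · apply le_antisymm
    · have hxm : x ∈ Submodule.span ℝ {x, n} := Submodule.subset_span (by simp)
      have hnm : n ∈ Submodule.span ℝ {x, n} := Submodule.subset_span (by simp)
      apply sup_le <;> rw [Submodule.span_singleton_le_iff_mem]
      · exact Submodule.add_mem _ hxm (Submodule.smul_mem _ _ hnm)
      · exact Submodule.add_mem _ hxm (Submodule.smul_mem _ _ hnm)
    · set S := Submodule.span ℝ {x + c₁ • n} ⊔ Submodule.span ℝ {x + c₂ • n}
      have hu : x + c₁ • n ∈ S := Submodule.mem_sup_left (Submodule.mem_span_singleton_self _)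
      have hv : x + c₂ • n ∈ S := Submodule.mem_sup_right (Submodule.mem_span_singleton_self _)
      have hnS : n ∈ S := by
        have h3 := S.smul_mem (c₁ - c₂)⁻¹ (S.sub_mem hu hv)
        have h4 : x + c₁ • n - (x + c₂ • n) = (c₁ - c₂) • n := by module
        rwa [h4, smul_smul, inv_mul_cancel₀ h12, one_smul] at h3
      have hxS : x ∈ S := by
        have h3 := S.sub_mem hu (S.smul_mem c₁ hnS)
        rwa [add_sub_cancel_right] at h3
      rw [Submodule.span_le]
      rintro y (rfl | rfl)
      · exact hxS
      · exact hnS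
  · intro y hy hy0
    obtain ⟨c, rfl⟩ := Submodule.mem_span_singleton.1 hy
    have hc : c ≠ 0 := by rintro rfl; simp at hy0
    have : B (c • (x + c₁ • n)) (c • (x + c₁ • n)) = c ^ 2 * B (x + c₁ • n) (x + c₁ • n) := by
      rw [map_smul, map_smul, LinearMap.smul_apply, smul_eq_mul, smul_eq_mul]; ring
    rw [this, h1]
    positivity
  · intro y hy
    obtain ⟨c, rfl⟩ := Submodule.mem_span_singleton.1 hy
    have : B (c • (x + c₂ • n)) (c • (x + c₂ • n)) = c ^ 2 * B (x + c₂ • n) (x + c₂ • n) := by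
      rw [map_smul, map_smul, LinearMap.smul_apply, smul_eq_mul, smul_eq_mul]; ring
    rw [this, h2]
    nlinarith [sq_nonneg c]
  · apply finrank_span_singleton
    intro h0
    rw [h0] at h1
    simp at h1

open Classical in
theorem hasPosIndex_biSup_span [FiniteDimensional ℝ E] (hB : ∀ x y, B x y = B y x) {ι : Type*}
    (v : ι → E) (hv : ∀ i j, i ≠ j → B (v i) (v j) = 0) (s : Finset ι) :
    HasPosIndex B (Submodule.span ℝ (v '' s)) (s.filter fun i => 0 < B (v i) (v i)).card := by
  induction s using Finset.induction_on with
  | empty => simpa using hasPosIndex_bot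
  | insert a s ha ih =>
    have h := (hasPosIndex_span_singleton (B := B) (v a)).sup hB ih (by
      intro x hx y hy
      obtain ⟨c, rfl⟩ := Submodule.mem_span_singleton.1 hx
      induction hy using Submodule.span_induction with
      | mem y hy =>
        obtain ⟨i, hi, rfl⟩ := hy
        have : a ≠ i := by rintro rfl; exact ha (by simpa using hi)
        simp [hv a i this]
      | zero => simp
      | add y z _ _ h1 h2 => simp only [map_add, h1, h2, add_zero]
      | smul c y _ h1 => rw [map_smul, h1, smul_zero])
    rw [← Submodule.span_union, Set.singleton_union, ← Set.image_insert_eq] at h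
    rw [Finset.filter_insert]
    convert h using 1
    · simp
    · split_ifs with h0
      · rw [Finset.card_insert_of_notMem (by simp [ha])]; ring
      · simp

end Inertia

/-- The real bilinear form of an integer matrix. -/
def realForm {n : Type*} [Fintype n] [DecidableEq n] (A : Matrix n n ℤ) :
    LinearMap.BilinForm ℝ (n → ℝ) :=
  Matrix.toBilin' (A.map (Int.cast : ℤ → ℝ))

section MatrixIndex

variable {n : Type*} [Fintype n] [DecidableEq n] {A : Matrix n n ℤ}

theorem realForm_apply (x y : n → ℝ) :
    realForm A x y = x ⬝ᵥ (A.map (Int.cast : ℤ → ℝ)).mulVec y := by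
  simp [realForm, Matrix.toBilin'_apply']

theorem realForm_single (i j : n) :
    realForm A (Pi.single i 1) (Pi.single j 1) = A i j := by
  simp [realForm]

theorem realForm_symm (hA : A.IsSymm) (x y : n → ℝ) : realForm A x y = realForm A y x := by
  rw [realForm_apply, realForm_apply, Matrix.dotProduct_mulVec, dotProduct_comm,
    ← Matrix.mulVec_transpose, ← Matrix.transpose_map, hA]

/-- An orthonormal eigenbasis diagonalises the form. This translates counts of roots of the
characteristic polynomial into indices of inertia, which can be computed by elimination. -/
theorem hasPosIndex_realForm (hA : A.IsSymm) :
    HasPosIndex (realForm A) ⊤ (posEigenCount A) ∧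
      HasPosIndex (-realForm A) ⊤ (negEigenCount A) := by
  classical
  have hH : (A.map (Int.cast : ℤ → ℝ)).IsHermitian := by
    rw [Matrix.IsHermitian, Matrix.conjTranspose_eq_transpose_of_trivial, ← Matrix.transpose_map,
      hA]
  set v : n → (n → ℝ) := fun i => (hH.eigenvectorBasis i).ofLp with hv
  have hvv : ∀ i j, realForm A (v i) (v j) = if i = j then hH.eigenvalues i else 0 := by
    intro i j
    rw [realForm_apply]
    have h1 := hH.mulVec_eigenvectorBasis j
    have h2 := hH.eigenvectorBasis.inner_eq_ite i j
    rw [hv]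
    simp only
    rw [h1, dotProduct_smul]
    have h3 : (hH.eigenvectorBasis i).ofLp ⬝ᵥ (hH.eigenvectorBasis j).ofLp =
        if i = j then (1 : ℝ) else 0 := by
      rw [← h2, EuclideanSpace.inner_eq_star_dotProduct, dotProduct_comm]
      simp
    rw [h3]
    split_ifs with h
    · simp [h]
    · simp
  have hspan : Submodule.span ℝ (v '' (Finset.univ : Finset n)) = ⊤ := by
    have h1 := hH.eigenvectorBasis.toBasis.span_eq
    have h2 := congrArg (Submodule.map (WithLp.linearEquiv 2 ℝ (n → ℝ)).toLinearMap) h1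
    rw [Submodule.map_span, Submodule.map_top, LinearEquiv.range] at h2
    rw [← h2]
    congr 1
    ext x
    simp [hv]
  constructor
  · have h := hasPosIndex_biSup_span (B := realForm A) (realForm_symm hA) v
      (fun i j hij => by rw [hvv, if_neg hij]) Finset.univ
    rw [hspan] at h
    convert h using 1
    rw [posEigenCount, hH.roots_charpoly_eq_eigenvalues, Multiset.filter_map, Multiset.card_map]
    simp only [hvv]
    rfl
  · have h := hasPosIndex_biSup_span (B := -realForm A)
      (fun x y => by simp [realForm_symm hA x y]) v
      (fun i j hij => by simp [hvv, hij]) Finset.univ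
    rw [hspan] at h
    convert h using 1
    rw [negEigenCount, hH.roots_charpoly_eq_eigenvalues, Multiset.filter_map, Multiset.card_map]
    simp only [hvv, LinearMap.neg_apply, Left.neg_pos_iff]
    rfl

end MatrixIndex

/-! ### Continued fractions of chains -/

theorem subInv_infty (m : ℤ) : subInv m OnePoint.infty = ((m : ℚ) : OnePoint ℚ) := rfl

theorem subInv_coe (m : ℤ) (x : ℚ) : subInv m (x : OnePoint ℚ) =
    if x = 0 then OnePoint.infty else (((m : ℚ) - x⁻¹ : ℚ) : OnePoint ℚ) := rfl

theorem subInv_coe_of_ne_zero (m : ℤ) {x : ℚ} (hx : x ≠ 0) :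
    subInv m (x : OnePoint ℚ) = (((m : ℚ) - x⁻¹ : ℚ) : OnePoint ℚ) := by
  rw [subInv_coe, if_neg hx]

theorem subInv_zero (m : ℤ) : subInv m ((0 : ℚ) : OnePoint ℚ) = OnePoint.infty := by
  rw [subInv_coe, if_pos rfl]

theorem subInv_eq_infty_iff {m : ℤ} {y : OnePoint ℚ} :
    subInv m y = OnePoint.infty ↔ y = ((0 : ℚ) : OnePoint ℚ) := by
  induction y using OnePoint.rec with
  | infty => simp [subInv_infty]
  | coe x =>
    rw [subInv_coe]
    split_ifs with h
    · simp [h]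
    · simp [h]

/-- `1` if `y` is positive or infinite, `0` otherwise. -/
def posIndicator : OnePoint ℚ → ℕ
  | OnePoint.infty => 1
  | OnePoint.some x => if 0 < x then 1 else 0

theorem posIndicator_infty : posIndicator OnePoint.infty = 1 := rfl

theorem posIndicator_coe (x : ℚ) : posIndicator (x : OnePoint ℚ) = if 0 < x then 1 else 0 := rfl

/-- The number of positive eigenvalues of the linking matrix of a chain with given weights. -/
def chainPos : List ℤ → ℕ
  | [] => 0
  | m :: l => chainPos l + posIndicator (contFrac (m :: l))

theorem contFrac_cons (m : ℤ) (l : List ℤ) : contFrac (m :: l) = subInv m (contFrac l) := rfl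

theorem chainPos_cons (m : ℤ) (l : List ℤ) :
    chainPos (m :: l) = chainPos l + posIndicator (contFrac (m :: l)) := rfl

/-- Numerator and denominator of the continued fraction of a chain. -/
def chainNum : List ℤ → ℤ × ℤ
  | [] => (1, 0)
  | m :: l => (m * (chainNum l).1 - (chainNum l).2, (chainNum l).1)

/-- If numerator and denominator vanished together, they would do so for every tail, down to the
empty chain with `(1, 0)`. So `0/0` never arises. -/
theorem chainNum_ne_zero (l : List ℤ) : (chainNum l).1 = 0 → (chainNum l).2 ≠ 0 := by
  induction l with
  | nil => simp [chainNum]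
  | cons m l ih =>
    intro h h'
    simp only [chainNum] at h h'
    rw [h'] at h
    exact ih h' (by simpa using h)

theorem contFrac_eq (l : List ℤ) : contFrac l =
    if (chainNum l).2 = 0 then OnePoint.infty
    else ((((chainNum l).1 : ℚ) / ((chainNum l).2 : ℚ) : ℚ) : OnePoint ℚ) := by
  induction l with
  | nil => simp [contFrac, chainNum]
  | cons m l ih =>
    rw [contFrac_cons, ih]
    change _ = if (chainNum l).1 = 0 then OnePoint.infty
      else ((((m * (chainNum l).1 - (chainNum l).2 : ℤ) : ℚ) / ((chainNum l).1 : ℚ) : ℚ) :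
        OnePoint ℚ)
    have hne := chainNum_ne_zero l
    by_cases h2 : (chainNum l).2 = 0
    · have h1 : (chainNum l).1 ≠ 0 := fun h => hne h h2
      have h1' : ((chainNum l).1 : ℚ) ≠ 0 := by exact_mod_cast h1
      rw [if_pos h2, if_neg h1, subInv_infty, h2]
      congr 1
      push_cast
      field_simp
      ring
    · have h2' : ((chainNum l).2 : ℚ) ≠ 0 := by exact_mod_cast h2
      rw [if_neg h2]
      by_cases h1 : (chainNum l).1 = 0
      · rw [if_pos h1, h1]
        simp [subInv_zero]
      · have h1' : ((chainNum l).1 : ℚ) ≠ 0 := by exact_mod_cast h1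
        rw [if_neg h1, subInv_coe_of_ne_zero _ (div_ne_zero h1' h2')]
        congr 1
        push_cast
        field_simp

/-- The chains `l` and `l'`, hanging from a vertex whose weight is increased by `j`, have the same
continued fractions, and the numbers of their positive eigenvalues have parities that differ by
the sign `s`. -/
def ChainRel (s : ℤˣ) (j : ℤ) (l l' : List ℤ) : Prop :=
  (∀ m, subInv (m + j) (contFrac l') = subInv m (contFrac l)) ∧
    (-1 : ℤˣ) ^ chainPos l' = s * (-1) ^ chainPos l

theorem ChainRel.refl (l : List ℤ) : ChainRel 1 0 l l := ⟨by simp, by simp⟩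

theorem ChainRel.cons {s : ℤˣ} {j : ℤ} {l l' : List ℤ} (h : ChainRel s j l l') (m : ℤ) :
    ChainRel s 0 (m :: l) ((m + j) :: l') := by
  have h1 : contFrac ((m + j) :: l') = contFrac (m :: l) := h.1 m
  refine ⟨fun m' => by rw [h1, add_zero], ?_⟩
  rw [chainPos_cons, chainPos_cons, h1, pow_add, pow_add, h.2, mul_assoc]

theorem ChainRel.append {s : ℤˣ} {l l' : List ℤ} (h : ChainRel s 0 l l') (l₀ : List ℤ) :
    ChainRel s 0 (l₀ ++ l) (l₀ ++ l') := by
  induction l₀ with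
  | nil => exact h
  | cons m l₀ ih => simpa using ih.cons m

/-- A fraction vanishes exactly when placing it under any further weight gives `∞`, and the relation
controls precisely these larger fractions. -/
theorem ChainRel.contFrac_eq_zero_iff {s : ℤˣ} {j : ℤ} {l l' : List ℤ} (h : ChainRel s j l l') :
    contFrac l' = ((0 : ℚ) : OnePoint ℚ) ↔ contFrac l = ((0 : ℚ) : OnePoint ℚ) := by
  rw [← subInv_eq_infty_iff (m := 0 + j), ← subInv_eq_infty_iff (m := 0), h.1]

theorem exists_subInv_eq_int_iff (m m' : ℤ) (y : OnePoint ℚ) :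
    (∃ k : ℤ, subInv m y = ((k : ℚ) : OnePoint ℚ)) →
      ∃ k : ℤ, subInv m' y = ((k : ℚ) : OnePoint ℚ) := by
  rintro ⟨k, hk⟩
  induction y using OnePoint.rec with
  | infty => exact ⟨m', rfl⟩
  | coe x =>
    by_cases hx : x = 0
    · subst hx
      rw [subInv_zero] at hk
      exact absurd hk.symm (OnePoint.coe_ne_infty _)
    · rw [subInv_coe_of_ne_zero _ hx, OnePoint.coe_eq_coe] at hk
      refine ⟨m' - m + k, ?_⟩
      rw [subInv_coe_of_ne_zero _ hx, OnePoint.coe_eq_coe]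
      push_cast
      linarith

open Classical in
/-- The sign of a chain ending in a leaf: zero unless the chain forms a pseudo branch. -/
def leafSign (l : List ℤ) : ℤ :=
  if ∃ k : ℤ, subInv 0 (contFrac l) = ((k : ℚ) : OnePoint ℚ) then
    (((-1 : ℤˣ) ^ chainPos l : ℤˣ) : ℤ)
  else 0

theorem ChainRel.leafSign_eq {s : ℤˣ} {j : ℤ} {l l' : List ℤ} (h : ChainRel s j l l') :
    leafSign l' = s * leafSign l := by
  have h1 : (∃ k : ℤ, subInv 0 (contFrac l') = ((k : ℚ) : OnePoint ℚ)) ↔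
      ∃ k : ℤ, subInv 0 (contFrac l) = ((k : ℚ) : OnePoint ℚ) := by
    rw [← h.1 0]
    exact ⟨exists_subInv_eq_int_iff _ _ _, exists_subInv_eq_int_iff _ _ _⟩
  unfold leafSign
  by_cases h2 : ∃ k : ℤ, subInv 0 (contFrac l) = ((k : ℚ) : OnePoint ℚ)
  · rw [if_pos h2, if_pos (h1.2 h2), h.2, Units.val_mul]
  · rw [if_neg h2, if_neg (h1.not.2 h2), mul_zero]

/-- Since `ε² = 1`, a pendant vertex of weight `ε` subtracts `1/ε = ε`, which the raised weight
compensates. -/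
theorem chainRel_nil_unit (ε : ℤˣ) : ChainRel (-ε) ε [] [(ε : ℤ)] := by
  constructor
  · intro m
    have h0 : ((ε : ℤ) : ℚ) ≠ 0 := by exact_mod_cast ε.ne_zero
    have h1 : contFrac [(ε : ℤ)] = (((ε : ℤ) : ℚ) : OnePoint ℚ) := rfl
    rw [h1, subInv_coe_of_ne_zero _ h0]
    change _ = ((m : ℚ) : OnePoint ℚ)
    congr 1
    rcases Int.units_eq_one_or ε with rfl | rfl <;> norm_num
  · rcases Int.units_eq_one_or ε with rfl | rfl
    · simp [chainPos, contFrac, subInv_infty, posIndicator_coe]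
    · simp [chainPos, contFrac, subInv_infty, posIndicator_coe]

theorem neg_one_pow_posIndicator (x : ℚ) :
    (-1 : ℤˣ) ^ posIndicator (x : OnePoint ℚ) = if 0 < x then -1 else 1 := by
  rw [posIndicator_coe]; split_ifs <;> simp

/-- With `z = [a, l]`, one has `ε - 1/(z + ε) = εz/(z + ε)`, and `m + ε - (z + ε)/(εz) = m - 1/z`. A
check of the signs of `z`, `z + ε` and `εz/(z + ε)` gives the parity. -/
theorem chainRel_blowUp (ε : ℤˣ) (a : ℤ) (l : List ℤ) :
    ChainRel (-ε) ε (a :: l) ((ε : ℤ) :: (a + ε) :: l) := by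
  have key : ∀ y : OnePoint ℚ, ∃ y₁ y₂ : OnePoint ℚ,
      subInv (a + ε) y = y₁ ∧ subInv ε y₁ = y₂ ∧
      (∀ m : ℤ, subInv (m + ε) y₂ = subInv m (subInv a y)) ∧
      (-1 : ℤˣ) ^ (posIndicator y₁ + posIndicator y₂) =
        -ε * (-1) ^ posIndicator (subInv a y) := by
    intro y
    refine ⟨_, _, rfl, rfl, ?_⟩
    -- Raising the leading weight translates every finite value by `ε`.
    have hz : ∀ z : ℚ, subInv a y = (z : OnePoint ℚ) →
        subInv (a + ε) y = ((z + ((ε : ℤ) : ℚ) : ℚ) : OnePoint ℚ) := by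
      intro z hz
      induction y using OnePoint.rec with
      | infty =>
        rw [subInv_infty, OnePoint.coe_eq_coe] at hz
        rw [subInv_infty, OnePoint.coe_eq_coe, ← hz]
        push_cast; ring
      | coe x =>
        by_cases hx : x = 0
        · subst hx; rw [subInv_zero] at hz; exact absurd hz (OnePoint.infty_ne_coe _)
        · rw [subInv_coe_of_ne_zero _ hx, OnePoint.coe_eq_coe] at hz
          rw [subInv_coe_of_ne_zero _ hx, OnePoint.coe_eq_coe, ← hz]
          push_cast; ring
    generalize hY : subInv a y = Y at hz
    induction Y using OnePoint.rec with
    | infty =>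
      have h1 : subInv (a + ε) y = OnePoint.infty := by
        rw [subInv_eq_infty_iff] at hY ⊢; exact hY
      have h0 : ((ε : ℤ) : ℚ) ≠ 0 := by exact_mod_cast ε.ne_zero
      rw [h1, subInv_infty]
      constructor
      · intro m
        rw [subInv_coe_of_ne_zero _ h0, subInv_infty]
        congr 1
        rcases Int.units_eq_one_or ε with rfl | rfl <;> norm_num
      · rw [pow_add, neg_one_pow_posIndicator]
        rcases Int.units_eq_one_or ε with rfl | rfl <;> norm_num [posIndicator_infty]
    | coe z =>
      rw [hz z rfl]
      -- In this degenerate case the inner fraction is `0` and the next one is `∞`, so the whole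
      -- collapses to `m + ε = m - 1/z`.
      by_cases h : z + ((ε : ℤ) : ℚ) = 0
      · rw [h, subInv_zero]
        have hz0 : z = -((ε : ℤ) : ℚ) := by linarith
        constructor
        · intro m
          have hz1 : z ≠ 0 := by rw [hz0]; simp
          rw [subInv_coe_of_ne_zero _ hz1, subInv_infty, hz0]
          congr 1
          rcases Int.units_eq_one_or ε with rfl | rfl <;> norm_num
          ring
        · rw [pow_add, neg_one_pow_posIndicator, neg_one_pow_posIndicator, hz0]
          rcases Int.units_eq_one_or ε with rfl | rfl <;> norm_num [posIndicator_infty]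
      · rw [subInv_coe_of_ne_zero _ h]
        have hval : ((ε : ℤ) : ℚ) - (z + ((ε : ℤ) : ℚ))⁻¹ = ((ε : ℤ) : ℚ) * z / (z + (ε : ℤ)) := by
          field_simp
          rcases Int.units_eq_one_or ε with rfl | rfl <;> norm_num
        rw [hval]
        constructor
        · intro m
          by_cases hz1 : z = 0
          · subst hz1
            simp [subInv_zero]
          · rw [subInv_coe_of_ne_zero _ hz1, subInv_coe_of_ne_zero]
            · congr 1
              rcases Int.units_eq_one_or ε with rfl | rfl
              · push_cast at h ⊢; field_simp; ring
              · push_cast at h ⊢; field_simp; ring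
            · apply div_ne_zero _ h
              apply mul_ne_zero _ hz1
              simp
        · rw [pow_add, neg_one_pow_posIndicator, neg_one_pow_posIndicator,
            neg_one_pow_posIndicator]
          rcases Int.units_eq_one_or ε with rfl | rfl
          · push_cast at h ⊢
            rw [one_mul]
            rcases lt_trichotomy z 0 with h1 | h1 | h1
            · rw [if_neg h1.not_gt]
              rcases lt_or_gt_of_ne h with h2 | h2
              · rw [if_neg h2.not_gt, if_pos (div_pos_of_neg_of_neg h1 h2)]; simp
              · rw [if_pos h2, if_neg (div_neg_of_neg_of_pos h1 h2).not_gt]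
            · subst h1; simp
            · have h2 : 0 < z + 1 := by linarith
              rw [if_pos h2, if_pos (div_pos h1 h2), if_pos h1]
          · push_cast at h ⊢
            rcases lt_trichotomy z 0 with h1 | h1 | h1
            · have h2 : z + -1 < 0 := by linarith
              rw [if_neg h1.not_gt, if_neg h2.not_gt,
                if_neg (div_neg_of_pos_of_neg (by linarith) h2).not_gt]; simp
            · subst h1; norm_num
            · rw [if_pos h1]
              rcases lt_or_gt_of_ne h with h2 | h2
              · rw [if_neg h2.not_gt, if_pos (div_pos_of_neg_of_neg (by simpa using h1) h2)]; simp
              · rw [if_pos h2, if_neg (div_neg_of_neg_of_pos (by simpa using h1) h2).not_gt]; simp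
  obtain ⟨y₁, y₂, h1, h2, h3, h4⟩ := key (contFrac l)
  constructor
  · intro m
    rw [contFrac_cons, contFrac_cons, h1, h2, h3, contFrac_cons]
  · simp only [chainPos_cons, contFrac_cons, h1, h2]
    rw [add_assoc, pow_add, h4, pow_add]
    exact mul_left_comm _ _ _ |>.trans (by rw [mul_comm (_ ^ chainPos l)])

/-- With `y = [m, l]`, two inversions give `m' - m + y = m' - 1/[l]`. Of `y` and `-1/y` exactly one
is positive, and in the pair `0, ∞` only `∞` counts as positive; hence the sign `-1`. -/
theorem chainRel_zero (m : ℤ) (l : List ℤ) : ChainRel (-1) (-m) l (0 :: m :: l) := by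
  have h1 : ∀ y : OnePoint ℚ, (∀ m', subInv (m' + -m) (subInv 0 (subInv m y)) = subInv m' y) ∧
      posIndicator (subInv m y) + posIndicator (subInv 0 (subInv m y)) = 1 := by
    intro y
    have hz : ∀ m' : ℤ, ∀ z : ℚ, subInv m y = (z : OnePoint ℚ) →
        subInv m' y = ((m' - m + z : ℚ) : OnePoint ℚ) := by
      intro m' z hz
      induction y using OnePoint.rec with
      | infty =>
        rw [subInv_infty, OnePoint.coe_eq_coe] at hz
        rw [subInv_infty, OnePoint.coe_eq_coe, ← hz]
        ring
      | coe x =>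
        by_cases hx : x = 0
        · subst hx; rw [subInv_zero] at hz; exact absurd hz (OnePoint.infty_ne_coe _)
        · rw [subInv_coe_of_ne_zero _ hx, OnePoint.coe_eq_coe] at hz
          rw [subInv_coe_of_ne_zero _ hx, OnePoint.coe_eq_coe, ← hz]
          ring
    generalize hY : subInv m y = Y at hz
    induction Y using OnePoint.rec with
    | infty =>
      rw [subInv_infty]
      constructor
      · intro m'
        rw [subInv_eq_infty_iff] at hY
        rw [hY, subInv_zero]
        simp [subInv_zero]
      · simp [posIndicator_infty, posIndicator_coe]
    | coe z =>
      by_cases h0 : z = 0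
      · subst h0
        rw [subInv_zero]
        constructor
        · intro m'
          rw [hz m' 0 rfl, subInv_infty]
          congr 1
          push_cast; ring
        · simp [posIndicator_infty, posIndicator_coe]
      · rw [subInv_coe_of_ne_zero _ h0]
        constructor
        · intro m'
          rw [hz m' z rfl, subInv_coe_of_ne_zero _ (by simpa using h0)]
          congr 1
          push_cast
          simp
          ring
        · rw [posIndicator_coe, posIndicator_coe]
          rcases lt_or_gt_of_ne h0 with h | h
          · rw [if_neg h.not_gt, if_pos (by simpa using h)]
          · rw [if_pos h, if_neg (by simpa using h.le)]
  obtain ⟨h2, h3⟩ := h1 (contFrac l)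
  refine ⟨fun m' => h2 m', ?_⟩
  simp only [chainPos_cons, contFrac_cons]
  rw [add_assoc, h3, pow_succ]
  simp

/-! ### Paths in plumbing trees -/

namespace Plumbing

section PathList

variable {V : Type u} (Γ : Plumbing V)

/-- The list `l` consists of the successive vertices of a path. -/
def IsPathList (l : List V) : Prop := l.IsChain Γ.graph.Adj ∧ l.Nodup

variable {Γ}

theorem IsPathList.of_infix {l l' : List V} (h : Γ.IsPathList l) (h' : l' <:+: l) :
    Γ.IsPathList l' := ⟨h.1.infix h', h'.sublist.nodup h.2⟩

theorem IsPathList.reverse {l : List V} (h : Γ.IsPathList l) : Γ.IsPathList l.reverse := by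
  refine ⟨?_, List.nodup_reverse.2 h.2⟩
  rw [List.isChain_reverse]
  exact h.1.imp fun a b hab => hab.symm

theorem IsPathList.of_append_left {l l' : List V} (h : Γ.IsPathList (l ++ l')) :
    Γ.IsPathList l := h.of_infix (List.prefix_append _ _).isInfix

theorem IsPathList.of_append_right {l l' : List V} (h : Γ.IsPathList (l ++ l')) :
    Γ.IsPathList l' := h.of_infix (List.suffix_append _ _).isInfix

theorem IsPathList.of_cons {x : V} {l : List V} (h : Γ.IsPathList (x :: l)) :
    Γ.IsPathList l := h.of_infix (List.suffix_cons _ _).isInfix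

/-- Uniqueness of paths in a tree allows chosen paths to be replaced by explicit lists, which can be
cut, joined and mapped. -/
theorem pathVerts_eq_of_ne_nil {l : List V} (h : Γ.IsPathList l) (hne : l ≠ []) :
    Γ.pathVerts (l.head hne) (l.getLast hne) = l := by
  have h1 : (SimpleGraph.Walk.ofSupport l hne h.1).IsPath := by
    rw [SimpleGraph.Walk.isPath_def, SimpleGraph.Walk.support_ofSupport]
    exact h.2
  have h2 := (Γ.isTree.existsUnique_path (l.head hne) (l.getLast hne)).choose_spec.2 _ h1
  unfold pathVerts path
  rw [← h2, SimpleGraph.Walk.support_ofSupport]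

theorem IsPathList.pathVerts_eq {w v : V} {i : List V} (h : Γ.IsPathList (w :: (i ++ [v]))) :
    Γ.pathVerts w v = w :: (i ++ [v]) := by
  have := pathVerts_eq_of_ne_nil h (by simp)
  simpa using this

theorem IsPathList.interiorVerts_eq {w v : V} {i : List V} (h : Γ.IsPathList (w :: (i ++ [v]))) :
    Γ.interiorVerts w v = i := by
  rw [interiorVerts, h.pathVerts_eq]
  simp

theorem IsPathList.ext {w v : V} {i i' : List V} (h : Γ.IsPathList (w :: (i ++ [v])))
    (h' : Γ.IsPathList (w :: (i' ++ [v]))) : i = i' :=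
  h.interiorVerts_eq.symm.trans h'.interiorVerts_eq

theorem exists_isPathList {w v : V} (hwv : w ≠ v) : ∃ i, Γ.IsPathList (w :: (i ++ [v])) := by
  have hp := (Γ.isTree.existsUnique_path w v).choose_spec.1
  set p := (Γ.isTree.existsUnique_path w v).choose
  have h1 : Γ.IsPathList p.support := ⟨p.isChain_adj_support, hp.support_nodup⟩
  obtain ⟨l, hl⟩ : ∃ l, p.support = w :: l := ⟨_, p.cons_tail_support.symm⟩
  have hlast : p.support.getLast p.support_ne_nil = v := p.getLast_support
  have hl0 : l ≠ [] := by
    rintro rfl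
    simp [hl] at hlast
    exact hwv hlast
  refine ⟨l.dropLast, ?_⟩
  have h2 : l.dropLast ++ [v] = l := by
    have h3 : l.getLast hl0 = v := by
      simp only [hl] at hlast
      rwa [List.getLast_cons hl0] at hlast
    rw [← h3, List.dropLast_append_getLast]
  rw [h2, ← hl]
  exact h1

/-- A chord would be a second path with the same ends. -/
theorem IsPathList.not_adj {x h : V} {t : List V} (hl : Γ.IsPathList (x :: h :: t)) {y : V}
    (hy : y ∈ t) : ¬Γ.graph.Adj x y := by
  intro hxy
  obtain ⟨t₁, t₂, rfl⟩ := List.append_of_mem hy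
  have h1 : Γ.IsPathList (x :: ((h :: t₁) ++ [y])) := by
    apply hl.of_infix
    refine ⟨[], t₂, by simp⟩
  have h2 : Γ.IsPathList (x :: ([] ++ [y])) := by
    refine ⟨by simpa using hxy, by simpa using hxy.ne⟩
  have := h1.ext h2
  simp at this

theorem IsPathList.adj_head {x h : V} {t : List V} (hl : Γ.IsPathList (x :: h :: t)) :
    Γ.graph.Adj x h := hl.1.rel

end PathList

/-! ### Degrees of vertices along paths -/

section Degree

variable {V : Type u} [Fintype V] {Γ : Plumbing V}

theorem two_le_deg {x a b : V} (ha : Γ.graph.Adj x a) (hb : Γ.graph.Adj x b) (hab : a ≠ b) :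
    2 ≤ Γ.deg x := by
  classical
  rw [deg, ← SimpleGraph.card_neighborFinset_eq_degree, ← Finset.card_pair hab]
  apply Finset.card_le_card
  intro y hy
  simp only [Finset.mem_insert, Finset.mem_singleton] at hy
  rcases hy with rfl | rfl <;> simpa

theorem eq_or_eq_of_deg_eq_two {x a b c : V} (h : Γ.deg x = 2) (ha : Γ.graph.Adj x a)
    (hb : Γ.graph.Adj x b) (hab : a ≠ b) (hc : Γ.graph.Adj x c) : c = a ∨ c = b := by
  classical
  by_contra hcon
  push Not at hcon
  have h3 : ({c, a, b} : Finset V).card ≤ Γ.deg x := by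
    rw [deg, ← SimpleGraph.card_neighborFinset_eq_degree]
    apply Finset.card_le_card
    intro y hy
    simp only [Finset.mem_insert, Finset.mem_singleton] at hy
    rcases hy with rfl | rfl | rfl <;> simpa
  rw [Finset.card_insert_of_notMem (by simp [hcon]), Finset.card_pair hab] at h3
  omega

theorem eq_of_deg_eq_one {x a b : V} (h : Γ.deg x = 1) (ha : Γ.graph.Adj x a)
    (hb : Γ.graph.Adj x b) : a = b := by
  by_contra hab
  have := two_le_deg ha hb hab
  omega

theorem deg_pos {x a : V} (ha : Γ.graph.Adj x a) : 0 < Γ.deg x := by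
  classical
  rw [deg, SimpleGraph.degree_pos_iff_exists_adj]
  exact ⟨a, ha⟩

theorem IsPathList.two_le_deg {w v x : V} {i : List V} (h : Γ.IsPathList (w :: (i ++ [v])))
    (hx : x ∈ i) : 2 ≤ Γ.deg x := by
  obtain ⟨t₁, t₂, rfl⟩ := List.append_of_mem hx
  obtain ⟨a, l₁, h1⟩ : ∃ a l₁, w :: t₁ = l₁ ++ [a] := by
    rcases List.eq_nil_or_concat (w :: t₁) with h0 | ⟨l, a, h0⟩
    · simp at h0
    · exact ⟨a, l, by simpa using h0⟩
  obtain ⟨b, l₂, h2⟩ : ∃ b l₂, t₂ ++ [v] = b :: l₂ := by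
    cases t₂ with
    | nil => exact ⟨v, [], rfl⟩
    | cons b t => exact ⟨b, _, rfl⟩
  have h3 : w :: (t₁ ++ x :: t₂ ++ [v]) = l₁ ++ ([a, x, b] ++ l₂) := by
    have : w :: (t₁ ++ x :: t₂ ++ [v]) = (w :: t₁) ++ (x :: (t₂ ++ [v])) := by simp
    rw [this, h1, h2]
    simp
  rw [h3] at h
  have h4 := h.of_append_right.of_append_left
  have h5 := h4.1
  have h6 := h4.2
  simp only [List.isChain_cons_cons, List.nodup_cons, List.mem_cons] at h5 h6
  exact Plumbing.two_le_deg h5.1.symm h5.2.1 (by tauto)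

end Degree

/-! ### Positive eigenvalues of chains -/

section ChainIndex

variable {V : Type u} [Fintype V] [DecidableEq V] {Γ : Plumbing V}

theorem linkingMatrix_isSymm : Γ.linkingMatrix.IsSymm := by
  ext v w
  simp only [Matrix.transpose_apply, linkingMatrix, Matrix.of_apply]
  by_cases h : v = w
  · subst h; rfl
  · rw [if_neg h, if_neg (Ne.symm h)]
    rw [Γ.graph.adj_comm]

theorem linkingMatrix_self (v : V) : Γ.linkingMatrix v v = Γ.weight v := by simp [linkingMatrix]

open Classical in
theorem linkingMatrix_of_ne {v w : V} (h : v ≠ w) :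
    Γ.linkingMatrix v w = if Γ.graph.Adj v w then 1 else 0 := by simp [linkingMatrix, h]

theorem linkingMatrix_of_adj {v w : V} (h : Γ.graph.Adj v w) : Γ.linkingMatrix v w = 1 := by
  rw [linkingMatrix_of_ne h.ne, if_pos h]

theorem linkingMatrix_of_not_adj {v w : V} (h : v ≠ w) (h' : ¬Γ.graph.Adj v w) :
    Γ.linkingMatrix v w = 0 := by
  rw [linkingMatrix_of_ne h, if_neg h']

end ChainIndex
end Plumbing

theorem bilinForm_eq_realForm {n : Type*} [Fintype n] [DecidableEq n] {A : Matrix n n ℤ}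
    {E : Type*} [AddCommGroup E] [Module ℝ E] (B : LinearMap.BilinForm ℝ E)
    (f : (n → ℝ) →ₗ[ℝ] E)
    (h : ∀ i j, B (f (Pi.single i 1)) (f (Pi.single j 1)) = A i j) (x y : n → ℝ) :
    B (f x) (f y) = realForm A x y := by
  have : B.compl₁₂ f f = realForm A := by
    apply LinearMap.BilinForm.ext_basis (Pi.basisFun ℝ n)
    intro i j
    rw [Pi.basisFun_apply, Pi.basisFun_apply, LinearMap.compl₁₂_apply, h, realForm_single]
  rw [← this, LinearMap.compl₁₂_apply]

theorem posEigenCount_singleton (k : ℤ) :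
    posEigenCount !![k] = posIndicator (((k : ℚ)) : OnePoint ℚ) := by
  have hA : (!![k] : Matrix (Fin 1) (Fin 1) ℤ).IsSymm := by
    ext i j; fin_cases i; fin_cases j; rfl
  refine (hasPosIndex_realForm hA).1.unique ?_
  classical
  have h := hasPosIndex_span_singleton (B := realForm !![k]) (Pi.single (0 : Fin 1) (1 : ℝ))
  have h1 : Submodule.span ℝ {(Pi.single (0 : Fin 1) (1 : ℝ) : Fin 1 → ℝ)} = ⊤ := by
    rw [eq_top_iff]
    intro x _
    rw [Submodule.mem_span_singleton]
    refine ⟨x 0, ?_⟩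
    ext i
    fin_cases i
    simp
  rw [h1, realForm_single] at h
  rw [posIndicator_coe]
  convert h using 1
  simp

/-! ### Index of the linking form on the span of a path -/

namespace Plumbing
section ChainIndex

variable {V : Type u} [Fintype V] [DecidableEq V] {Γ : Plumbing V}

/-- The subspace spanned by the vertices of a list. -/
def vertexSpan (l : List V) : Submodule ℝ (V → ℝ) :=
  Submodule.span ℝ ((fun x => Pi.single x (1 : ℝ)) '' {x | x ∈ l})

theorem hasPosIndex_vertexSpan (Γ : Plumbing V) (l : List V) :
    HasPosIndex (realForm Γ.linkingMatrix) (vertexSpan l)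
      (posEigenCount (Γ.subLinkingMatrix l)) := by
  have hs : (Γ.subLinkingMatrix l).IsSymm := by
    rw [subLinkingMatrix]
    exact linkingMatrix_isSymm.submatrix _
  set f : (l.toFinset → ℝ) →ₗ[ℝ] (V → ℝ) :=
    Fintype.linearCombination ℝ (fun x : l.toFinset => Pi.single x.1 (1 : ℝ)) with hf
  have h := (hasPosIndex_realForm hs).1.map (B' := realForm Γ.linkingMatrix) f (by
    apply bilinForm_eq_realForm
    intro i j
    rw [hf, Fintype.linearCombination_apply_single, Fintype.linearCombination_apply_single,
      one_smul, one_smul, realForm_single]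
    rfl)
  convert h using 1
  rw [Submodule.map_top, hf, Fintype.range_linearCombination, vertexSpan]
  congr 1
  ext x
  simp

theorem single_mem_vertexSpan {l : List V} {x : V} (hx : x ∈ l) :
    Pi.single x (1 : ℝ) ∈ vertexSpan l := Submodule.subset_span ⟨x, hx, rfl⟩

theorem vertexSpan_mono {l l' : List V} (h : l ⊆ l') : vertexSpan l ≤ vertexSpan l' :=
  Submodule.span_mono (Set.image_mono fun _ hx => h hx)

theorem vertexSpan_cons (x : V) (l : List V) :
    vertexSpan (x :: l) = Submodule.span ℝ {Pi.single x (1 : ℝ)} ⊔ vertexSpan l := by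
  rw [vertexSpan, vertexSpan, ← Submodule.span_union]
  congr 1
  ext y
  simp [eq_comm]

theorem eq_zero_of_mem_vertexSpan {l : List V} {x : V} (hx : x ∉ l) {v : V → ℝ}
    (hv : v ∈ vertexSpan l) : v x = 0 := by
  induction hv using Submodule.span_induction with
  | mem y hy =>
    obtain ⟨z, hz, rfl⟩ := hy
    have : x ≠ z := by rintro rfl; exact hx hz
    simp [this]
  | zero => rfl
  | add y z _ _ h1 h2 => simp [h1, h2]
  | smul c y _ h1 => simp [h1]

theorem IsPathList.realForm_single_left {x h : V} {t : List V} (hl : Γ.IsPathList (x :: h :: t))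
    {v : V → ℝ} (hv : v ∈ vertexSpan (h :: t)) :
    realForm Γ.linkingMatrix (Pi.single x 1) v = v h := by
  induction hv using Submodule.span_induction with
  | mem y hy =>
    obtain ⟨z, hz, rfl⟩ := hy
    simp only [realForm_single]
    rcases List.mem_cons.1 hz with rfl | hz
    · simp [linkingMatrix_of_adj hl.adj_head]
    · have h1 : x ≠ z := by
        rintro rfl
        exact (List.nodup_cons.1 hl.2).1 (List.mem_cons_of_mem _ hz)
      have h2 : h ≠ z := by
        rintro rfl
        exact (List.nodup_cons.1 hl.of_cons.2).1 hz
      rw [linkingMatrix_of_not_adj h1 (hl.not_adj hz)]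
      simp [h2]
  | zero => simp
  | add y z _ _ h1 h2 => rw [map_add, h1, h2, Pi.add_apply]
  | smul c y _ h1 => rw [map_smul, h1, Pi.smul_apply]

/-- With `p/q` the continued fraction of the chain, `n` is orthogonal to everything below the head,
pairs to `p` with the head and has coordinate `q` there. The recursion `n = p e_h - n'`, with `n'`
the vector and `p` the numerator of the tail, mirrors that of `chainNum`. -/
theorem IsPathList.exists_chainVector {h : V} {t : List V} (hl : Γ.IsPathList (h :: t)) :
    ∃ n : V → ℝ, n - ((chainNum ((h :: t).map Γ.weight)).2 : ℝ) • Pi.single h 1 ∈ vertexSpan t ∧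
      (∀ y ∈ t, realForm Γ.linkingMatrix n (Pi.single y 1) = 0) ∧
      realForm Γ.linkingMatrix n (Pi.single h 1) = ((chainNum ((h :: t).map Γ.weight)).1 : ℝ) := by
  have hsymm := realForm_symm (A := Γ.linkingMatrix) linkingMatrix_isSymm
  induction t generalizing h with
  | nil =>
    refine ⟨Pi.single h 1, ?_, by simp, ?_⟩
    · simp [chainNum]
    · rw [realForm_single, linkingMatrix_self]
      simp [chainNum]
  | cons g t ih =>
    obtain ⟨n, hn1, hn2, hn3⟩ := ih hl.of_cons
    have hng : n ∈ vertexSpan (g :: t) := by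
      have h1 := Submodule.add_mem _ (vertexSpan_mono (List.subset_cons_self g t) hn1)
        (Submodule.smul_mem _ ((chainNum ((g :: t).map Γ.weight)).2 : ℝ)
          (single_mem_vertexSpan (List.mem_cons_self (a := g) (l := t))))
      simpa using h1
    have hgt : g ∉ t := (List.nodup_cons.1 hl.of_cons.2).1
    have hnv : n g = ((chainNum ((g :: t).map Γ.weight)).2 : ℝ) := by
      have h1 := eq_zero_of_mem_vertexSpan hgt hn1
      simpa [sub_eq_zero] using h1
    set p : ℝ := ((chainNum ((g :: t).map Γ.weight)).1 : ℝ) with hp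
    refine ⟨p • Pi.single h 1 - n, ?_, ?_, ?_⟩
    · have : ((chainNum ((h :: g :: t).map Γ.weight)).2 : ℝ) = p := rfl
      rw [this]
      simpa using hng
    · intro y hy
      rw [map_sub, map_smul, LinearMap.sub_apply, LinearMap.smul_apply,
        hl.realForm_single_left (single_mem_vertexSpan hy)]
      rcases List.mem_cons.1 hy with rfl | hy
      · rw [hn3]; simp
      · have h2 : g ≠ y := by rintro rfl; exact hgt hy
        rw [hn2 y hy]
        simp [h2]
    · rw [map_sub, map_smul, LinearMap.sub_apply, LinearMap.smul_apply, hsymm n,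
        hl.realForm_single_left hng, hnv, realForm_single, linkingMatrix_self]
      simp only [List.map_cons, chainNum]
      rw [hp]
      push_cast
      simp only [List.map_cons, chainNum, smul_eq_mul]
      push_cast
      ring

/-- The form is diagonalised from the far end of the chain; each pivot is a tail of the continued
fraction, and a zero pivot is handled together with the following `∞`. -/
theorem IsPathList.hasPosIndex_vertexSpan {l : List V} (hl : Γ.IsPathList l) :
    HasPosIndex (realForm Γ.linkingMatrix) (vertexSpan l) (chainPos (l.map Γ.weight)) := by
  classical
  have hsymm := realForm_symm (A := Γ.linkingMatrix) linkingMatrix_isSymm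
  induction hlen : l.length using Nat.strong_induction_on generalizing l with
  | _ N ih =>
  subst hlen
  match l, hl with
  | [], _ =>
    have : vertexSpan ([] : List V) = ⊥ := by simp [vertexSpan]
    rw [this]
    exact hasPosIndex_bot
  | [x], _ =>
    have h := hasPosIndex_span_singleton (B := realForm Γ.linkingMatrix) (Pi.single x (1 : ℝ))
    have h2 : vertexSpan [x] = Submodule.span ℝ {Pi.single x (1 : ℝ)} := by
      rw [vertexSpan_cons]
      simp [vertexSpan]
    rw [h2]
    convert h using 1
    rw [realForm_single, linkingMatrix_self]
    simp [chainPos, contFrac, subInv_infty, posIndicator_coe]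
  | x :: h :: t, hl =>
    obtain ⟨n, hn1, hn2, hn3⟩ := hl.of_cons.exists_chainVector
    set W := vertexSpan (h :: t) with hW
    set w : List ℤ := (h :: t).map Γ.weight with hw
    set p : ℝ := ((chainNum w).1 : ℝ) with hp
    set q : ℝ := ((chainNum w).2 : ℝ) with hq
    have hpi : p = 0 ↔ (chainNum w).1 = 0 := Int.cast_eq_zero
    have hqi : q = 0 ↔ (chainNum w).2 = 0 := Int.cast_eq_zero
    have hnW : n ∈ W := by
      have h1 := Submodule.add_mem _ (vertexSpan_mono (List.subset_cons_self h t) hn1)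
        (Submodule.smul_mem _ q
          (single_mem_vertexSpan (List.mem_cons_self (a := h) (l := t))))
      simpa using h1
    have hht : h ∉ t := (List.nodup_cons.1 hl.of_cons.2).1
    have hnv : n h = q := by
      have h1 := eq_zero_of_mem_vertexSpan hht hn1
      simpa [sub_eq_zero] using h1
    have hnB : ∀ v ∈ W, realForm Γ.linkingMatrix n v = p * v h := by
      intro v hv
      induction hv using Submodule.span_induction with
      | mem y hy =>
        obtain ⟨z, hz, rfl⟩ := hy
        rcases List.mem_cons.1 hz with rfl | hz
        · simp [hn3]
        · have h2 : h ≠ z := by rintro rfl; exact hht hz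
          simp [hn2 z hz, h2]
      | zero => simp
      | add y z _ _ h1 h2 => rw [map_add, h1, h2, Pi.add_apply, mul_add]
      | smul c y _ h1 => rw [map_smul, h1, Pi.smul_apply, smul_eq_mul, smul_eq_mul]; ring
    -- The pivot at `h` vanishes: `n` is null and spans a hyperbolic plane with `e_x`, orthogonal to
    -- the rest. Its index `1` matches the count of `0` for `h` and `1` for `∞` at `x`, so the
    -- induction skips two vertices.
    by_cases hp0 : p = 0
    · have hq0 : q ≠ 0 := hqi.not.2 (chainNum_ne_zero w (hpi.1 hp0))
      have hfrac : contFrac w = ((0 : ℚ) : OnePoint ℚ) := by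
        have h1 : (chainNum w).1 = 0 := hpi.1 hp0
        have h2 : (chainNum w).2 ≠ 0 := hqi.not.1 hq0
        rw [contFrac_eq, if_neg h2, h1, Int.cast_zero, zero_div]
      have hxn : realForm Γ.linkingMatrix (Pi.single x 1) n = q := by
        rw [hl.realForm_single_left hnW, hnv]
      have hnn : realForm Γ.linkingMatrix n n = 0 := by rw [hnB n hnW, hp0, zero_mul]
      have h1 := (hasPosIndex_hyperbolic hsymm hnn (by rw [hxn]; exact hq0)).sup hsymm
        (ih t.length (by simp) hl.of_cons.of_cons rfl) (by
          intro a ha b hb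
          have hbW : b ∈ W := vertexSpan_mono (List.subset_cons_self h t) hb
          have hbh : b h = 0 := eq_zero_of_mem_vertexSpan hht hb
          induction ha using Submodule.span_induction with
          | mem y hy =>
            rcases hy with rfl | rfl
            · rw [hl.realForm_single_left hbW, hbh]
            · rw [hnB b hbW, hbh, mul_zero]
          | zero => simp
          | add y z _ _ h1 h2 => rw [map_add, LinearMap.add_apply, h1, h2, add_zero]
          | smul c y _ h1 => rw [map_smul, LinearMap.smul_apply, h1, smul_zero])
      convert h1 using 1
      · apply le_antisymm
        · rw [vertexSpan_cons, vertexSpan_cons]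
          apply sup_le
          · apply le_sup_of_le_left
            exact Submodule.span_mono (by simp)
          · apply sup_le
            · rw [Submodule.span_singleton_le_iff_mem]
              set S := Submodule.span ℝ {Pi.single x (1 : ℝ), n} ⊔ vertexSpan t
              have h3 : n ∈ S := Submodule.mem_sup_left (Submodule.subset_span (by simp))
              have h4 := S.smul_mem q⁻¹ (S.sub_mem h3 (Submodule.mem_sup_right hn1))
              rw [sub_sub_cancel, smul_smul, inv_mul_cancel₀ hq0, one_smul] at h4
              exact h4
            · exact le_sup_right
        · apply sup_le
          · rw [Submodule.span_le]
            rintro y (rfl | rfl)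
            · exact single_mem_vertexSpan (by simp)
            · exact vertexSpan_mono (List.subset_cons_self x _) hnW
          · exact vertexSpan_mono (fun y hy => by simp [hy])
      · have e1 : (x :: h :: t).map Γ.weight = Γ.weight x :: w := rfl
        have e2 : w = Γ.weight h :: t.map Γ.weight := rfl
        rw [e1, chainPos_cons, contFrac_cons, hfrac, subInv_zero, posIndicator_infty]
        rw [e2, chainPos_cons, ← e2, hfrac, posIndicator_coe]
        simp [add_comm]
    -- Gram–Schmidt: this vector is orthogonal to the span of the tail, and its square is the
    -- continued fraction `m_x - q/p`.
    · set f : V → ℝ := Pi.single x 1 - p⁻¹ • n with hf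
      have hfW : ∀ v ∈ W, realForm Γ.linkingMatrix f v = 0 := by
        intro v hv
        rw [hf, map_sub, map_smul, LinearMap.sub_apply, LinearMap.smul_apply,
          hl.realForm_single_left hv, hnB v hv, smul_eq_mul, inv_mul_cancel_left₀ hp0, sub_self]
      have hff : realForm Γ.linkingMatrix f f = Γ.weight x - q / p := by
        have h1 : realForm Γ.linkingMatrix f f = realForm Γ.linkingMatrix f (Pi.single x 1) := by
          conv_lhs => rw [hf, map_sub, map_smul, ← hf, hfW n hnW]
          simp
        rw [h1, hf, map_sub, map_smul, LinearMap.sub_apply, LinearMap.smul_apply, hsymm n,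
          hl.realForm_single_left hnW, hnv, realForm_single, linkingMatrix_self, smul_eq_mul]
        ring
      have h1 := (hasPosIndex_span_singleton (B := realForm Γ.linkingMatrix) f).sup hsymm
        (ih (h :: t).length (by simp) hl.of_cons rfl) (by
          intro a ha b hb
          obtain ⟨c, rfl⟩ := Submodule.mem_span_singleton.1 ha
          rw [map_smul, LinearMap.smul_apply, hfW b hb, smul_zero])
      convert h1 using 1
      · rw [vertexSpan_cons]
        apply le_antisymm
        · apply sup_le
          · rw [Submodule.span_singleton_le_iff_mem]
            have h3 : f ∈ Submodule.span ℝ {f} ⊔ W :=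
              Submodule.mem_sup_left (Submodule.mem_span_singleton_self _)
            have h4 := Submodule.add_mem _ h3
              (Submodule.smul_mem _ p⁻¹ (Submodule.mem_sup_right hnW))
            rwa [hf, sub_add_cancel] at h4
          · exact le_sup_right
        · apply sup_le
          · rw [Submodule.span_singleton_le_iff_mem]
            exact Submodule.sub_mem _
              (Submodule.mem_sup_left (Submodule.mem_span_singleton_self _))
              (Submodule.smul_mem _ _ (Submodule.mem_sup_right hnW))
          · exact le_sup_right
      · have e1 : (x :: h :: t).map Γ.weight = Γ.weight x :: w := rfl
        have h3 : (chainNum w).1 ≠ 0 := hpi.not.1 hp0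
        rw [e1, chainPos_cons, contFrac_eq, if_neg (show (chainNum (Γ.weight x :: w)).2 ≠ 0 from h3),
          posIndicator_coe, hff, add_comm]
        congr 1
        have h4 : ((chainNum w).1 : ℚ) ≠ 0 := by exact_mod_cast h3
        have h5 : (((chainNum (Γ.weight x :: w)).1 : ℚ) / ((chainNum (Γ.weight x :: w)).2 : ℚ)) =
            (Γ.weight x : ℚ) - ((chainNum w).2 : ℚ) / ((chainNum w).1 : ℚ) := by
          change (((Γ.weight x * (chainNum w).1 - (chainNum w).2 : ℤ) : ℚ) /
            ((chainNum w).1 : ℚ)) = _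
          push_cast
          field_simp
        have h6 : ((Γ.weight x : ℝ) - q / p) =
            (((Γ.weight x : ℚ) - ((chainNum w).2 : ℚ) / ((chainNum w).1 : ℚ) : ℚ) : ℝ) := by
          rw [hp, hq]
          push_cast
          rfl
        apply if_congr _ rfl rfl
        rw [h5, h6, Rat.cast_pos]

theorem IsPathList.posEigenCount_subLinkingMatrix {l : List V} (hl : Γ.IsPathList l) :
    posEigenCount (Γ.subLinkingMatrix l) = chainPos (l.map Γ.weight) :=
  (Γ.hasPosIndex_vertexSpan l).unique hl.hasPosIndex_vertexSpan

/-- When the branch fraction is an integer `k`, the last pivot of its diagonalisation is `k`, so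
subtracting `π(k)` leaves the count for the chain without `w`. Integrality does not depend on the
weight of `w` either. -/
theorem IsPathList.branchSign_eq {w v : V} {i : List V} (h : Γ.IsPathList (w :: (i ++ [v]))) :
    Γ.branchSign w v = leafSign ((i ++ [v]).map Γ.weight) := by
  unfold branchSign leafSign
  rw [h.pathVerts_eq]
  rw [h.posEigenCount_subLinkingMatrix, List.map_cons, chainPos_cons, contFrac_cons]
  by_cases hk : ∃ k : ℤ, subInv (Γ.weight w) (contFrac ((i ++ [v]).map Γ.weight)) =
      ((k : ℚ) : OnePoint ℚ)
  · rw [dif_pos hk, if_pos (exists_subInv_eq_int_iff _ _ _ hk), posEigenCount_singleton]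
    have h2 := hk.choose_spec
    rw [← h2, Nat.cast_add, add_sub_cancel_right, zpow_natCast]
  · rw [dif_neg hk, if_neg fun h' => hk (exists_subInv_eq_int_iff _ _ _ h')]

end ChainIndex
end Plumbing

/-! ### Arcs of vertices of valency two -/

namespace Plumbing

theorem _root_.List.exists_first_mem {α : Type*} (p : α → Prop) (l : List α) (h : ∃ x ∈ l, p x) :
    ∃ i w r, l = i ++ w :: r ∧ p w ∧ ∀ x ∈ i, ¬p x := by
  induction l with
  | nil => simp at h
  | cons a l ih =>
    by_cases ha : p a
    · exact ⟨[], a, l, rfl, ha, by simp⟩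
    · obtain ⟨x, hx, hpx⟩ := h
      rcases List.mem_cons.1 hx with rfl | hx
      · exact absurd hpx ha
      · obtain ⟨i, w, r, rfl, hw, hi⟩ := ih ⟨x, hx, hpx⟩
        refine ⟨a :: i, w, r, rfl, hw, ?_⟩
        intro y hy
        rcases List.mem_cons.1 hy with rfl | hy
        · exact ha
        · exact hi y hy

section Arc

variable {V : Type u} [Fintype V] {Γ : Plumbing V}

/-- The list `i` consists of the interior vertices, all of valency two, of a path from `w` to
`v`. -/
def Arc (Γ : Plumbing V) (w : V) (i : List V) (v : V) : Prop :=
  Γ.IsPathList (w :: (i ++ [v])) ∧ ∀ x ∈ i, Γ.deg x = 2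

theorem Arc.reverse {w v : V} {i : List V} (h : Γ.Arc w i v) : Γ.Arc v i.reverse w := by
  refine ⟨?_, by simpa using h.2⟩
  have := h.1.reverse
  simpa using this

theorem Arc.ne {w v : V} {i : List V} (h : Γ.Arc w i v) : w ≠ v := by
  have := (List.nodup_cons.1 h.1.2).1
  rintro rfl
  simp at this

theorem Arc.ext {w v : V} {i i' : List V} (h : Γ.Arc w i v) (h' : Γ.Arc w i' v) : i = i' :=
  h.1.ext h'.1

theorem isBranch_iff {w v : V} :
    Γ.IsBranch w v ↔ Γ.IsHigh w ∧ Γ.deg v = 1 ∧ ∃ i, Γ.Arc w i v := by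
  constructor
  · rintro ⟨hw, hv, hi⟩
    have hne : w ≠ v := by
      rintro rfl
      rw [IsHigh] at hw
      omega
    obtain ⟨i, h⟩ := exists_isPathList (Γ := Γ) hne
    rw [h.interiorVerts_eq] at hi
    exact ⟨hw, hv, i, h, hi⟩
  · rintro ⟨hw, hv, i, h, hi⟩
    refine ⟨hw, hv, ?_⟩
    rwa [h.interiorVerts_eq]

theorem isPseudoBridge_iff {w v : V} :
    Γ.IsPseudoBridge w v ↔ Γ.IsHigh w ∧ Γ.IsHigh v ∧ ∃ i, Γ.Arc w i v ∧
      contFrac (i.map Γ.weight) = ((0 : ℚ) : OnePoint ℚ) := by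
  constructor
  · rintro ⟨hw, hv, hne, -, hi, hc⟩
    obtain ⟨i, h⟩ := exists_isPathList (Γ := Γ) hne
    rw [h.interiorVerts_eq] at hi hc
    exact ⟨hw, hv, i, ⟨h, hi⟩, hc⟩
  · rintro ⟨hw, hv, i, h, hc⟩
    refine ⟨hw, hv, h.ne, ?_, ?_, ?_⟩
    · rw [h.1.interiorVerts_eq]
      rintro rfl
      exact absurd hc (OnePoint.infty_ne_coe _)
    · rw [h.1.interiorVerts_eq]
      exact h.2
    · rwa [h.1.interiorVerts_eq]

/-- The branch is the path from the leaf towards `w₀`, stopped at the first high vertex. -/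
theorem exists_isBranch {v w₀ : V} (hv : Γ.deg v = 1) (hw₀ : Γ.IsHigh w₀) :
    ∃ w, Γ.IsBranch w v := by
  have hne : v ≠ w₀ := by
    rintro rfl
    rw [IsHigh] at hw₀
    omega
  obtain ⟨j, hj⟩ := exists_isPathList (Γ := Γ) hne
  obtain ⟨i, w, r, h1, hw, hi⟩ := List.exists_first_mem Γ.IsHigh (j ++ [w₀]) ⟨w₀, by simp, hw₀⟩
  rw [h1] at hj
  have h2 : Γ.IsPathList (v :: (i ++ [w])) := by
    apply hj.of_infix
    exact ⟨[], r, by simp⟩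
  have h3 : Γ.Arc v i w := by
    refine ⟨h2, fun x hx => ?_⟩
    have := h2.two_le_deg hx
    have h4 := hi x hx
    rw [IsHigh] at h4
    omega
  exact ⟨w, isBranch_iff.2 ⟨hw, hv, _, h3.reverse⟩⟩

/-- At a vertex of degree two the path has no choice, so a common first step determines where it
first meets a vertex of another degree. -/
theorem eq_of_isPathList_of_deg {a b : V} {l l' : List V} {w w' : V}
    (h : Γ.IsPathList (a :: b :: l)) (h' : Γ.IsPathList (a :: b :: l'))
    (hd : ∀ x ∈ (b :: l).dropLast, Γ.deg x = 2) (hd' : ∀ x ∈ (b :: l').dropLast, Γ.deg x = 2)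
    (hw : w ∈ (b :: l).getLast?) (hw' : w' ∈ (b :: l').getLast?)
    (hdw : Γ.deg w ≠ 2) (hdw' : Γ.deg w' ≠ 2) : w = w' := by
  induction l generalizing a b l' with
  | nil =>
    cases l' with
    | nil => simp at hw hw'; rw [← hw, ← hw']
    | cons c' l' =>
      have h1 := hd' b (by simp)
      simp at hw
      exact absurd (hw ▸ h1) hdw
  | cons c l ih =>
    cases l' with
    | nil =>
      have h1 := hd b (by simp)
      simp at hw'
      exact absurd (hw' ▸ h1) hdw'
    | cons c' l' =>
      have hb : Γ.deg b = 2 := hd b (by simp)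
      have hac : a ≠ c := by
        rintro rfl
        have := (List.nodup_cons.1 h.2).1
        simp at this
      have hac' : a ≠ c' := by
        rintro rfl
        have := (List.nodup_cons.1 h'.2).1
        simp at this
      have hcc : c' = c := by
        rcases eq_or_eq_of_deg_eq_two hb h.adj_head.symm h.of_cons.adj_head hac
          h'.of_cons.adj_head with h1 | h1
        · exact absurd h1.symm hac'
        · exact h1
      subst hcc
      refine ih (a := b) (b := c') (l' := l') h.of_cons h'.of_cons ?_ ?_ ?_ ?_
      · intro x hx; apply hd; simp [hx]
      · intro x hx; apply hd'; simp [hx]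
      · simpa using hw
      · simpa using hw'

theorem Arc.eq_of_leaf {v w w' : V} {i i' : List V} (hv : Γ.deg v = 1) (h : Γ.Arc w i v)
    (h' : Γ.Arc w' i' v) (hw : Γ.IsHigh w) (hw' : Γ.IsHigh w') : w = w' := by
  have h1 := h.reverse
  have h2 := h'.reverse
  rw [IsHigh] at hw hw'
  obtain ⟨b, l, hl⟩ : ∃ b l, i.reverse ++ [w] = b :: l := by
    cases i.reverse with
    | nil => exact ⟨w, [], rfl⟩
    | cons b t => exact ⟨b, _, rfl⟩
  obtain ⟨b', l', hl'⟩ : ∃ b l, i'.reverse ++ [w'] = b :: l := by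
    cases i'.reverse with
    | nil => exact ⟨w', [], rfl⟩
    | cons b t => exact ⟨b, _, rfl⟩
  have g1 := h1.1
  have g2 := h2.1
  rw [hl] at g1
  rw [hl'] at g2
  have hb : b' = b := eq_of_deg_eq_one hv g2.adj_head g1.adj_head
  subst hb
  refine eq_of_isPathList_of_deg g1 g2 ?_ ?_ (w := w) (w' := w') ?_ ?_ (by omega) (by omega)
  · rw [← hl, List.dropLast_concat]; exact h1.2
  · rw [← hl', List.dropLast_concat]; exact h2.2
  · rw [← hl]; simp
  · rw [← hl']; simp

theorem IsBranch.root_unique {v w w' : V} (h : Γ.IsBranch w v) (h' : Γ.IsBranch w' v) :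
    w = w' := by
  obtain ⟨hw, hv, i, hi⟩ := isBranch_iff.1 h
  obtain ⟨hw', -, i', hi'⟩ := isBranch_iff.1 h'
  exact hi.eq_of_leaf hv hi' hw hw'

/-- An interior vertex of degree other than two would be a third high vertex. This is how the bound
on high vertices enters the comparison of chambers. -/
theorem exists_arc_of_highCount_le_two [DecidableEq V] (h2 : Γ.highCount ≤ 2) {w w' : V}
    (hw : Γ.IsHigh w) (hw' : Γ.IsHigh w') (hne : w ≠ w') : ∃ i, Γ.Arc w i w' := by
  classical
  obtain ⟨i, hi⟩ := exists_isPathList (Γ := Γ) hne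
  refine ⟨i, hi, fun x hx => ?_⟩
  have h3 := hi.two_le_deg hx
  by_contra hx2
  have hxh : Γ.IsHigh x := by rw [IsHigh]; omega
  have hn := hi.2
  have hxw : w ≠ x := by
    rintro rfl
    exact (List.nodup_cons.1 hn).1 (by simp [hx])
  have hxw' : w' ≠ x := by
    rintro rfl
    have := (List.nodup_cons.1 hn).2
    rw [List.nodup_append] at this
    exact this.2.2 _ hx _ (by simp) rfl
  have hc : ({⟨w, hw⟩, ⟨w', hw'⟩, ⟨x, hxh⟩} : Finset Γ.High).card = 3 := by
    rw [Finset.card_insert_of_notMem, Finset.card_pair]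
    · simpa using hxw'
    · simp [hne, hxw]
  have h4 := Finset.card_le_univ ({⟨w, hw⟩, ⟨w', hw'⟩, ⟨x, hxh⟩} : Finset Γ.High)
  rw [hc] at h4
  rw [highCount] at h2
  omega

end Arc

/-! ### Chambers and leaf exponents in terms of arcs -/

section Signs

variable {V : Type u} [Fintype V] [DecidableEq V] {Γ : Plumbing V}

theorem mem_chambers {ξ : Γ.High → ℤˣ} : ξ ∈ Γ.chambers ↔ ∀ (w₁ w₂ : Γ.High) (i : List V),
    Γ.Arc w₁ i w₂ → contFrac (i.map Γ.weight) = ((0 : ℚ) : OnePoint ℚ) →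
      ξ w₁ * ξ w₂ = (-1) ^ (chainPos (i.map Γ.weight) + 1) := by
  classical
  simp only [chambers, Finset.mem_filter, Finset.mem_univ, true_and]
  constructor
  · intro h w₁ w₂ i hi hc
    have h1 := h w₁ w₂ (isPseudoBridge_iff.2 ⟨w₁.2, w₂.2, i, hi, hc⟩)
    rw [hi.1.interiorVerts_eq] at h1
    have h2 : Γ.IsPathList i := hi.1.of_cons.of_append_left
    rwa [h2.posEigenCount_subLinkingMatrix] at h1
  · intro h w₁ w₂ hb
    obtain ⟨-, -, i, hi, hc⟩ := isPseudoBridge_iff.1 hb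
    have h2 : Γ.IsPathList i := hi.1.of_cons.of_append_left
    rw [hi.1.interiorVerts_eq, h2.posEigenCount_subLinkingMatrix]
    exact h w₁ w₂ i hi hc

open Classical in
/-- The exponent of `t` that belongs to the leaf `v`: the sign `ξ_w φ(v)`, where `w` is the
high-valency vertex from which the branch to `v` starts. -/
def leafExp (Γ : Plumbing V) (ξ : Γ.High → ℤˣ) (v : V) : ℤ :=
  ∑ w : Γ.High, if Γ.IsBranch w v then (ξ w : ℤ) * Γ.branchSign w v else 0

theorem leafExp_of_isBranch {w v : V} (ξ : Γ.High → ℤˣ) (h : Γ.IsBranch w v) :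
    Γ.leafExp ξ v = (ξ ⟨w, h.1⟩ : ℤ) * Γ.branchSign w v := by
  classical
  rw [leafExp, Finset.sum_eq_single ⟨w, h.1⟩]
  · rw [if_pos h]
  · intro w' _ hw'
    rw [if_neg]
    intro h'
    exact hw' (Subtype.ext (h'.root_unique h))
  · simp

theorem leafExp_of_arc {w v : V} {i : List V} (ξ : Γ.High → ℤˣ) (h : Γ.Arc w i v)
    (hw : Γ.IsHigh w) (hv : Γ.deg v = 1) :
    Γ.leafExp ξ v = (ξ ⟨w, hw⟩ : ℤ) * leafSign ((i ++ [v]).map Γ.weight) := by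
  rw [leafExp_of_isBranch ξ (isBranch_iff.2 ⟨hw, hv, i, h⟩), h.1.branchSign_eq]

theorem nonempty_high_iff : Γ.highCount ≠ 0 ↔ ∃ w, Γ.IsHigh w := by
  classical
  rw [highCount, ← Nat.pos_iff_ne_zero, Fintype.card_pos_iff]
  exact ⟨fun ⟨w⟩ => ⟨w.1, w.2⟩, fun ⟨w, hw⟩ => ⟨⟨w, hw⟩⟩⟩

end Signs
end Plumbing

/-! ### Algebra of the discriminant series -/

section Series

variable {V : Type u} [DecidableEq V]

theorem tMonomial_mul_tMonomial (k k' : ℤ) (e e' : V → ℤ) :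
    tMonomial k e * tMonomial k' e' = tMonomial (k + k') (e + e') := by
  rw [tMonomial, tMonomial, tMonomial, HahnSeries.single_mul_single,
    AddMonoidAlgebra.single_mul_single, one_mul]

/-- The sign `-ξ`, raised to the power `p`, times the coefficient of the `k`-th power in
`∑ A(r,p) x^(2r+p)`. -/
def expansionTerm (p : ℕ) (ξ : ℤˣ) (k : ℤ) : ℤ :=
  if (p : ℤ) ≤ k ∧ 2 ∣ k - p then (-ξ : ℤ) ^ p * (expansionCoeff ((k - p) / 2).toNat p : ℤ) else 0

theorem highFactor_coeff (w : V) (p : ℕ) (ξ : ℤˣ) (k : ℤ) :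
    (highFactor w p ξ).coeff k =
      AddMonoidAlgebra.single (Pi.single w ((ξ : ℤ) * k)) (expansionTerm p ξ k) := by
  unfold highFactor expansionTerm
  rw [PowerSeries.coeff_coe]
  by_cases hk : k < 0
  · rw [if_pos hk, if_neg (by omega)]
    simp
  · obtain ⟨n, rfl⟩ := Int.eq_ofNat_of_zero_le (not_lt.1 hk)
    rw [if_neg hk, Int.natAbs_natCast, PowerSeries.coeff_mk]
    by_cases h : p ≤ n ∧ 2 ∣ n - p
    · obtain ⟨h1, r, hr⟩ := h
      obtain rfl : n = p + 2 * r := by omega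
      have hA : (p : ℤ) ≤ ((p + 2 * r : ℕ) : ℤ) ∧ 2 ∣ ((p + 2 * r : ℕ) : ℤ) - p :=
        ⟨by exact_mod_cast h1, r, by push_cast; ring⟩
      rw [if_pos ⟨h1, r, hr⟩, if_pos hA]
      congr 1
      have h2 : (((p + 2 * r : ℕ) : ℤ) - p) / 2 = r := by push_cast; omega
      rw [h2]
      have h3 : (p + 2 * r - p) / 2 = r := by omega
      rw [h3, Int.toNat_natCast]
      rcases Int.units_eq_one_or ξ with rfl | rfl <;> simp
    · rw [if_neg h, if_neg]
      · simp
      · rintro ⟨h1, r, hr⟩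
        apply h
        refine ⟨by exact_mod_cast h1, r.toNat, ?_⟩
        omega

theorem leafFactor_unit (w : V) (ξ : ℤˣ) : leafFactor w (ξ : ℤ) =
    ((ξ : ℤ) : TSeries V) * (tMonomial 1 (Pi.single w (ξ : ℤ)) -
      tMonomial (-1) (Pi.single w (-ξ : ℤ))) := by
  rcases Int.units_eq_one_or ξ with rfl | rfl
  · simp [leafFactor]
  · simp [leafFactor]
    ring

theorem tMonomial_mul_highFactor_coeff (w : V) (p : ℕ) (ξ η : ℤˣ) (k : ℤ) :
    (tMonomial (η : ℤ) (Pi.single w ((ξ : ℤ) * η)) * highFactor w p ξ).coeff k =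
      AddMonoidAlgebra.single (Pi.single w ((ξ : ℤ) * k)) (expansionTerm p ξ (k - η)) := by
  rw [tMonomial, HahnSeries.coeff_single_mul, highFactor_coeff, AddMonoidAlgebra.single_mul_single,
    one_mul, ← Pi.single_add]
  congr 2
  ring

/-- This is Pascal's rule `A(r, p+1) - A(r-1, p+1) = A(r, p)`; the sign `(-ξ)^(p+1)` supplies the
factor `-ξ` that turns the difference around. -/
theorem expansionTerm_succ (p : ℕ) (hp : 1 ≤ p) (ξ : ℤˣ) (k : ℤ) :
    (ξ : ℤ) * (expansionTerm (p + 1) ξ (k - 1) - expansionTerm (p + 1) ξ (k + 1)) =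
      expansionTerm p ξ k := by
  have hξ : (ξ : ℤ) * ξ = 1 := by rcases Int.units_eq_one_or ξ with rfl | rfl <;> rfl
  unfold expansionTerm
  by_cases h : (p : ℤ) ≤ k ∧ 2 ∣ k - p
  · obtain ⟨h1, r, hr⟩ := h
    obtain ⟨n, rfl⟩ := Int.eq_ofNat_of_zero_le (show 0 ≤ r by omega)
    have hA : (p : ℤ) ≤ k ∧ 2 ∣ k - p := ⟨h1, n, hr⟩
    have hB : ((p + 1 : ℕ) : ℤ) ≤ k + 1 ∧ 2 ∣ k + 1 - ((p + 1 : ℕ) : ℤ) :=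
      ⟨by push_cast; omega, n, by push_cast; omega⟩
    rw [if_pos hA, if_pos hB]
    have e1 : (k + 1 - ((p + 1 : ℕ) : ℤ)) / 2 = n := by push_cast; omega
    have e2 : (k - (p : ℤ)) / 2 = n := by omega
    rw [e1, e2, Int.toNat_natCast]
    obtain ⟨q, rfl⟩ := Nat.exists_eq_add_of_le' hp
    -- For `r = 0` the term with index `r - 1` is absent, so Pascal's rule degenerates to `1 = 1`.
    rcases Nat.eq_zero_or_pos n with rfl | hn
    · have hC : ¬(((q + 1 + 1 : ℕ) : ℤ) ≤ k - 1 ∧ 2 ∣ k - 1 - ((q + 1 + 1 : ℕ) : ℤ)) := by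
        push_cast at hr ⊢; omega
      rw [if_neg hC]
      simp only [expansionCoeff, Nat.add_sub_cancel, zero_add, Nat.choose_self]
      rw [pow_succ (-(ξ : ℤ)) (q + 1)]
      push_cast
      linear_combination (-(ξ : ℤ)) ^ (q + 1) * hξ
    · obtain ⟨m, rfl⟩ := Nat.exists_eq_add_of_le' hn
      have hC : ((q + 1 + 1 : ℕ) : ℤ) ≤ k - 1 ∧ 2 ∣ k - 1 - ((q + 1 + 1 : ℕ) : ℤ) :=
        ⟨by push_cast at hr ⊢; omega, (m : ℤ), by push_cast at hr ⊢; omega⟩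
      rw [if_pos hC]
      have e3 : (k - 1 - ((q + 1 + 1 : ℕ) : ℤ)) / 2 = m := by push_cast at hr ⊢; omega
      rw [e3, Int.toNat_natCast]
      simp only [expansionCoeff, Nat.add_sub_cancel]
      have h3 : m + 1 + (q + 1 + 1) - 1 = m + q + 1 + 1 := by omega
      have h4 : m + (q + 1 + 1) - 1 = m + q + 1 := by omega
      have h5 : m + 1 + (q + 1) - 1 = m + q + 1 := by omega
      rw [h3, h4, h5, Nat.choose_succ_succ (m + q + 1) q]
      push_cast
      rw [pow_succ (-(ξ : ℤ)) (q + 1)]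
      linear_combination (-(ξ : ℤ)) ^ (q + 1) * ((m + q + 1).choose q : ℤ) * hξ
  · rw [if_neg h, if_neg, if_neg]
    · simp
    · rintro ⟨h1, r, hr⟩
      exact h ⟨by push_cast at h1; omega, r, by push_cast at hr; omega⟩
    · rintro ⟨h1, r, hr⟩
      exact h ⟨by push_cast at h1; omega, r + 1, by push_cast at hr; omega⟩

theorem expansionTerm_one (ξ : ℤˣ) (k : ℤ) :
    (ξ : ℤ) * (expansionTerm 1 ξ (k - 1) - expansionTerm 1 ξ (k + 1)) = if k = 0 then 1 else 0 := by
  have hξ : (ξ : ℤ) * ξ = 1 := by rcases Int.units_eq_one_or ξ with rfl | rfl <;> rfl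
  unfold expansionTerm
  simp only [expansionCoeff, Nat.sub_self, Nat.choose_zero_right, Nat.cast_one, mul_one, pow_one]
  by_cases hk : k = 0
  · subst hk
    norm_num
  · rw [if_neg hk]
    by_cases h : 1 ≤ k - 1 ∧ 2 ∣ k - 1 - 1
    · rw [if_pos h, if_pos (by omega), sub_self, mul_zero]
    · rw [if_neg h, if_neg (by omega), sub_self, mul_zero]

theorem leafFactor_mul_highFactor_coeff (w : V) (p : ℕ) (ξ : ℤˣ) (k : ℤ) :
    (leafFactor w (ξ : ℤ) * highFactor w p ξ).coeff k =
      AddMonoidAlgebra.single (Pi.single w ((ξ : ℤ) * k))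
        ((ξ : ℤ) * (expansionTerm p ξ (k - 1) - expansionTerm p ξ (k + 1))) := by
  have h1 := tMonomial_mul_highFactor_coeff w p ξ 1 k
  have h2 := tMonomial_mul_highFactor_coeff w p ξ (-1) k
  simp only [Units.val_one, Units.val_neg, mul_one, mul_neg, sub_neg_eq_add] at h1 h2
  rw [leafFactor_unit, mul_assoc, sub_mul, ← zsmul_eq_mul, HahnSeries.coeff_smul,
    HahnSeries.coeff_sub, h1, h2, ← AddMonoidAlgebra.single_sub, AddMonoidAlgebra.smul_single,
    smul_eq_mul]

theorem leafFactor_mul_highFactor (w : V) {p : ℕ} (hp : 1 ≤ p) (ξ : ℤˣ) :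
    leafFactor w (ξ : ℤ) * highFactor w (p + 1) ξ = highFactor w p ξ := by
  ext1
  funext k
  rw [leafFactor_mul_highFactor_coeff, expansionTerm_succ p hp, highFactor_coeff]

/-- For `p = 1` the expansion is the geometric series of the inverse of the leaf factor, in the
direction chosen by `ξ`. -/
theorem leafFactor_mul_highFactor_one (w : V) (ξ : ℤˣ) :
    leafFactor w (ξ : ℤ) * highFactor w 1 ξ = 1 := by
  ext1
  funext k
  rw [leafFactor_mul_highFactor_coeff, expansionTerm_one, HahnSeries.coeff_one]
  split_ifs with h
  · subst h
    simp [AddMonoidAlgebra.one_def]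
  · simp

/-- Multiplication by the leaf factor lowers `p` by one and is invertible, so all the expansions are
powers of the geometric series. -/
theorem highFactor_eq_pow (w : V) {p : ℕ} (hp : 1 ≤ p) (ξ : ℤˣ) :
    highFactor w p ξ = highFactor w 1 ξ ^ p := by
  induction p, hp using Nat.le_induction with
  | base => rw [pow_one]
  | succ p hp ih =>
    calc highFactor w (p + 1) ξ
        = (leafFactor w (ξ : ℤ) * highFactor w 1 ξ) * highFactor w (p + 1) ξ := by
          rw [leafFactor_mul_highFactor_one, one_mul]
      _ = (leafFactor w (ξ : ℤ) * highFactor w (p + 1) ξ) * highFactor w 1 ξ := by ring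
      _ = _ := by rw [leafFactor_mul_highFactor w hp, ih, pow_succ]

theorem highFactor_mul_highFactor (w : V) {p q : ℕ} (hp : 1 ≤ p) (hq : 1 ≤ q) (ξ : ℤˣ) :
    highFactor w p ξ * highFactor w q ξ = highFactor w (p + q) ξ := by
  rw [highFactor_eq_pow w (show 1 ≤ p + q by omega), pow_add, ← highFactor_eq_pow w hp,
    ← highFactor_eq_pow w hq]

/-- The factor of the discriminant belonging to a vertex of degree `d`. -/
def vertexFactor (v : V) (d : ℕ) (s : ℤ) (ξ : ℤˣ) : TSeries V :=
  if d = 0 then leafFactor v 0 ^ 2 else if d = 1 then leafFactor v s else if d = 2 then 1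
  else highFactor v (d - 2) ξ

theorem vertexFactor_zero (v : V) (s : ℤ) (ξ : ℤˣ) : vertexFactor v 0 s ξ = leafFactor v 0 ^ 2 :=
  rfl

theorem vertexFactor_one (v : V) (s : ℤ) (ξ : ℤˣ) : vertexFactor v 1 s ξ = leafFactor v s := rfl

theorem vertexFactor_two (v : V) (s : ℤ) (ξ : ℤˣ) : vertexFactor v 2 s ξ = 1 := rfl

theorem vertexFactor_of_three_le (v : V) {d : ℕ} (hd : 3 ≤ d) (s : ℤ) (ξ : ℤˣ) :
    vertexFactor v d s ξ = highFactor v (d - 2) ξ := by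
  rw [vertexFactor, if_neg (by omega), if_neg (by omega), if_neg (by omega)]

/-- A leaf factor with matching exponent cancels one unit of valency. When `d = 2` the vertex
carries no sign afterwards, and `ξ'` is free. -/
theorem leafFactor_mul_vertexFactor (v : V) {d : ℕ} (hd : 2 ≤ d) (s s' : ℤ) (ξ ξ' : ℤˣ)
    (h : 3 ≤ d → ξ' = ξ) :
    leafFactor v (ξ : ℤ) * vertexFactor v (d + 1) s ξ = vertexFactor v d s' ξ' := by
  rw [vertexFactor_of_three_le v (by omega)]
  rcases Nat.lt_or_ge 2 d with h3 | h2
  · rw [vertexFactor_of_three_le v h3, h h3, ← leafFactor_mul_highFactor v (p := d - 2) (by omega)]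
    congr 3
    omega
  · obtain rfl : d = 2 := by omega
    rw [vertexFactor_two]
    exact leafFactor_mul_highFactor_one v ξ

theorem vertexFactor_mul_vertexFactor (v : V) {d d' : ℕ} (hd : 3 ≤ d) (hd' : 3 ≤ d') (s s' s'' : ℤ)
    (ξ : ℤˣ) : vertexFactor v d s ξ * vertexFactor v d' s' ξ = vertexFactor v (d + d' - 2) s'' ξ := by
  rw [vertexFactor_of_three_le v hd, vertexFactor_of_three_le v hd',
    vertexFactor_of_three_le v (by omega), highFactor_mul_highFactor v (by omega) (by omega)]
  congr 1
  omega

end Series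

/-! ### Substitutions of variables -/

section Substitution

variable {V V' : Type u} [DecidableEq V] [Fintype V'] [DecidableEq V'] (κ : V' → V) (τ : V' → ℤˣ)

/-- The effect on exponents of the substitution `z_{v'} ↦ z_{κ v'} ^ (τ v')`. -/
def expHom : (V' → ℤ) →+ (V → ℤ) where
  toFun e v := ∑ v' : V', if κ v' = v then (τ v' : ℤ) * e v' else 0
  map_zero' := by ext v; simp
  map_add' e e' := by
    ext v
    simp only [Pi.add_apply, ← Finset.sum_add_distrib]
    refine Finset.sum_congr rfl fun v' _ => ?_
    split_ifs <;> ring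

theorem expHom_apply (e : V' → ℤ) (v : V) :
    expHom κ τ e v = ∑ v' : V', if κ v' = v then (τ v' : ℤ) * e v' else 0 := rfl

theorem expHom_single (v' : V') (c : ℤ) :
    expHom κ τ (Pi.single v' c) = Pi.single (κ v') ((τ v' : ℤ) * c) := by
  ext v
  rw [expHom_apply, Finset.sum_eq_single v']
  · by_cases h : κ v' = v
    · subst h; simp
    · rw [if_neg h, Pi.single_eq_of_ne (Ne.symm h)]
  · intro x _ hx
    simp [hx]
  · simp

/-- The substitution `z_{v'} ↦ z_{κ v'} ^ (τ v')`. -/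
def substHom : TSeries V' →+* TSeries V where
  toFun D := D.map (AddMonoidAlgebra.mapDomainRingHom ℤ (expHom κ τ))
  map_zero' := by ext1; funext k; simp
  map_one' := HahnSeries.map_one
    (AddMonoidAlgebra.mapDomainRingHom ℤ (expHom κ τ)).toMonoidWithZeroHom
  map_add' x y := by ext1; funext k; simp [AddMonoidAlgebra.mapDomain_add]
  map_mul' x y := HahnSeries.map_mul
    (AddMonoidAlgebra.mapDomainRingHom ℤ (expHom κ τ)).toNonUnitalRingHom

theorem substHom_coeff (D : TSeries V') (k : ℤ) :
    (substHom κ τ D).coeff k = AddMonoidAlgebra.mapDomain (expHom κ τ) (D.coeff k) := rfl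

theorem substHom_tMonomial (k : ℤ) (e : V' → ℤ) :
    substHom κ τ (tMonomial k e) = tMonomial k (expHom κ τ e) := by
  ext1
  funext j
  rw [substHom_coeff, tMonomial, tMonomial]
  by_cases h : j = k
  · subst h; simp
  · simp [HahnSeries.coeff_single_of_ne h]

theorem substHom_leafFactor (v : V') (s : ℤ) : substHom κ τ (leafFactor v s) =
    (((τ v : ℤˣ) : ℤ) : TSeries V) * leafFactor (κ v) ((τ v : ℤ) * s) := by
  rw [leafFactor, map_sub, substHom_tMonomial, substHom_tMonomial, expHom_single, expHom_single]
  rcases Int.units_eq_one_or (τ v) with h | h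
  · rw [h]; simp [leafFactor]
  · rw [h]; simp [leafFactor]
    ring

theorem expansionTerm_mul (p : ℕ) (ξ η : ℤˣ) (k : ℤ) :
    expansionTerm p (η * ξ) k = ((η ^ p : ℤˣ) : ℤ) * expansionTerm p ξ k := by
  unfold expansionTerm
  split_ifs
  · push_cast
    rw [← mul_neg, mul_pow]
    ring
  · simp

theorem substHom_highFactor (w : V') (p : ℕ) (ξ : ℤˣ) : substHom κ τ (highFactor w p ξ) =
    (((τ w ^ p : ℤˣ) : ℤ) : TSeries V) * highFactor (κ w) p (τ w * ξ) := by
  have hu : ((τ w ^ p : ℤˣ) : ℤ) * ((τ w ^ p : ℤˣ) : ℤ) = 1 := by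
    rcases Int.units_eq_one_or (τ w ^ p) with h | h <;> rw [h] <;> rfl
  ext1
  funext k
  rw [← zsmul_eq_mul, HahnSeries.coeff_smul, substHom_coeff, highFactor_coeff, highFactor_coeff,
    AddMonoidAlgebra.mapDomain_single, expHom_single, AddMonoidAlgebra.smul_single,
    expansionTerm_mul, smul_eq_mul, ← mul_assoc (((τ w ^ p : ℤˣ) : ℤ)), hu, one_mul]
  congr 2
  push_cast
  ring

/-- The sign is `τ^d` uniformly: a leaf factor is odd under inversion of its variable, the expansion
yields `τ^(d-2)`, and `τ² = 1`. -/
theorem substHom_vertexFactor (v : V') (d : ℕ) (s : ℤ) (ξ : ℤˣ) :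
    substHom κ τ (vertexFactor v d s ξ) =
      (((τ v ^ d : ℤˣ) : ℤ) : TSeries V) * vertexFactor (κ v) d ((τ v : ℤ) * s) (τ v * ξ) := by
  have h2 : τ v ^ 2 = 1 := by rcases Int.units_eq_one_or (τ v) with h | h <;> rw [h] <;> rfl
  unfold vertexFactor
  split_ifs with h0 h1 h3
  · subst h0
    rw [map_pow, substHom_leafFactor, mul_zero, mul_pow, pow_zero, ← Int.cast_pow, ← Units.val_pow_eq_pow_val, h2]
  · subst h1
    rw [substHom_leafFactor, pow_one]
  · subst h3
    rw [map_one, h2]; simp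
  · rw [substHom_highFactor]
    congr 3
    conv_rhs => rw [show d = d - 2 + 2 by omega, pow_add, h2, mul_one]

end Substitution

/-! ### Supports of series -/

section Support

variable {V : Type u}

/-- All exponents of the `z`-monomials that occur in `D` lie in `S`. -/
def ExponentsIn (S : Set (V → ℤ)) (D : TSeries V) : Prop :=
  ∀ k e, (D.coeff k).coeff e ≠ 0 → e ∈ S

theorem ExponentsIn.mono {S T : Set (V → ℤ)} {D : TSeries V} (h : ExponentsIn S D) (hST : S ⊆ T) :
    ExponentsIn T D := fun k e he => hST (h k e he)

theorem exponentsIn_one : ExponentsIn ({0} : Set (V → ℤ)) 1 := by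
  intro k e he
  rw [HahnSeries.coeff_one] at he
  split_ifs at he
  · rw [AddMonoidAlgebra.one_def, AddMonoidAlgebra.coeff_single] at he
    by_contra h
    exact he (Finsupp.single_eq_of_ne h)
  · simp at he

theorem ExponentsIn.mul {S T : Set (V → ℤ)} {D E : TSeries V} (hD : ExponentsIn S D)
    (hE : ExponentsIn T E) : ExponentsIn {e | ∃ a ∈ S, ∃ b ∈ T, e = a + b} (D * E) := by
  classical
  intro k e he
  rw [HahnSeries.coeff_mul, AddMonoidAlgebra.coeff_sum, Finsupp.finsetSum_apply] at he
  obtain ⟨ij, -, hij⟩ := Finset.exists_ne_zero_of_sum_ne_zero he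
  rw [AddMonoidAlgebra.coeff_mul, Finsupp.sum] at hij
  obtain ⟨a, ha, ha'⟩ := Finset.exists_ne_zero_of_sum_ne_zero hij
  rw [Finsupp.sum] at ha'
  obtain ⟨b, hb, hb'⟩ := Finset.exists_ne_zero_of_sum_ne_zero ha'
  refine ⟨a, hD _ _ (Finsupp.mem_support_iff.1 ha), b, hE _ _ (Finsupp.mem_support_iff.1 hb), ?_⟩
  by_contra h
  exact hb' (if_neg fun h' => h h'.symm)

variable [DecidableEq V]

theorem exponentsIn_prod (s : Finset V) (F : V → TSeries V) (C : V → Set ℤ)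
    (h : ∀ v ∈ s, ExponentsIn {e | ∃ c ∈ C v, e = Pi.single v c} (F v)) :
    ExponentsIn {e | (∀ v ∈ s, e v ∈ C v) ∧ ∀ v ∉ s, e v = 0} (∏ v ∈ s, F v) := by
  induction s using Finset.induction_on with
  | empty =>
    rw [Finset.prod_empty]
    refine exponentsIn_one.mono ?_
    rintro e rfl
    simp
  | insert a s ha ih =>
    rw [Finset.prod_insert ha]
    refine ((h a (by simp)).mul (ih fun v hv => h v (by simp [hv]))).mono ?_
    rintro e ⟨_, ⟨c, hc, rfl⟩, b, ⟨hb1, hb2⟩, rfl⟩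
    constructor
    · intro v hv
      rcases Finset.mem_insert.1 hv with rfl | hv'
      · simpa [hb2 v ha] using hc
      · have hva : v ≠ a := by rintro rfl; exact ha hv'
        simpa [hva] using hb1 v hv'
    · intro v hv
      rw [Finset.mem_insert, not_or] at hv
      simp [hv.1, hb2 v hv.2]

theorem exponentsIn_tMonomial (k : ℤ) (e : V → ℤ) : ExponentsIn {e} (tMonomial k e) := by
  intro j e' he
  rw [tMonomial, HahnSeries.coeff_single] at he
  split_ifs at he
  · by_contra h
    exact he (Finsupp.single_eq_of_ne h)
  · simp at he

theorem exponentsIn_leafFactor (v : V) (s : ℤ) :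
    ExponentsIn {e | ∃ c ∈ ({1, -1} : Set ℤ), e = Pi.single v c} (leafFactor v s) := by
  intro k e he
  rw [leafFactor, HahnSeries.coeff_sub, AddMonoidAlgebra.coeff_sub, Finsupp.sub_apply] at he
  by_cases h1 : ((tMonomial s (Pi.single v 1) : TSeries V).coeff k).coeff e = 0
  · rw [h1, zero_sub, neg_ne_zero] at he
    exact ⟨-1, by simp, exponentsIn_tMonomial _ _ _ _ he⟩
  · exact ⟨1, by simp, exponentsIn_tMonomial _ _ _ _ h1⟩

theorem exponentsIn_highFactor (w : V) (p : ℕ) (ξ : ℤˣ) :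
    ExponentsIn {e | ∃ c ∈ {c : ℤ | 2 ∣ c - p}, e = Pi.single w c} (highFactor w p ξ) := by
  intro k e he
  rw [highFactor_coeff] at he
  refine ⟨(ξ : ℤ) * k, ?_, ?_⟩
  · have h2 : expansionTerm p ξ k ≠ 0 := by
      intro h
      simp [h] at he
    unfold expansionTerm at h2
    split_ifs at h2 with h
    · obtain ⟨-, r, hr⟩ := h
      rcases Int.units_eq_one_or ξ with rfl | rfl
      · exact ⟨r, by simpa using hr⟩
      · exact ⟨-r - p, by simp; linarith⟩
    · simp at h2
  · by_contra h
    exact he (Finsupp.single_eq_of_ne h)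

/-- The possible exponents at a vertex of degree `d`. -/
def vertexExponents (d : ℕ) : Set ℤ :=
  {c | 2 ∣ c - d ∧ (d = 2 → c = 0) ∧ (d = 1 → c = 1 ∨ c = -1)}

theorem exponentsIn_vertexFactor (v : V) (d : ℕ) (s : ℤ) (ξ : ℤˣ) :
    ExponentsIn {e | ∃ c ∈ vertexExponents d, e = Pi.single v c} (vertexFactor v d s ξ) := by
  unfold vertexFactor
  split_ifs with h0 h1 h2
  · rw [pow_two]
    refine ((exponentsIn_leafFactor v 0).mul (exponentsIn_leafFactor v 0)).mono ?_
    rintro e ⟨_, ⟨c, hc, rfl⟩, _, ⟨c', hc', rfl⟩, rfl⟩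
    refine ⟨c + c', ⟨?_, by omega, by omega⟩, (Pi.single_add _ _ _).symm⟩
    simp only [Set.mem_insert_iff, Set.mem_singleton_iff] at hc hc'
    omega
  · refine (exponentsIn_leafFactor v s).mono ?_
    rintro e ⟨c, hc, rfl⟩
    simp only [Set.mem_insert_iff, Set.mem_singleton_iff] at hc
    exact ⟨c, ⟨by omega, by omega, fun _ => hc⟩, rfl⟩
  · refine exponentsIn_one.mono ?_
    rintro e rfl
    exact ⟨0, ⟨by omega, by simp, by omega⟩, by simp⟩
  · refine (exponentsIn_highFactor v (d - 2) ξ).mono ?_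
    rintro e ⟨c, hc, rfl⟩
    simp only [Set.mem_ofPred_eq] at hc
    exact ⟨c, ⟨by omega, by omega, by omega⟩, rfl⟩

end Support

/-! ### Global form of the discriminant, and its pairing with the theta function -/

namespace Plumbing

section Global

variable {V : Type u} [Fintype V] [DecidableEq V] (Γ : Plumbing V)

/-- The exponents that can occur in the discriminant series. -/
def Admissible (e : V → ℤ) : Prop := ∀ v, e v ∈ vertexExponents (Γ.deg v)

open Classical in
/-- Extension of a sign vector by `1` to all vertices. -/
def extendSign (ξ : Γ.High → ℤˣ) (v : V) : ℤˣ := if h : Γ.IsHigh v then ξ ⟨v, h⟩ else 1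

/-- The product of the discriminant series of all vertices. -/
def fullDiscriminant (ξ : Γ.High → ℤˣ) : TSeries V :=
  ∏ v, vertexFactor v (Γ.deg v) (Γ.leafExp ξ v) (Γ.extendSign ξ v)

variable {Γ}

theorem extendSign_of_isHigh (ξ : Γ.High → ℤˣ) {v : V} (h : Γ.IsHigh v) :
    Γ.extendSign ξ v = ξ ⟨v, h⟩ := dif_pos h

theorem exponentsIn_fullDiscriminant (ξ : Γ.High → ℤˣ) :
    ExponentsIn {e | Γ.Admissible e} (Γ.fullDiscriminant ξ) := by
  refine (exponentsIn_prod Finset.univ _ (fun v => vertexExponents (Γ.deg v))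
    fun v _ => exponentsIn_vertexFactor v _ _ _).mono ?_
  intro e he v
  exact he.1 v (Finset.mem_univ v)

theorem deg_ne_zero_of_isHigh {w : V} (hw : Γ.IsHigh w) (v : V) : Γ.deg v ≠ 0 := by
  by_cases h : w = v
  · subst h
    rw [IsHigh] at hw
    omega
  · obtain ⟨i, hi⟩ := exists_isPathList (Γ := Γ) (Ne.symm h)
    cases i with
    | nil => exact (deg_pos hi.adj_head).ne'
    | cons b t => exact (deg_pos hi.adj_head).ne'

-- Every leaf lies on the branch of exactly one high vertex, so the leaf factors can be regrouped
-- vertex by vertex. With a high vertex present no vertex is isolated.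
open Classical in
theorem prod_discriminant_eq (h : Γ.highCount ≠ 0) (ξ : Γ.High → ℤˣ) :
    ∏ w : Γ.High, Γ.discriminant w (ξ w) = Γ.fullDiscriminant ξ := by
  classical
  obtain ⟨w₀, hw₀⟩ := nonempty_high_iff.1 h
  have h1 : ∀ v, vertexFactor v (Γ.deg v) (Γ.leafExp ξ v) (Γ.extendSign ξ v) =
      (if Γ.IsHigh v then highFactor v (Γ.deg v - 2) (Γ.extendSign ξ v) else 1) *
        (if Γ.deg v = 1 then leafFactor v (Γ.leafExp ξ v) else 1) := by
    intro v
    have := deg_ne_zero_of_isHigh hw₀ v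
    unfold vertexFactor IsHigh
    split_ifs <;> first | omega | simp
  rw [fullDiscriminant, Finset.prod_congr rfl fun v _ => h1 v, Finset.prod_mul_distrib]
  unfold discriminant
  rw [Finset.prod_mul_distrib]
  congr 1
  · rw [← Finset.prod_filter, Finset.prod_subtype (Finset.univ.filter Γ.IsHigh)
      (p := Γ.IsHigh) (by simp)]
    exact Finset.prod_congr rfl fun w _ => by rw [extendSign_of_isHigh ξ w.2]
  · rw [← Finset.prod_filter]
    have h2 : ∀ w : Γ.High,
        ∏ v ∈ Finset.univ.filter (fun v => Γ.IsBranch w v),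
          leafFactor v ((ξ w : ℤ) * Γ.branchSign w v) =
        ∏ v ∈ Finset.univ.filter (fun v => Γ.deg v = 1),
          if Γ.IsBranch w v then leafFactor v (Γ.leafExp ξ v) else 1 := by
      intro w
      rw [← Finset.prod_filter, Finset.filter_filter]
      refine Finset.prod_congr ?_ ?_
      · ext v
        simp only [Finset.mem_filter, Finset.mem_univ, true_and]
        exact ⟨fun h => ⟨h.2.1, h⟩, fun h => h.2⟩
      · intro v hv
        rw [leafExp_of_isBranch ξ (Finset.mem_filter.1 hv).2.2]
    rw [Finset.prod_congr rfl fun w _ => h2 w, Finset.prod_comm]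
    refine Finset.prod_congr rfl fun v hv => ?_
    obtain ⟨w, hw⟩ := exists_isBranch (Finset.mem_filter.1 hv).2 hw₀
    rw [Finset.prod_eq_single ⟨w, hw.1⟩]
    · exact if_pos hw
    · intro w' _ hw'
      exact if_neg fun h' => hw' (Subtype.ext (h'.root_unique hw))
    · simp

theorem lowDiscriminant_eq (h : Γ.highCount = 0) (ξ : Γ.High → ℤˣ) :
    Γ.lowDiscriminant = Γ.fullDiscriminant ξ := by
  classical
  have hlow : ∀ v, ¬Γ.IsHigh v := fun v hv => nonempty_high_iff.2 ⟨v, hv⟩ h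
  have he : IsEmpty Γ.High := ⟨fun w => hlow w.1 w.2⟩
  refine Finset.prod_congr rfl fun v _ => ?_
  have h1 : Γ.leafExp ξ v = 0 := by
    rw [leafExp]
    exact Finset.sum_of_isEmpty _
  have h2 := hlow v
  rw [IsHigh, not_le] at h2
  rw [h1]
  have h3 : Γ.deg v = 0 ∨ Γ.deg v = 1 ∨ Γ.deg v = 2 := by omega
  rcases h3 with h3 | h3 | h3 <;> rw [h3]
  · rw [vertexFactor_zero]
  · rw [vertexFactor_one, pow_one]
  · rw [vertexFactor_two, Nat.sub_self, pow_zero]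

/-- Without high vertices there is a single, empty sign vector and all leaf exponents are zero, so
the averaged formula covers this case too. -/
theorem zHatCoeff_eq (a : V → ℤ) (n : ℚ) (k : ℤ) :
    Γ.zHatCoeff a n k = (-1) ^ posEigenCount Γ.linkingMatrix *
      (((∑ ξ ∈ Γ.chambers, Γ.ctTheta a (Γ.fullDiscriminant ξ) n k : ℤ) : ℚ) /
        (Γ.chambers.card : ℚ)) := by
  classical
  unfold zHatCoeff
  congr 1
  split_ifs with h
  · have hlow : ∀ v, ¬Γ.IsHigh v := fun v hv => nonempty_high_iff.2 ⟨v, hv⟩ h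
    have he : IsEmpty Γ.High := ⟨fun w => hlow w.1 w.2⟩
    have hc : Γ.chambers = {isEmptyElim} := by
      ext ξ
      rw [Finset.mem_singleton]
      refine ⟨fun _ => Subsingleton.elim _ _, fun _ => mem_chambers.2 fun w => isEmptyElim w⟩
    rw [hc, Finset.sum_singleton, Finset.card_singleton, Nat.cast_one, div_one,
      lowDiscriminant_eq h]
  · simp only [prod_discriminant_eq h]

open Classical in
/-- Pairing with the theta function, as an additive map. -/
def ctThetaHom (Γ : Plumbing V) (a : V → ℤ) (n : ℚ) (k : ℤ) : TSeries V →+ ℤ where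
  toFun D := Γ.ctTheta a D n k
  map_zero' := by simp [ctTheta]
  map_add' D E := by
    unfold ctTheta
    rw [HahnSeries.coeff_add, AddMonoidAlgebra.coeff_add, Finsupp.sum_add_index']
    · intro e; simp
    · intro e b c; split_ifs <;> simp

theorem ctThetaHom_apply (a : V → ℤ) (n : ℚ) (k : ℤ) (D : TSeries V) :
    Γ.ctThetaHom a n k D = Γ.ctTheta a D n k := rfl

theorem ctTheta_intCast_mul (a : V → ℤ) (n : ℚ) (k : ℤ) (c : ℤ) (D : TSeries V) :
    Γ.ctTheta a ((c : TSeries V) * D) n k = c * Γ.ctTheta a D n k := by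
  rw [← zsmul_eq_mul, ← ctThetaHom_apply, map_zsmul, ctThetaHom_apply, smul_eq_mul]

variable {V' : Type u} [Fintype V'] [DecidableEq V'] {Γ' : Plumbing V'}

/-- Only the class and the `q`-exponent of each monomial enter the pairing, so monomials may be
replaced, and collected, by their images. -/
theorem ctTheta_substHom {a : V → ℤ} {a' : V' → ℤ} {κ : V' → V} {τ : V' → ℤˣ} {S : Set (V' → ℤ)}
    (h : ∀ e ∈ S, (Γ'.SpincEquiv a' (-e) ↔ Γ.SpincEquiv a (-(expHom κ τ e))) ∧
      Γ'.qExponent (-e) = Γ.qExponent (-(expHom κ τ e)))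
    {D : TSeries V'} (hD : ExponentsIn S D) (n : ℚ) (k : ℤ) :
    Γ'.ctTheta a' D n k = Γ.ctTheta a (substHom κ τ D) n k := by
  classical
  unfold ctTheta
  rw [substHom_coeff]
  simp only [AddMonoidAlgebra.mapDomain, AddMonoidAlgebra.coeff_ofCoeff]
  rw [Finsupp.sum_mapDomain_index]
  · refine Finset.sum_congr rfl fun e he => ?_
    obtain ⟨h1, h2⟩ := h e (hD k e (Finsupp.mem_support_iff.1 he))
    exact if_congr (by rw [h1, h2]) rfl rfl
  · intro e; simp
  · intro e b c; split_ifs <;> simp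

/-- The substitution `z_{v'} ↦ z_{κ v'} ^ (τ v')` carries the theta function of `Γ'` to that
of `Γ`, as far as admissible exponents are concerned. -/
structure ThetaReduction (Γ : Plumbing V) (Γ' : Plumbing V') (a : V → ℤ) (a' : V' → ℤ)
    (κ : V' → V) (τ : V' → ℤˣ) : Prop where
  spinc : ∀ e, Γ'.Admissible e → (Γ'.SpincEquiv a' (-e) ↔ Γ.SpincEquiv a (-(expHom κ τ e)))
  qExp : ∀ e, Γ'.Admissible e → Γ'.qExponent (-e) = Γ.qExponent (-(expHom κ τ e))
  sign : (-1 : ℤˣ) ^ posEigenCount Γ'.linkingMatrix =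
    (∏ v, τ v ^ Γ'.deg v) * (-1) ^ posEigenCount Γ.linkingMatrix

/-- The image, up to sign, of the discriminant series under the substitution
`z_{v'} ↦ z_{κ v'} ^ (τ v')`. -/
def substDiscriminant (Γ' : Plumbing V') (κ : V' → V) (τ : V' → ℤˣ) (ξ : Γ'.High → ℤˣ) :
    TSeries V :=
  ∏ v, vertexFactor (κ v) (Γ'.deg v) ((τ v : ℤ) * Γ'.leafExp ξ v) (τ v * Γ'.extendSign ξ v)

theorem substHom_fullDiscriminant (κ : V' → V) (τ : V' → ℤˣ) (ξ : Γ'.High → ℤˣ) :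
    substHom κ τ (Γ'.fullDiscriminant ξ) =
      (((∏ v, τ v ^ Γ'.deg v : ℤˣ) : ℤ) : TSeries V) * Γ'.substDiscriminant κ τ ξ := by
  rw [fullDiscriminant, map_prod, Finset.prod_congr rfl fun v _ => substHom_vertexFactor κ τ v _ _ _,
    Finset.prod_mul_distrib, substDiscriminant]
  congr 1
  rw [← Int.cast_prod, Units.coe_prod]

/-- The sign from the substitution and the sign from `(-1)^π` are the same and multiply to `1`. -/
theorem ThetaReduction.zHatCoeff_eq {a : V → ℤ} {a' : V' → ℤ} {κ : V' → V} {τ : V' → ℤˣ}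
    (h : ThetaReduction Γ Γ' a a' κ τ) (n : ℚ) (k : ℤ) :
    Γ'.zHatCoeff a' n k = (-1) ^ posEigenCount Γ.linkingMatrix *
      (((∑ ξ ∈ Γ'.chambers, Γ.ctTheta a (Γ'.substDiscriminant κ τ ξ) n k : ℤ) : ℚ) /
        (Γ'.chambers.card : ℚ)) := by
  rw [Plumbing.zHatCoeff_eq]
  have h1 : ∀ ξ, Γ'.ctTheta a' (Γ'.fullDiscriminant ξ) n k =
      ((∏ v, τ v ^ Γ'.deg v : ℤˣ) : ℤ) * Γ.ctTheta a (Γ'.substDiscriminant κ τ ξ) n k := by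
    intro ξ
    rw [ctTheta_substHom (fun e he => ⟨h.spinc e he, h.qExp e he⟩)
      (exponentsIn_fullDiscriminant ξ), substHom_fullDiscriminant, ctTheta_intCast_mul]
  have h2 : ((-1 : ℚ)) ^ posEigenCount Γ'.linkingMatrix =
      ((((∏ v, τ v ^ Γ'.deg v : ℤˣ) : ℤ)) : ℚ) * (-1) ^ posEigenCount Γ.linkingMatrix := by
    have := congrArg (fun x : ℤˣ => ((x : ℤ) : ℚ)) h.sign
    simpa using this
  have h3 : (((∏ v, τ v ^ Γ'.deg v : ℤˣ) : ℤ) : ℚ) * (((∏ v, τ v ^ Γ'.deg v : ℤˣ) : ℤ) : ℚ) = 1 := by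
    rcases Int.units_eq_one_or (∏ v, τ v ^ Γ'.deg v) with h | h <;> rw [h] <;> norm_num
  rw [Finset.sum_congr rfl fun ξ _ => h1 ξ, ← Finset.mul_sum, h2, Int.cast_mul]
  linear_combination ((-1 : ℚ) ^ posEigenCount Γ.linkingMatrix *
    (((∑ ξ ∈ Γ'.chambers, Γ.ctTheta a (Γ'.substDiscriminant κ τ ξ) n k : ℤ) : ℚ) /
        (Γ'.chambers.card : ℚ))) * h3

theorem ThetaReduction.zHatCoeff_eq_of_bijOn {a : V → ℤ} {a' : V' → ℤ} {κ : V' → V} {τ : V' → ℤˣ}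
    (h : ThetaReduction Γ Γ' a a' κ τ) (g : (Γ'.High → ℤˣ) → (Γ.High → ℤˣ))
    (hg : Set.BijOn g Γ'.chambers Γ.chambers)
    (hD : ∀ ξ ∈ Γ'.chambers, Γ'.substDiscriminant κ τ ξ = Γ.fullDiscriminant (g ξ)) (n : ℚ) (k : ℤ) :
    Γ'.zHatCoeff a' n k = Γ.zHatCoeff a n k := by
  rw [h.zHatCoeff_eq, Plumbing.zHatCoeff_eq]
  have hcard : Γ'.chambers.card = Γ.chambers.card :=
    Finset.card_nbij g hg.mapsTo hg.injOn hg.surjOn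
  have hsum : ∑ ξ ∈ Γ'.chambers, Γ.ctTheta a (Γ'.substDiscriminant κ τ ξ) n k =
      ∑ ξ ∈ Γ.chambers, Γ.ctTheta a (Γ.fullDiscriminant ξ) n k :=
    Finset.sum_nbij g hg.mapsTo hg.injOn hg.surjOn fun ξ hξ => by rw [hD ξ hξ]
  rw [hcard, hsum]

theorem ThetaReduction.zHatCoeff_eq_of_equiv {a : V → ℤ} {a' : V' → ℤ} {κ : V' → V} {τ : V' → ℤˣ}
    (h : ThetaReduction Γ Γ' a a' κ τ) (g : (Γ'.High → ℤˣ) ≃ (Γ.High → ℤˣ))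
    (hg : ∀ ξ, g ξ ∈ Γ.chambers ↔ ξ ∈ Γ'.chambers)
    (hD : ∀ ξ ∈ Γ'.chambers, Γ'.substDiscriminant κ τ ξ = Γ.fullDiscriminant (g ξ)) (n : ℚ) (k : ℤ) :
    Γ'.zHatCoeff a' n k = Γ.zHatCoeff a n k :=
  h.zHatCoeff_eq_of_bijOn g ⟨fun ξ hξ => (hg ξ).2 hξ, g.injective.injOn, fun η hη =>
    ⟨g.symm η, (hg _).1 (by rwa [g.apply_symm_apply]), g.apply_symm_apply η⟩⟩ hD n k

end Global

/-! ### Products of signs over a graph -/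

section SignProduct

variable {V : Type u} [Fintype V] [DecidableEq V] {Γ : Plumbing V}

/-- Grouping by edges, an edge contributes the product of the signs at its ends. All of these are
`1` except at the one edge across which the sign may change. -/
theorem prod_pow_deg (τ : V → ℤˣ) {x y : V} (hxy : Γ.graph.Adj x y)
    (h : ∀ a b, Γ.graph.Adj a b → s(a, b) ≠ s(x, y) → τ a = τ b) :
    ∏ v, τ v ^ Γ.deg v = τ x * τ y := by
  classical
  have h1 : ∏ v, τ v ^ Γ.deg v = ∏ d : Γ.graph.Dart, τ d.fst := by
    rw [← Finset.prod_fiberwise_of_maps_to (t := Finset.univ) (g := fun d : Γ.graph.Dart => d.fst)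
      (by simp)]
    refine Finset.prod_congr rfl fun v _ => ?_
    rw [Finset.prod_congr rfl (g := fun _ => τ v) (fun d hd => by
      rw [(Finset.mem_filter.1 hd).2]), Finset.prod_const]
    congr 1
    rw [deg, ← SimpleGraph.dart_fst_fiber_card_eq_degree]
  rw [h1, ← Finset.prod_fiberwise_of_maps_to (t := Γ.graph.edgeFinset)
    (g := fun d : Γ.graph.Dart => d.edge) (by intro d _; simp)]
  have hfib : ∀ d : Γ.graph.Dart, ∏ d' : Γ.graph.Dart with d'.edge = d.edge, τ d'.fst =
      τ d.fst * τ d.snd := by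
    intro d
    rw [SimpleGraph.Dart.edge_fiber, Finset.prod_pair d.symm_ne.symm]
    rfl
  rw [Finset.prod_eq_single s(x, y)]
  · exact hfib ⟨(x, y), hxy⟩
  · intro e he hne
    induction e using Sym2.ind with
    | _ a b =>
    have hab : Γ.graph.Adj a b := by simpa using he
    have := hfib ⟨(a, b), hab⟩
    rw [SimpleGraph.Dart.edge_mk] at this
    rw [this]
    simp only
    rw [h a b hab hne]
    exact Int.units_mul_self _
  · intro hn
    simp [hxy] at hn

end SignProduct
end Plumbing

/-! ### Branches and the linking matrix -/

namespace Plumbing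

section ArcNeighbors

variable {V : Type u} [Fintype V] {Γ : Plumbing V}

theorem Arc.exists_neighbors {w v z : V} {i : List V} (h : Γ.Arc w i v) (hz : z ∈ i) :
    ∃ t₁ t₂ a b, w :: (i ++ [v]) = t₁ ++ a :: z :: b :: t₂ ∧ a ≠ b ∧ Γ.graph.Adj z a ∧
      Γ.graph.Adj z b := by
  obtain ⟨s₁, s₂, rfl⟩ := List.append_of_mem hz
  obtain ⟨a, l₁, h1⟩ : ∃ a l₁, w :: s₁ = l₁ ++ [a] := by
    rcases List.eq_nil_or_concat (w :: s₁) with h0 | ⟨l, a, h0⟩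
    · simp at h0
    · exact ⟨a, l, by simpa using h0⟩
  obtain ⟨b, l₂, h2⟩ : ∃ b l₂, s₂ ++ [v] = b :: l₂ := by
    cases s₂ with
    | nil => exact ⟨v, [], rfl⟩
    | cons b t => exact ⟨b, _, rfl⟩
  have h3 : w :: (s₁ ++ z :: s₂ ++ [v]) = l₁ ++ a :: z :: b :: l₂ := by
    have : w :: (s₁ ++ z :: s₂ ++ [v]) = (w :: s₁) ++ (z :: (s₂ ++ [v])) := by simp
    rw [this, h1, h2]
    simp
  have h4 := h.1
  rw [h3] at h4
  have h5 := h4.of_append_right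
  have h6 := h5.2
  simp only [List.nodup_cons, List.mem_cons] at h6
  exact ⟨l₁, l₂, a, b, h3, by tauto, h5.adj_head.symm, h5.of_cons.adj_head⟩

theorem Arc.mem_of_adj {w v z z' : V} {i : List V} (h : Γ.Arc w i v) (hz : z ∈ i)
    (hzz : Γ.graph.Adj z z') : z' ∈ w :: (i ++ [v]) := by
  obtain ⟨t₁, t₂, a, b, h1, hab, ha, hb⟩ := h.exists_neighbors hz
  rw [h1]
  rcases eq_or_eq_of_deg_eq_two (h.2 z hz) ha hb hab hzz with rfl | rfl <;> simp

theorem Arc.mem_of_adj_leaf {w v z' : V} {i : List V} (h : Γ.Arc w i v) (hv : Γ.deg v = 1)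
    (hzz : Γ.graph.Adj v z') : z' ∈ w :: i := by
  have h1 := h.reverse.1
  obtain ⟨b, l, hl⟩ : ∃ b l, i.reverse ++ [w] = b :: l := by
    cases i.reverse with
    | nil => exact ⟨w, [], rfl⟩
    | cons b t => exact ⟨b, _, rfl⟩
  rw [hl] at h1
  obtain rfl : z' = b := eq_of_deg_eq_one hv hzz h1.adj_head
  have h2 : z' ∈ i.reverse ++ [w] := by rw [hl]; simp
  rcases List.mem_append.1 h2 with h3 | h3
  · simp [List.mem_reverse.1 h3]
  · simp [List.mem_singleton.1 h3]

/-- As long as the end is not a leaf it has a further neighbour, which is new because the graph is a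
tree; finiteness of `V` stops the process. -/
theorem IsPathList.exists_extension_to_leaf {p : List V} {y x : V}
    (h : Γ.IsPathList (p ++ [y, x])) :
    ∃ r z, Γ.IsPathList (p ++ [y] ++ (r ++ [z])) ∧ Γ.deg z = 1 ∧ x ∈ r ++ [z] := by
  induction hn : Fintype.card V - p.length using Nat.strong_induction_on generalizing p y x with
  | _ n ih =>
  subst hn
  have hadj : Γ.graph.Adj x y := (h.of_append_right.adj_head).symm
  by_cases hx : Γ.deg x = 1
  · exact ⟨[], x, by simpa using h, hx, by simp⟩
  · have h1 : ∃ z, Γ.graph.Adj x z ∧ z ≠ y := by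
      classical
      by_contra hcon
      push Not at hcon
      apply hx
      rw [deg, SimpleGraph.degree_eq_one_iff_existsUnique_adj]
      exact ⟨y, hadj, hcon⟩
    obtain ⟨z, hxz, hzy⟩ := h1
    have hz : z ∉ p ++ [y, x] := by
      intro hz
      have hrev := h.reverse
      simp only [List.reverse_append, List.reverse_cons, List.reverse_nil, List.nil_append,
        List.cons_append] at hrev
      have hzp : z ∈ p := by
        simp only [List.mem_append, List.mem_cons, List.not_mem_nil, or_false] at hz
        rcases hz with hz | hz | hz
        · exact hz
        · exact absurd hz hzy
        · exact absurd hz hxz.ne'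
      exact hrev.not_adj (List.mem_reverse.2 hzp) hxz
    have hp' : Γ.IsPathList (p ++ [y] ++ [x, z]) := by
      constructor
      · have h2 := h.1
        rw [show p ++ [y] ++ [x, z] = (p ++ [y, x]) ++ [z] by simp]
        rw [List.isChain_append]
        refine ⟨h2, by simp, ?_⟩
        intro a ha b hb
        simp at ha hb
        subst ha hb
        exact hxz
      · rw [show p ++ [y] ++ [x, z] = (p ++ [y, x]) ++ [z] by simp, List.nodup_append]
        refine ⟨h.2, by simp, ?_⟩
        intro a ha b hb
        simp at hb
        subst hb
        rintro rfl
        exact hz ha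
    have hlen : p.length < Fintype.card V := by
      have := h.2.length_le_card
      simp at this
      omega
    obtain ⟨r, z', h3, h4, h5⟩ := ih (Fintype.card V - (p ++ [y]).length) (by simp; omega) hp' rfl
    refine ⟨x :: r, z', ?_, h4, by simp⟩
    simpa using h3

end ArcNeighbors

/-! ### Rows of the linking matrix and columns of its inverse -/

section MulVec

variable {V : Type u} [Fintype V] [DecidableEq V] {Γ : Plumbing V} {R : Type*} [CommRing R]

open Classical in
theorem linkingMatrix_mulVec (u : V → R) (v : V) :
    ((Γ.linkingMatrix.map (Int.cast : ℤ → R)).mulVec u) v =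
      (Γ.weight v : R) * u v + ∑ y, if Γ.graph.Adj v y then u y else 0 := by
  rw [Matrix.mulVec, dotProduct]
  have h1 : ∀ y, (Γ.linkingMatrix.map (Int.cast : ℤ → R)) v y * u y =
      (if y = v then (Γ.weight v : R) * u v else 0) + if Γ.graph.Adj v y then u y else 0 := by
    intro y
    rw [Matrix.map_apply]
    by_cases hy : y = v
    · subst hy
      simp [linkingMatrix_self]
    · rw [linkingMatrix_of_ne (Ne.symm hy), if_neg hy]
      split_ifs <;> simp
  rw [Finset.sum_congr rfl fun y _ => h1 y, Finset.sum_add_distrib, Finset.sum_ite_eq']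
  simp

theorem linkingMatrix_mulVec_of_deg_one (u : V → R) {v a : V} (hv : Γ.deg v = 1)
    (ha : Γ.graph.Adj v a) : ((Γ.linkingMatrix.map (Int.cast : ℤ → R)).mulVec u) v =
      (Γ.weight v : R) * u v + u a := by
  classical
  rw [linkingMatrix_mulVec, Finset.sum_eq_single a, if_pos ha]
  · intro b _ hb
    exact if_neg fun h => hb (eq_of_deg_eq_one hv h ha)
  · simp

theorem linkingMatrix_mulVec_of_deg_two (u : V → R) {v a b : V} (hv : Γ.deg v = 2)
    (ha : Γ.graph.Adj v a) (hb : Γ.graph.Adj v b) (hab : a ≠ b) :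
    ((Γ.linkingMatrix.map (Int.cast : ℤ → R)).mulVec u) v =
      (Γ.weight v : R) * u v + (u a + u b) := by
  classical
  rw [linkingMatrix_mulVec, ← Finset.sum_pair hab]
  congr 1
  rw [← Finset.sum_filter]
  congr 1
  ext y
  simp only [Finset.mem_filter, Finset.mem_univ, true_and, Finset.mem_insert, Finset.mem_singleton]
  constructor
  · exact fun h => eq_or_eq_of_deg_eq_two hv ha hb hab h
  · rintro (rfl | rfl) <;> assumption

/-- Along vertices of degree two the equation `Mu = 0` is a three-term recursion, so two consecutive
zeros propagate. -/
theorem eq_zero_of_isPathList {u : V → R} {a b : V} {l : List V}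
    (h : Γ.IsPathList (a :: b :: l)) (hd : ∀ x ∈ (b :: l).dropLast, Γ.deg x = 2)
    (hu : ∀ x ∈ (b :: l).dropLast,
      ((Γ.linkingMatrix.map (Int.cast : ℤ → R)).mulVec u) x = 0)
    (ha : u a = 0) (hb : u b = 0) : ∀ x ∈ l, u x = 0 := by
  induction l generalizing a b with
  | nil => simp
  | cons c l ih =>
    have hac : a ≠ c := by
      rintro rfl
      have := (List.nodup_cons.1 h.2).1
      simp at this
    have hc : u c = 0 := by
      have h1 := hu b (by simp)
      rw [linkingMatrix_mulVec_of_deg_two u (hd b (by simp)) h.adj_head.symm h.of_cons.adj_head hac,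
        ha, hb] at h1
      simpa using h1
    intro x hx
    rcases List.mem_cons.1 hx with rfl | hx
    · exact hc
    · refine ih h.of_cons ?_ ?_ hb hc x hx
      · intro y hy; apply hd; simp [hy]
      · intro y hy; apply hu; simp [hy]

/-- In a plumbing with a single high-valency vertex `w` and invertible linking matrix, the column
of the inverse matrix belonging to `w` either has a non-zero entry at `w` or at exactly one leaf. -/
theorem exists_unique_leaf_of_apply_eq_zero {w : V} (hw : ∀ v, Γ.IsHigh v → v = w)
    {u : V → ℚ} (hu : (Γ.linkingMatrix.map (Int.cast : ℤ → ℚ)).mulVec u = Pi.single w 1)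
    (hinj : Function.Injective (Γ.linkingMatrix.map (Int.cast : ℤ → ℚ)).mulVec)
    (huw : u w = 0) : ∃ x, Γ.deg x = 1 ∧ u x ≠ 0 ∧ ∀ x', Γ.deg x' = 1 → x' ≠ x → x' ≠ w → u x' = 0 := by
  classical
  obtain ⟨y, hwy, huy⟩ : ∃ y, Γ.graph.Adj w y ∧ u y ≠ 0 := by
    by_contra hcon
    push Not at hcon
    have h1 := congrFun hu w
    rw [linkingMatrix_mulVec, huw, Finset.sum_eq_zero] at h1
    · simp at h1
    · intro y _
      split_ifs with h
      · exact hcon y h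
      · rfl
  have hp : Γ.IsPathList ([] ++ [w, y]) := ⟨by simpa using hwy, by simpa using hwy.ne⟩
  obtain ⟨i, x, hix, hx, hyi⟩ := hp.exists_extension_to_leaf
  have harc : Γ.Arc w i x := by
    have hix' : Γ.IsPathList (w :: (i ++ [x])) := by simpa using hix
    refine ⟨hix', fun z hz => ?_⟩
    have h1 := hix'.two_le_deg hz
    by_contra h2
    have h3 : z = w := hw z (by rw [IsHigh]; omega)
    subst h3
    exact (List.nodup_cons.1 hix'.2).1 (by simp [hz])
  have hwC : w ∉ i ++ [x] := (List.nodup_cons.1 harc.1.2).1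
  have hrow : ∀ z, z ≠ w → ((Γ.linkingMatrix.map (Int.cast : ℤ → ℚ)).mulVec u) z = 0 := by
    intro z hz
    rw [hu, Pi.single_eq_of_ne hz]
  have hclosed : ∀ z ∈ i ++ [x], ∀ z', Γ.graph.Adj z z' → z' ∈ i ++ [x] ∨ z' = w := by
    intro z hz z' hzz'
    rcases List.mem_append.1 hz with hz | hz
    · have := harc.mem_of_adj hz hzz'
      rw [List.mem_cons] at this
      exact this.symm
    · rw [List.mem_singleton] at hz
      subst hz
      have := harc.mem_of_adj_leaf hx hzz'
      rw [List.mem_cons] at this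
      exact this.symm.imp_left fun h => by simp [h]
  have hhead : ∀ z ∈ i ++ [x], Γ.graph.Adj w z → z = y := by
    intro z hz hwz
    obtain ⟨b, l, hl⟩ : ∃ b l, i ++ [x] = b :: l := by
      cases i with
      | nil => exact ⟨x, [], rfl⟩
      | cons b t => exact ⟨b, _, rfl⟩
    have h1 := harc.1
    rw [hl] at h1 hz hyi
    have key : ∀ z ∈ b :: l, Γ.graph.Adj w z → z = b := by
      intro z hz hwz
      rcases List.mem_cons.1 hz with rfl | hz
      · rfl
      · exact absurd hwz (h1.not_adj hz)
    rw [key z hz hwz, key y hyi hwy]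
  -- The column is cut down to the branch through `y`. Since `u_w = 0`, the cut introduces no error
  -- on the branch, and only row `w` can be nonzero.
  set v : V → ℚ := fun z => if z ∈ i ++ [x] then u z else 0 with hv
  have hMv : (Γ.linkingMatrix.map (Int.cast : ℤ → ℚ)).mulVec v = Pi.single w (u y) := by
    ext z
    by_cases hzw : z = w
    · subst hzw
      rw [linkingMatrix_mulVec, hv]
      simp only
      rw [if_neg hwC, mul_zero, zero_add, Pi.single_eq_same, Finset.sum_eq_single y,
        if_pos hwy, if_pos hyi]
      · intro b _ hb
        split_ifs with h1 h2
        · exact absurd (hhead b h2 h1) hb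
        · rfl
        · rfl
      · simp
    · rw [Pi.single_eq_of_ne hzw]
      by_cases hz : z ∈ i ++ [x]
      · rw [← hrow z hzw, linkingMatrix_mulVec, linkingMatrix_mulVec]
        congr 1
        · rw [hv]; simp only; rw [if_pos hz]
        · refine Finset.sum_congr rfl fun b _ => ?_
          split_ifs with h1
          · rcases hclosed z hz b h1 with h2 | h2
            · rw [hv]; simp only; rw [if_pos h2]
            · rw [hv]; simp only; rw [h2, if_neg hwC, huw]
          · rfl
      · rw [linkingMatrix_mulVec, hv]
        simp only
        rw [if_neg hz, mul_zero, zero_add]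
        refine Finset.sum_eq_zero fun b _ => ?_
        split_ifs with h1 h2
        · rcases hclosed b h2 z h1.symm with h3 | h3
          · exact absurd h3 hz
          · exact absurd h3 hzw
        · rfl
        · rfl
  -- Both sides have the same image under the injective matrix. Comparison at `y` gives `u_y = 1`,
  -- so `u` itself is supported on this branch and vanishes at all other leaves.
  have hvu : v = u y • u := by
    apply hinj
    rw [hMv, Matrix.mulVec_smul, hu]
    ext z
    by_cases hz : z = w
    · subst hz; simp
    · simp [hz]
  have huy1 : u y = 1 := by
    have h1 := congrFun hvu y
    rw [hv] at h1
    simp only [Pi.smul_apply, smul_eq_mul] at h1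
    rw [if_pos hyi] at h1
    exact (mul_right_cancel₀ huy (by rw [one_mul]; exact h1)).symm
  rw [huy1, one_smul] at hvu
  have hsupp : ∀ z, z ∉ i ++ [x] → u z = 0 := by
    intro z hz
    rw [← hvu, hv]
    exact if_neg hz
  refine ⟨x, hx, ?_, ?_⟩
  -- If `u` vanished at the leaf, the row of the leaf would make its neighbour vanish, and the
  -- recursion would carry the zeros up to `y`.
  · intro hux
    obtain ⟨b, l, hl⟩ : ∃ b l, i.reverse ++ [w] = b :: l := by
      cases i.reverse with
      | nil => exact ⟨w, [], rfl⟩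
      | cons b t => exact ⟨b, _, rfl⟩
    have h1 := harc.reverse
    have h2 := h1.1
    rw [hl] at h2
    have hxw : x ≠ w := harc.ne.symm
    have hub : u b = 0 := by
      have h3 := hrow x hxw
      rw [linkingMatrix_mulVec_of_deg_one u hx h2.adj_head, hux] at h3
      simpa using h3
    have hdrop : (b :: l).dropLast = i.reverse := by rw [← hl]; simp
    have h4 := eq_zero_of_isPathList (u := u) h2 (by rw [hdrop]; exact h1.2) (by
      rw [hdrop]
      intro z hz
      apply hrow
      rintro rfl
      exact hwC (by simp [List.mem_reverse.1 hz])) hux hub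
    apply huy
    rcases List.mem_append.1 hyi with h5 | h5
    · have h6 : y ∈ b :: l := by rw [← hl]; simp [h5]
      rcases List.mem_cons.1 h6 with rfl | h6
      · exact hub
      · exact h4 y h6
    · rw [List.mem_singleton] at h5
      rw [h5, hux]
  · intro x' hx' hne hxw'
    apply hsupp
    intro h1
    rcases List.mem_append.1 h1 with h2 | h2
    · have := harc.2 x' h2
      omega
    · exact hne (List.mem_singleton.1 h2)

end MulVec
end Plumbing

/-! ### Finiteness for plumbings with at most one high-valency vertex -/

namespace Plumbing

section Values

variable {V : Type u} [Fintype V] [DecidableEq V] {Γ : Plumbing V}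

/-- The coefficient of `q^n` of the pairing of `D` with the theta function is a finite sum of
powers of `t`, whose value at `t = 1` is `c`. -/
def HasValue (Γ : Plumbing V) (a : V → ℤ) (n : ℚ) (D : TSeries V) (c : ℤ) : Prop :=
  HasSum (fun k => Γ.ctTheta a D n k) c

variable {a : V → ℤ} {n : ℚ}

theorem HasValue.sub {D E : TSeries V} {c d : ℤ} (hD : Γ.HasValue a n D c)
    (hE : Γ.HasValue a n E d) : Γ.HasValue a n (D - E) (c - d) := by
  have h : (fun k => Γ.ctTheta a (D - E) n k) = fun k => Γ.ctTheta a D n k - Γ.ctTheta a E n k := by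
    funext k
    rw [← ctThetaHom_apply, map_sub]
    rfl
  rw [HasValue, h]
  exact HasSum.sub hD hE

theorem ctTheta_tMonomial_zero_mul (j : ℤ) (D : TSeries V) (k : ℤ) :
    Γ.ctTheta a (tMonomial j 0 * D) n k = Γ.ctTheta a D n (k - j) := by
  unfold ctTheta
  rw [tMonomial, HahnSeries.coeff_single_mul, ← AddMonoidAlgebra.one_def, one_mul]

/-- A power of `t` only permutes the coefficients in `k`; it is invisible at `t = 1`. -/
theorem HasValue.shift {D : TSeries V} {c : ℤ} (hD : Γ.HasValue a n D c) (j : ℤ) :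
    Γ.HasValue a n (tMonomial j 0 * D) c := by
  have h : (fun k => Γ.ctTheta a (tMonomial j 0 * D) n k) =
      (fun k => Γ.ctTheta a D n k) ∘ Equiv.subRight j := by
    funext k
    exact ctTheta_tMonomial_zero_mul j D k
  rw [HasValue, h]
  exact (Equiv.hasSum_iff (f := fun k => Γ.ctTheta a D n k) (Equiv.subRight j)).2 hD

/-- The value `c` is chosen before `s`. Each leaf factor is a difference of two monomials whose
powers of `t` alone depend on `s`, and these do not affect values. -/
theorem exists_hasValue_prod_leafFactor (S : Finset V) (D : TSeries V)
    (hD : ∀ η : V → ℤˣ, ∃ c, Γ.HasValue a n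
      (tMonomial 0 (∑ x ∈ S, Pi.single x (η x : ℤ)) * D) c) :
    ∃ c, ∀ s : V → ℤ, Γ.HasValue a n ((∏ x ∈ S, leafFactor x (s x)) * D) c := by
  induction S using Finset.induction_on generalizing D with
  | empty =>
    obtain ⟨c, hc⟩ := hD 1
    refine ⟨c, fun s => ?_⟩
    rw [Finset.prod_empty, one_mul]
    rw [Finset.sum_empty] at hc
    have h1 : (tMonomial 0 0 : TSeries V) = 1 := rfl
    rwa [h1, one_mul] at hc
  | insert x S hx ih =>
    have h1 : ∀ ε : ℤˣ, ∃ c, ∀ s : V → ℤ,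
        Γ.HasValue a n ((∏ y ∈ S, leafFactor y (s y)) * (tMonomial 0 (Pi.single x (ε : ℤ)) * D)) c := by
      intro ε
      apply ih
      intro η
      obtain ⟨c, hc⟩ := hD (Function.update η x ε)
      refine ⟨c, ?_⟩
      rw [Finset.sum_insert hx, Function.update_self, Finset.sum_congr rfl
        (g := fun y => Pi.single y (η y : ℤ)) (fun y hy => by
          rw [Function.update_of_ne (by rintro rfl; exact hx hy)])] at hc
      rwa [← mul_assoc, tMonomial_mul_tMonomial, add_zero, add_comm]
    obtain ⟨c₁, hc₁⟩ := h1 1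
    obtain ⟨c₂, hc₂⟩ := h1 (-1)
    refine ⟨c₁ - c₂, fun s => ?_⟩
    have h2 := ((hc₁ s).shift (s x)).sub ((hc₂ s).shift (-(s x)))
    have h3 : ∀ (j : ℤ) (e : V → ℤ), (tMonomial j e : TSeries V) =
        tMonomial j 0 * tMonomial 0 e := by
      intro j e
      rw [tMonomial_mul_tMonomial, add_zero, zero_add]
    have h4 : (∏ y ∈ insert x S, leafFactor y (s y)) * D =
        tMonomial (s x) 0 * ((∏ y ∈ S, leafFactor y (s y)) *
          (tMonomial 0 (Pi.single x ((1 : ℤˣ) : ℤ)) * D)) -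
        tMonomial (-(s x)) 0 * ((∏ y ∈ S, leafFactor y (s y)) *
          (tMonomial 0 (Pi.single x ((-1 : ℤˣ) : ℤ)) * D)) := by
      rw [Finset.prod_insert hx]
      have h5 : leafFactor x (s x) = tMonomial (s x) 0 * tMonomial 0 (Pi.single x ((1 : ℤˣ) : ℤ)) -
          tMonomial (-(s x)) 0 * tMonomial 0 (Pi.single x ((-1 : ℤˣ) : ℤ)) := by
        rw [← h3, ← h3]
        rfl
      rw [h5]
      ring
    rwa [h4]

theorem finite_setOf_quadratic_eq {α β γ : ℚ} (h : α ≠ 0 ∨ β ≠ 0) :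
    {k : ℤ | α * (k : ℚ) ^ 2 + β * k + γ = 0}.Finite := by
  set p : Polynomial ℚ := Polynomial.C α * Polynomial.X ^ 2 + Polynomial.C β * Polynomial.X +
    Polynomial.C γ with hp
  have hp0 : p ≠ 0 := by
    intro h0
    have h3 : p.coeff 1 = β := by
      simp [hp]
    rw [h0, Polynomial.coeff_zero] at h3
    have h4 : p.coeff 2 = α := by
      simp [hp]
    rw [h0, Polynomial.coeff_zero] at h4
    rcases h with h | h
    · exact h h4.symm
    · exact h h3.symm
  have hfin : (p.roots.toFinset : Set ℚ).Finite := Finset.finite_toSet _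
  refine (hfin.preimage (f := (Int.cast : ℤ → ℚ)) Int.cast_injective.injOn).subset ?_
  intro k hk
  simp only [Set.mem_preimage, Finset.mem_coe, Multiset.mem_toFinset]
  rw [Polynomial.mem_roots hp0, Polynomial.IsRoot, hp]
  simpa using hk

theorem linkingMatrix_map_det_ne_zero (h : Γ.linkingMatrix.det ≠ 0) :
    (Γ.linkingMatrix.map (Int.cast : ℤ → ℚ)).det ≠ 0 := by
  have h1 : (Γ.linkingMatrix.map (Int.cast : ℤ → ℚ)).det = ((Γ.linkingMatrix.det : ℤ) : ℚ) :=
    (Int.cast_det (R := ℚ) Γ.linkingMatrix).symm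
  rw [h1]
  exact_mod_cast h

theorem linkingMatrix_map_isSymm {R : Type*} [CommRing R] :
    (Γ.linkingMatrix.map (Int.cast : ℤ → R)).IsSymm := by
  rw [Matrix.IsSymm, ← Matrix.transpose_map, linkingMatrix_isSymm]

/-- Up to an overall factor, the exponent is a quadratic polynomial in `k` with leading coefficient
`u_w` and linear coefficient `2 ∑ e_x u_x`, where `u` is the column of the inverse matrix at `w`.
These cannot both vanish. -/
theorem finite_setOf_qExponent_eq (hdet : Γ.linkingMatrix.det ≠ 0) {w : V} (hwh : Γ.IsHigh w)
    (hw : ∀ v, Γ.IsHigh v → v = w) {e : V → ℤ} (he : ∀ v, e v ≠ 0 ↔ Γ.deg v = 1) (n : ℚ) :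
    {k : ℤ | Γ.qExponent (-(e + Pi.single w k)) = n}.Finite := by
  set A := Γ.linkingMatrix.map (Int.cast : ℤ → ℚ) with hA
  have hdet' : A.det ≠ 0 := linkingMatrix_map_det_ne_zero hdet
  have hunit : IsUnit A.det := isUnit_iff_ne_zero.2 hdet'
  set u := A⁻¹.mulVec (Pi.single w 1) with hu
  have hAu : A.mulVec u = Pi.single w 1 := by
    rw [hu, Matrix.mulVec_mulVec, Matrix.mul_nonsing_inv A hunit, Matrix.one_mulVec]
  have hinj : Function.Injective A.mulVec := Matrix.mulVec_injective_of_isUnit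
    ((Matrix.isUnit_iff_isUnit_det A).2 hunit)
  have hsymm : A⁻¹.IsSymm := by
    rw [Matrix.IsSymm, Matrix.transpose_nonsing_inv, linkingMatrix_map_isSymm]
  set E : V → ℚ := fun v => (e v : ℚ) with hE
  have hcross : ∀ x y : V → ℚ, x ⬝ᵥ A⁻¹.mulVec y = y ⬝ᵥ A⁻¹.mulVec x := by
    intro x y
    rw [Matrix.dotProduct_mulVec, dotProduct_comm, ← Matrix.mulVec_transpose, hsymm]
  have key : ∀ k : ℤ, Γ.qExponent (-(e + Pi.single w k)) = n ↔
      u w * (k : ℚ) ^ 2 + (2 * (E ⬝ᵥ u)) * k + (E ⬝ᵥ A⁻¹.mulVec E + 4 * n -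
        (3 * (matrixSignature Γ.linkingMatrix : ℚ) - ((∑ v, Γ.weight v : ℤ) : ℚ))) = 0 := by
    intro k
    have h1 : (fun v => ((-(e + Pi.single w k) : V → ℤ) v : ℚ)) =
        -(E + (k : ℚ) • Pi.single w (1 : ℚ)) := by
      funext v
      by_cases hv : v = w
      · subst hv; simp [hE]
      · simp [hE, hv]
    have h2 : (E + (k : ℚ) • Pi.single w (1 : ℚ)) ⬝ᵥ A⁻¹.mulVec (E + (k : ℚ) • Pi.single w (1 : ℚ)) =
        E ⬝ᵥ A⁻¹.mulVec E + 2 * (E ⬝ᵥ u) * k + u w * (k : ℚ) ^ 2 := by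
      rw [Matrix.mulVec_add, Matrix.mulVec_smul, ← hu, add_dotProduct, dotProduct_add,
        dotProduct_add, smul_dotProduct, smul_dotProduct, dotProduct_smul, dotProduct_smul,
        hcross (Pi.single w 1) E, ← hu, single_one_dotProduct]
      simp only [smul_eq_mul]
      ring
    rw [qExponent, h1, Matrix.mulVec_neg, neg_dotProduct_neg, h2]
    constructor
    · intro h
      linear_combination (-4) * h
    · intro h
      linear_combination (-1 / 4) * h
  simp only [key]
  apply finite_setOf_quadratic_eq
  -- If `u_w = 0`, exactly one leaf has a nonzero entry of `u`. So nothing can cancel in the sum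
  -- over leaves, where all `e_x` are nonzero.
  by_cases huw : u w = 0
  · right
    obtain ⟨x, hx, hux, hx'⟩ := exists_unique_leaf_of_apply_eq_zero hw hAu hinj huw
    have h1 : E ⬝ᵥ u = E x * u x := by
      rw [dotProduct, Finset.sum_eq_single x]
      · intro v _ hv
        by_cases h1 : Γ.deg v = 1
        · by_cases h2 : v = w
          · rw [h2, huw, mul_zero]
          · rw [hx' v h1 hv h2, mul_zero]
        · have h2 : e v = 0 := by
            by_contra h3
            exact h1 ((he v).1 h3)
          simp [hE, h2]
      · simp
    rw [h1]
    have h2 : E x ≠ 0 := by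
      have := (he x).2 hx
      simpa [hE] using this
    positivity
  · exact Or.inl huw

theorem exists_hasValue_tMonomial_mul_highFactor (hdet : Γ.linkingMatrix.det ≠ 0) {w : V}
    (hwh : Γ.IsHigh w) (hw : ∀ v, Γ.IsHigh v → v = w) {e : V → ℤ} (he : ∀ v, e v ≠ 0 ↔ Γ.deg v = 1)
    (p : ℕ) (ξ : ℤˣ) : ∃ c, Γ.HasValue a n (tMonomial 0 e * highFactor w p ξ) c := by
  have hfin := finite_setOf_qExponent_eq hdet hwh hw he n
  have hfin' : {k : ℤ | Γ.qExponent (-(e + Pi.single w ((ξ : ℤ) * k))) = n}.Finite := by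
    apply hfin.preimage (f := fun k : ℤ => (ξ : ℤ) * k)
    intro k _ l _ h
    exact mul_left_cancel₀ ξ.ne_zero h
  refine ⟨_, hasSum_sum_of_ne_finset_zero (s := hfin'.toFinset) ?_⟩
  intro k hk
  rw [Set.Finite.mem_toFinset] at hk
  unfold ctTheta
  rw [tMonomial, HahnSeries.coeff_single_mul, highFactor_coeff, AddMonoidAlgebra.single_mul_single,
    AddMonoidAlgebra.coeff_single, Finsupp.sum_single_index (by simp), if_neg]
  intro h
  rw [sub_zero] at h
  exact hk h.2

theorem exists_hasValue_tMonomial (e : V → ℤ) : ∃ c, Γ.HasValue a n (tMonomial 0 e) c := by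
  refine ⟨_, hasSum_sum_of_ne_finset_zero (s := {0}) ?_⟩
  intro k hk
  unfold ctTheta
  rw [tMonomial, HahnSeries.coeff_single_of_ne (by simpa using hk)]
  simp

/-- The order of quantifiers is the point: the value depends on `ξ` but not on the leaf exponents
`s`, which is what a move may change. -/
theorem exists_hasValue_vertexFactor (hdet : Γ.linkingMatrix.det ≠ 0) (h0 : ∀ v, Γ.deg v ≠ 0)
    (h1 : Γ.highCount ≤ 1) (a : V → ℤ) (n : ℚ) (ξ : Γ.High → ℤˣ) :
    ∃ c, ∀ s : V → ℤ, Γ.HasValue a n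
      (∏ v, vertexFactor v (Γ.deg v) (s v) (Γ.extendSign ξ v)) c := by
  classical
  set H : TSeries V := ∏ v, if Γ.IsHigh v then highFactor v (Γ.deg v - 2) (Γ.extendSign ξ v) else 1
    with hH
  have hsplit : ∀ s : V → ℤ, ∏ v, vertexFactor v (Γ.deg v) (s v) (Γ.extendSign ξ v) =
      (∏ v ∈ Finset.univ.filter (fun v => Γ.deg v = 1), leafFactor v (s v)) * H := by
    intro s
    rw [Finset.prod_filter, hH, ← Finset.prod_mul_distrib]
    refine Finset.prod_congr rfl fun v _ => ?_
    have := h0 v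
    unfold vertexFactor IsHigh
    split_ifs <;> first | omega | simp
  simp only [hsplit]
  apply exists_hasValue_prod_leafFactor
  -- Expanding the leaf factors leaves monomials whose exponent is a sign at each leaf and zero
  -- elsewhere, as the finiteness argument requires.
  intro η
  set e : V → ℤ := ∑ x ∈ Finset.univ.filter (fun v => Γ.deg v = 1), Pi.single x (η x : ℤ) with he
  have hev : ∀ v, e v = if Γ.deg v = 1 then (η v : ℤ) else 0 := by
    intro v
    rw [he, Finset.sum_apply]
    simp [Pi.single_apply, Finset.sum_ite_eq]
  have hev' : ∀ v, e v ≠ 0 ↔ Γ.deg v = 1 := by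
    intro v
    rw [hev]
    split_ifs with h <;> simp [h]
  by_cases hhigh : ∃ w, Γ.IsHigh w
  · obtain ⟨w, hw⟩ := hhigh
    have huniq : ∀ v, Γ.IsHigh v → v = w := by
      intro v hv
      rw [highCount, Fintype.card_le_one_iff] at h1
      exact congrArg Subtype.val (h1 ⟨v, hv⟩ ⟨w, hw⟩)
    have hHw : H = highFactor w (Γ.deg w - 2) (Γ.extendSign ξ w) := by
      rw [hH, Finset.prod_eq_single w, if_pos hw]
      · intro v _ hv
        exact if_neg fun h => hv (huniq v h)
      · simp
    rw [hHw]
    exact exists_hasValue_tMonomial_mul_highFactor hdet hw huniq hev' _ _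
  · push Not at hhigh
    have hH1 : H = 1 := Finset.prod_eq_one fun v _ => if_neg (hhigh v)
    rw [hH1, mul_one]
    exact exists_hasValue_tMonomial e

end Values

/-! ### Recovering the series from finite coefficients -/

section Recovered

variable {V : Type u} [Fintype V] [DecidableEq V] {Γ : Plumbing V}

/-- The coefficient of each `q^n` is a Laurent polynomial in `t`, hence continuous at `t = 1`. -/
theorem isRecovered_iff_of_finite {a : V → ℤ} {r : ℚ → ℚ}
    (h : ∀ n, (Function.support fun k => Γ.zHatCoeff a n k).Finite ∧
      ∑ᶠ k, Γ.zHatCoeff a n k = r n) (c : ℚ → ℝ) :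
    Γ.IsRecovered a c ↔ ∀ n, c n = r n := by
  have hsum : ∀ n, (∀ t : ℝ, Summable fun k : ℤ => (Γ.zHatCoeff a n k : ℝ) * t ^ k) ∧
      Tendsto (fun t : ℝ => ∑' k : ℤ, (Γ.zHatCoeff a n k : ℝ) * t ^ k) (𝓝[<] 1) (𝓝 (r n : ℝ)) := by
    intro n
    obtain ⟨hf, hr⟩ := h n
    have hz : ∀ t : ℝ, ∀ k ∉ hf.toFinset, (Γ.zHatCoeff a n k : ℝ) * t ^ k = 0 := by
      intro t k hk
      have : Γ.zHatCoeff a n k = 0 := by simpa using hk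
      rw [this, Rat.cast_zero, zero_mul]
    refine ⟨fun t => summable_of_ne_finset_zero (hz t), ?_⟩
    have h1 : ∀ t : ℝ, ∑' k : ℤ, (Γ.zHatCoeff a n k : ℝ) * t ^ k =
        ∑ k ∈ hf.toFinset, (Γ.zHatCoeff a n k : ℝ) * t ^ k := fun t => tsum_eq_sum (hz t)
    simp only [h1]
    have h2 : (r n : ℝ) = ∑ k ∈ hf.toFinset, (Γ.zHatCoeff a n k : ℝ) * (1 : ℝ) ^ k := by
      rw [← hr, finsum_eq_sum _ hf]
      simp
    rw [h2]
    apply tendsto_finsetSum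
    intro k _
    apply Tendsto.const_mul
    have h3 : ContinuousAt (fun t : ℝ => t ^ k) 1 := continuousAt_zpow₀ 1 k (Or.inl one_ne_zero)
    exact h3.tendsto.mono_left nhdsWithin_le_nhds
  constructor
  · intro hc n
    exact tendsto_nhds_unique (hc n).2 (hsum n).2
  · intro hc n
    refine ⟨fun t _ => (hsum n).1 t, ?_⟩
    rw [hc n]
    exact (hsum n).2

theorem isRecovered_congr {V' : Type u} [Fintype V'] [DecidableEq V'] {Γ' : Plumbing V'}
    {a : V → ℤ} {a' : V' → ℤ} (h : ∀ n k, Γ'.zHatCoeff a' n k = Γ.zHatCoeff a n k) (c : ℚ → ℝ) :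
    Γ.IsRecovered a c ↔ Γ'.IsRecovered a' c := by
  unfold IsRecovered
  simp only [h]

end Recovered

end Plumbing

/-! ### Averages over the chambers -/

namespace Plumbing

section Average

variable {V : Type u} [Fintype V] [DecidableEq V] {Γ : Plumbing V}

theorem Arc.chainPos_reverse {w v : V} {i : List V} (h : Γ.Arc w i v) :
    chainPos (i.reverse.map Γ.weight) = chainPos (i.map Γ.weight) := by
  have hi : Γ.IsPathList i := (h.1.of_cons).of_append_left
  have h1 := hi.hasPosIndex_vertexSpan
  have h2 := hi.reverse.hasPosIndex_vertexSpan
  have h3 : (vertexSpan i.reverse : Submodule ℝ (V → ℝ)) = vertexSpan i :=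
    le_antisymm (vertexSpan_mono fun x hx => List.mem_reverse.1 hx)
      (vertexSpan_mono fun x hx => List.mem_reverse.2 hx)
  rw [h3] at h2
  exact h2.unique h1

/-- With at most two high vertices there is at most one bridge, and a single sign condition can be
met. This keeps the denominator of the average nonzero. -/
theorem chambers_nonempty (h : Γ.highCount ≤ 2) : Γ.chambers.Nonempty := by
  classical
  by_cases hex : ∃ w₁ w₂ : Γ.High, w₁ ≠ w₂
  · obtain ⟨w₁, w₂, hne⟩ := hex
    obtain ⟨i, hi⟩ := exists_arc_of_highCount_le_two h w₁.2 w₂.2 (fun h => hne (Subtype.ext h))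
    have hall : ∀ w : Γ.High, w = w₁ ∨ w = w₂ := by
      intro w
      by_contra hw
      push Not at hw
      have h3 : ({w, w₁, w₂} : Finset Γ.High).card = 3 := Finset.card_eq_three.2
        ⟨w, w₁, w₂, hw.1, hw.2, hne, rfl⟩
      have h4 : ({w, w₁, w₂} : Finset Γ.High).card ≤ Fintype.card Γ.High := Finset.card_le_univ _
      rw [highCount] at h
      omega
    set s : ℤˣ := (-1) ^ (chainPos (i.map Γ.weight) + 1) with hs
    refine ⟨fun w => if w = w₁ then 1 else s, mem_chambers.2 ?_⟩
    intro x y j hj _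
    rcases hall x with rfl | rfl <;> rcases hall y with rfl | rfl
    · exact absurd rfl hj.ne
    · rw [hj.ext hi, if_pos rfl, if_neg hne.symm, one_mul]
    · have h5 : j = i.reverse := hj.ext hi.reverse
      rw [h5, hi.chainPos_reverse, if_pos rfl, if_neg hne.symm, mul_one]
    · exact absurd rfl hj.ne
  · push Not at hex
    exact ⟨1, mem_chambers.2 fun w₁ w₂ i hi _ => absurd (congrArg Subtype.val (hex w₁ w₂)) hi.ne⟩

theorem neg_mem_chambers {ξ : Γ.High → ℤˣ} (h : ξ ∈ Γ.chambers) : -ξ ∈ Γ.chambers := by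
  rw [mem_chambers] at h ⊢
  intro w₁ w₂ i hi hz
  rw [Pi.neg_apply, Pi.neg_apply, neg_mul_neg]
  exact h w₁ w₂ i hi hz

/-- On at most one vertex a sign vector is determined up to a global sign. -/
theorem apply_add_apply_neg_eq (h : Γ.highCount ≤ 1) (F : (Γ.High → ℤˣ) → ℤ)
    (ξ η : Γ.High → ℤˣ) : F ξ + F (-ξ) = F η + F (-η) := by
  classical
  have hs : ∀ x y : Γ.High, x = y := by
    intro x y
    rw [highCount, Fintype.card_le_one_iff] at h
    exact h x y
  have h1 : ξ = η ∨ ξ = -η := by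
    by_cases he : ∃ w : Γ.High, ξ w ≠ η w
    · obtain ⟨w, hw⟩ := he
      right
      funext x
      rw [hs x w, Pi.neg_apply]
      exact (Int.units_ne_iff_eq_neg).1 hw
    · push Not at he
      exact Or.inl (funext he)
  rcases h1 with rfl | rfl
  · rfl
  · rw [neg_neg, add_comm]

theorem two_mul_sum_eq {ι : Type*} [InvolutiveNeg ι] (C : Finset ι) (hC : ∀ x ∈ C, -x ∈ C)
    (F : ι → ℤ) (S : ℤ) (h : ∀ x, F x + F (-x) = S) : 2 * ∑ x ∈ C, F x = C.card * S := by
  have h1 : ∑ x ∈ C, F (-x) = ∑ x ∈ C, F x :=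
    Finset.sum_nbij' (fun x => -x) (fun x => -x) hC hC (by simp) (by simp) (by simp)
  calc 2 * ∑ x ∈ C, F x = ∑ x ∈ C, F x + ∑ x ∈ C, F (-x) := by rw [h1]; ring
    _ = ∑ x ∈ C, S := by rw [← Finset.sum_add_distrib]; exact Finset.sum_congr rfl fun x _ => h x
    _ = C.card * S := by rw [Finset.sum_const, nsmul_eq_mul]

theorem finite_support_average {ι : Type*} (C : Finset ι) (F : ι → ℤ → ℤ) (val : ι → ℤ)
    (hF : ∀ x ∈ C, HasSum (F x) (val x)) (q d : ℚ) :
    (Function.support fun k => q * (((∑ x ∈ C, F x k : ℤ) : ℚ) / d)).Finite ∧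
      ∑ᶠ k, q * (((∑ x ∈ C, F x k : ℤ) : ℚ) / d) = q * (((∑ x ∈ C, val x : ℤ) : ℚ) / d) := by
  have h1 : HasSum (fun k => ∑ x ∈ C, F x k) (∑ x ∈ C, val x) := hasSum_sum hF
  have hfin : (Function.support fun k => ∑ x ∈ C, F x k).Finite :=
    h1.summable.hasFiniteSupport_of_discreteTopology
  have hsub : (Function.support fun k => q * (((∑ x ∈ C, F x k : ℤ) : ℚ) / d)) ⊆ hfin.toFinset := by
    intro k hk
    rw [Set.Finite.coe_toFinset]
    intro h0
    apply hk
    simp only at h0 ⊢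
    rw [h0]
    simp
  refine ⟨hfin.subset (by simpa using hsub), ?_⟩
  rw [finsum_eq_sum_of_support_subset _ hsub, ← Finset.mul_sum, ← Finset.sum_div, ← Int.cast_sum]
  congr 3
  have h2 : HasSum (fun k => ∑ x ∈ C, F x k) (∑ k ∈ hfin.toFinset, ∑ x ∈ C, F x k) :=
    hasSum_sum_of_ne_finset_zero (fun k hk => by simpa using hk)
  exact h2.unique h1

/-- Pairing `ξ` with `-ξ`, every chamber set gives the mean of the values at `1` and `-1`, whatever
its size. So the recovered series depends only on `val` and the prefactor `q`, not on the chambers.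
-/
theorem isRecovered_iff_of_hasValue {V' : Type u} [Fintype V'] [DecidableEq V']
    {Γ' : Plumbing V'} {a : V → ℤ} {a' : V' → ℤ} (h1 : Γ.highCount ≤ 1) (h2 : Γ'.highCount ≤ 2)
    (val : ℚ → (Γ.High → ℤˣ) → ℤ) (D : (Γ'.High → ℤˣ) → TSeries V)
    (g : (Γ'.High → ℤˣ) → (Γ.High → ℤˣ)) (hg : ∀ ξ, g (-ξ) = -g ξ)
    (hval : ∀ n, ∀ ξ ∈ Γ'.chambers, Γ.HasValue a n (D ξ) (val n (g ξ))) (q : ℚ)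
    (hz : ∀ n k, Γ'.zHatCoeff a' n k = q *
        (((∑ ξ ∈ Γ'.chambers, Γ.ctTheta a (D ξ) n k : ℤ) : ℚ) / (Γ'.chambers.card : ℚ)))
    (c : ℚ → ℝ) : Γ'.IsRecovered a' c ↔
      ∀ n, c n = ((q * (((val n 1 + val n (-1) : ℤ) : ℚ) / 2) : ℚ) : ℝ) := by
  refine isRecovered_iff_of_finite (fun n => ?_) c
  simp only [hz]
  have h3 := finite_support_average Γ'.chambers (fun ξ k => Γ.ctTheta a (D ξ) n k)
    (fun ξ => val n (g ξ)) (hval n) q (Γ'.chambers.card : ℚ)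
  refine ⟨h3.1, h3.2.trans ?_⟩
  have h4 := two_mul_sum_eq Γ'.chambers (fun ξ hξ => neg_mem_chambers hξ)
    (fun ξ => val n (g ξ)) (val n 1 + val n (-1)) (fun ξ => by
      rw [hg]
      exact apply_add_apply_neg_eq h1 (val n) (g ξ) 1)
  have h5 : (Γ'.chambers.card : ℚ) ≠ 0 := by
    exact_mod_cast (Finset.card_pos.2 (chambers_nonempty h2)).ne'
  have h6 : (2 : ℚ) * ((∑ ξ ∈ Γ'.chambers, val n (g ξ) : ℤ) : ℚ) =
      Γ'.chambers.card * ((val n 1 + val n (-1) : ℤ) : ℚ) := by exact_mod_cast h4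
  congr 1
  rw [div_eq_div_iff h5 two_ne_zero]
  linarith

theorem deg_ne_zero_of_adj {x y : V} (h : Γ.graph.Adj x y) (v : V) : Γ.deg v ≠ 0 := by
  by_cases hv : v = x
  · subst hv
    exact (deg_pos h).ne'
  · obtain ⟨i, hi⟩ := exists_isPathList (Γ := Γ) hv
    cases i with
    | nil => exact (deg_pos hi.adj_head).ne'
    | cons b t => exact (deg_pos hi.adj_head).ne'

variable {V' : Type u} [Fintype V'] [DecidableEq V'] {Γ' : Plumbing V'}

/-- Both plumbings yield the same mean of values of `Γ`, since the two discriminants differ only in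
leaf exponents and in the set over which the signs are averaged. -/
theorem ThetaReduction.isRecovered_iff_of_extendSign {a : V → ℤ} {a' : V' → ℤ} {κ : V' → V}
    {τ : V' → ℤˣ} (h : ThetaReduction Γ Γ' a a' κ τ) (hdet : Γ.linkingMatrix.det ≠ 0)
    (h0 : ∀ v, Γ.deg v ≠ 0) (h1 : Γ.highCount ≤ 1) (h2 : Γ'.highCount ≤ 2)
    (g : (Γ'.High → ℤˣ) → (Γ.High → ℤˣ)) (hg : ∀ ξ, g (-ξ) = -g ξ)
    (hD : ∀ ξ ∈ Γ'.chambers, ∃ s : V → ℤ, Γ'.substDiscriminant κ τ ξ =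
      ∏ v, vertexFactor v (Γ.deg v) (s v) (Γ.extendSign (g ξ) v)) (c : ℚ → ℝ) :
    Γ.IsRecovered a c ↔ Γ'.IsRecovered a' c := by
  choose val hval using exists_hasValue_vertexFactor hdet h0 h1 a
  have e1 : ∀ n, ∀ ξ ∈ Γ.chambers, Γ.HasValue a n (Γ.fullDiscriminant ξ) (val n (id ξ)) := by
    intro n ξ _
    unfold fullDiscriminant
    exact hval n ξ (Γ.leafExp ξ)
  have e2 : ∀ n, ∀ ξ ∈ Γ'.chambers,
      Γ.HasValue a n (Γ'.substDiscriminant κ τ ξ) (val n (g ξ)) := by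
    intro n ξ hξ
    obtain ⟨s, hs⟩ := hD ξ hξ
    rw [hs]
    exact hval n (g ξ) s
  have h3 := isRecovered_iff_of_hasValue h1 (le_trans h1 one_le_two) val Γ.fullDiscriminant id
    (fun _ => rfl) e1 _ (Plumbing.zHatCoeff_eq a) c
  have h4 := isRecovered_iff_of_hasValue h1 h2 val (Γ'.substDiscriminant κ τ) g hg e2 _
    h.zHatCoeff_eq c
  exact h3.trans h4.symm

end Average
end Plumbing

/-! ### Block reduction of linking matrices -/

open Matrix in
/-- `M'` is, in block form with respect to `φ`, the matrix whose lower right block is the unimodular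
matrix `Q` with inverse `Q'`, and whose Schur complement is `M`, up to the signs `τ`. -/
structure BlockReduction {V V' k : Type*} [Fintype V] [DecidableEq V] [Fintype k] [DecidableEq k]
    (M : Matrix V V ℤ) (M' : Matrix V' V' ℤ) (φ : V ⊕ k ≃ V') (τ : V → ℤˣ) (G : Matrix V k ℤ)
    (Q Q' : Matrix k k ℤ) : Prop where
  symm : Q.IsSymm
  mul_inv : Q * Q' = 1
  apply_inl_inl : ∀ x y, M' (φ (Sum.inl x)) (φ (Sum.inl y)) =
    τ x * τ y * M x y + (G * Q' * Gᵀ) x y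
  apply_inl_inr : ∀ x j, M' (φ (Sum.inl x)) (φ (Sum.inr j)) = G x j
  apply_inr_inl : ∀ x j, M' (φ (Sum.inr j)) (φ (Sum.inl x)) = G x j
  apply_inr_inr : ∀ i j, M' (φ (Sum.inr i)) (φ (Sum.inr j)) = Q i j

namespace BlockReduction

section Solve

open Matrix

variable {V V' k R : Type*} [Fintype V] [DecidableEq V] [Fintype k] [DecidableEq k]
  [Fintype V'] [DecidableEq V'] [CommRing R]
  {M : Matrix V V ℤ} {M' : Matrix V' V' ℤ} {φ : V ⊕ k ≃ V'} {τ : V → ℤˣ} {G : Matrix V k ℤ}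
  {Q Q' : Matrix k k ℤ}

local notation "cR" => (Int.cast : ℤ → R)

/-- The exponents for the reduced matrix. -/
def reduce (φ : V ⊕ k ≃ V') (τ : V → ℤˣ) (G : Matrix V k ℤ) (Q' : Matrix k k ℤ) (d : V' → R)
    (x : V) : R :=
  ((τ x : ℤ) : R) * (d (φ (Sum.inl x)) - ((G * Q').map cR *ᵥ fun j => d (φ (Sum.inr j))) x)

theorem map_intCast_mul {l m n : Type*} [Fintype m] (A : Matrix l m ℤ) (B : Matrix m n ℤ) :
    (A * B).map cR = A.map cR * B.map cR :=
  Matrix.map_mul (f := Int.castRingHom R)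

theorem units_cast_mul_self (ε : ℤˣ) : ((ε : ℤ) : R) * ((ε : ℤ) : R) = 1 := by
  rcases Int.units_eq_one_or ε with rfl | rfl <;> simp

/-- This is block elimination: `G Q'` times the lower rows is subtracted from the upper rows, which
cancels the `Q`-variables and leaves the Schur complement. -/
theorem mulVec_eq (h : BlockReduction M M' φ τ G Q Q') (x' : V' → R) :
    (∀ x, (M'.map cR *ᵥ x') (φ (Sum.inl x)) =
      ((τ x : ℤ) : R) * (M.map cR *ᵥ fun y => ((τ y : ℤ) : R) * x' (φ (Sum.inl y))) x +
      ((G * Q').map cR *ᵥ fun i => (M'.map cR *ᵥ x') (φ (Sum.inr i))) x) ∧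
    ∀ i, (M'.map cR *ᵥ x') (φ (Sum.inr i)) = ((G.map cR)ᵀ *ᵥ fun y => x' (φ (Sum.inl y))) i +
      (Q.map cR *ᵥ fun j => x' (φ (Sum.inr j))) i := by
  have h2 : ∀ i, (M'.map cR *ᵥ x') (φ (Sum.inr i)) =
      ((G.map cR)ᵀ *ᵥ fun y => x' (φ (Sum.inl y))) i +
      (Q.map cR *ᵥ fun j => x' (φ (Sum.inr j))) i := by
    intro i
    simp only [mulVec, dotProduct]
    rw [← φ.sum_comp, Fintype.sum_sum_type]
    simp [h.apply_inr_inl, h.apply_inr_inr]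
  refine ⟨fun x => ?_, h2⟩
  have h3 : (fun i => (M'.map cR *ᵥ x') (φ (Sum.inr i))) =
      (G.map cR)ᵀ *ᵥ (fun y => x' (φ (Sum.inl y))) + Q.map cR *ᵥ fun j => x' (φ (Sum.inr j)) := by
    funext i
    exact h2 i
  have h4 : (G * Q') * Q = G := by
    rw [Matrix.mul_assoc, mul_eq_one_comm.1 h.mul_inv, Matrix.mul_one]
  have h5 : (G * Q').map cR * Q.map cR = G.map cR := by
    rw [← map_intCast_mul, h4]
  have h6 : (G * Q').map cR * (G.map cR)ᵀ = (G * Q' * Gᵀ).map cR := by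
    rw [← Matrix.transpose_map, ← map_intCast_mul]
  rw [h3, Matrix.mulVec_add, Matrix.mulVec_mulVec, Matrix.mulVec_mulVec, h5, h6]
  simp only [mulVec, dotProduct, Pi.add_apply]
  rw [← φ.sum_comp, Fintype.sum_sum_type, Finset.mul_sum, ← add_assoc, ← Finset.sum_add_distrib]
  congr 1
  · refine Finset.sum_congr rfl fun y _ => ?_
    simp only [Matrix.map_apply, h.apply_inl_inl]
    push_cast
    ring
  · simp [h.apply_inl_inr]

theorem reduce_mulVec (h : BlockReduction M M' φ τ G Q Q') (x' : V' → R) :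
    reduce φ τ G Q' (M'.map cR *ᵥ x') =
      M.map cR *ᵥ fun y => ((τ y : ℤ) : R) * x' (φ (Sum.inl y)) := by
  funext x
  rw [reduce, (h.mulVec_eq x').1 x, add_sub_cancel_right, ← mul_assoc, units_cast_mul_self, one_mul]

theorem apply_inr_eq (h : BlockReduction M M' φ τ G Q Q') (x' : V' → R) :
    (fun j => x' (φ (Sum.inr j))) = Q'.map cR *ᵥ ((fun i => (M'.map cR *ᵥ x') (φ (Sum.inr i))) -
      (G.map cR)ᵀ *ᵥ fun y => x' (φ (Sum.inl y))) := by
  have h3 : (fun i => (M'.map cR *ᵥ x') (φ (Sum.inr i))) =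
      (G.map cR)ᵀ *ᵥ (fun y => x' (φ (Sum.inl y))) + Q.map cR *ᵥ fun j => x' (φ (Sum.inr j)) := by
    funext i
    exact (h.mulVec_eq x').2 i
  rw [h3, add_sub_cancel_left, Matrix.mulVec_mulVec, ← map_intCast_mul,
    mul_eq_one_comm.1 h.mul_inv, Matrix.map_one _ Int.cast_zero Int.cast_one, Matrix.one_mulVec]

/-- Because `Q` has an integral inverse, a solution of the reduced system lifts to the full one by
back substitution over any ring; it is used over `ℤ` for the classes and the determinants. -/
theorem exists_mulVec_eq (h : BlockReduction M M' φ τ G Q Q') (d : V' → R) (X : V → R)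
    (hX : M.map cR *ᵥ X = reduce φ τ G Q' d) : ∃ x' : V' → R, M'.map cR *ᵥ x' = d ∧
      ∀ y, ((τ y : ℤ) : R) * x' (φ (Sum.inl y)) = X y := by
  set x₁ : V → R := fun y => ((τ y : ℤ) : R) * X y with hx₁
  set x₂ : k → R := Q'.map cR *ᵥ ((fun i => d (φ (Sum.inr i))) - (G.map cR)ᵀ *ᵥ x₁) with hx₂
  set x' : V' → R := fun v => Sum.elim x₁ x₂ (φ.symm v) with hx'
  have e1 : (fun y => x' (φ (Sum.inl y))) = x₁ := by funext y; simp [hx']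
  have e2 : (fun y => x' (φ (Sum.inr y))) = x₂ := by funext y; simp [hx']
  have e3 : (fun y => ((τ y : ℤ) : R) * x' (φ (Sum.inl y))) = X := by
    funext y
    simp only [hx', Equiv.symm_apply_apply, Sum.elim_inl, hx₁]
    rw [← mul_assoc, units_cast_mul_self, one_mul]
  obtain ⟨h1, h2⟩ := h.mulVec_eq x'
  have e4 : (fun i => (M'.map cR *ᵥ x') (φ (Sum.inr i))) = fun i => d (φ (Sum.inr i)) := by
    have : (fun i => (M'.map cR *ᵥ x') (φ (Sum.inr i))) = (G.map cR)ᵀ *ᵥ x₁ + Q.map cR *ᵥ x₂ := by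
      funext i
      rw [h2 i, e1, e2]
      rfl
    rw [this, hx₂, Matrix.mulVec_mulVec, ← map_intCast_mul, h.mul_inv,
      Matrix.map_one _ Int.cast_zero Int.cast_one, Matrix.one_mulVec, add_sub_cancel]
  refine ⟨x', ?_, fun y => congrFun e3 y⟩
  funext v
  obtain ⟨w, rfl⟩ := φ.surjective v
  rcases w with x | i
  · rw [h1 x, e3, e4, hX, reduce, ← mul_assoc, units_cast_mul_self, one_mul, sub_add_cancel]
  · exact congrFun e4 i

/-- Completing the square: with `d = M'x'`, the quadratic form in `d` is that of the reduced
exponent plus the `Q'`-form of the new coordinates. -/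
theorem dotProduct_mulVec_eq (h : BlockReduction M M' φ τ G Q Q') (x' : V' → R) :
    (M'.map cR *ᵥ x') ⬝ᵥ x' = (reduce φ τ G Q' (M'.map cR *ᵥ x')) ⬝ᵥ
        (fun y => ((τ y : ℤ) : R) * x' (φ (Sum.inl y))) +
      (fun i => (M'.map cR *ᵥ x') (φ (Sum.inr i))) ⬝ᵥ
        (Q'.map cR *ᵥ fun i => (M'.map cR *ᵥ x') (φ (Sum.inr i))) := by
  set d := M'.map cR *ᵥ x' with hd
  have h1 : d ⬝ᵥ x' = (fun x => d (φ (Sum.inl x))) ⬝ᵥ (fun x => x' (φ (Sum.inl x))) +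
      (fun x => d (φ (Sum.inr x))) ⬝ᵥ (fun x => x' (φ (Sum.inr x))) := by
    simp only [dotProduct]
    rw [← φ.sum_comp, Fintype.sum_sum_type]
  have hsymm : Q'.IsSymm := by
    have h2 : Q'ᵀ * Q = 1 := by
      rw [← h.symm, ← Matrix.transpose_mul, h.mul_inv, Matrix.transpose_one]
    exact left_inv_eq_right_inv h2 h.mul_inv
  rw [h1, h.apply_inr_eq x', ← hd, Matrix.mulVec_sub, dotProduct_sub]
  have h3 : reduce φ τ G Q' d ⬝ᵥ (fun y => ((τ y : ℤ) : R) * x' (φ (Sum.inl y))) =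
      (fun x => d (φ (Sum.inl x))) ⬝ᵥ (fun x => x' (φ (Sum.inl x))) -
      ((G * Q').map cR *ᵥ fun j => d (φ (Sum.inr j))) ⬝ᵥ (fun x => x' (φ (Sum.inl x))) := by
    rw [← sub_dotProduct]
    simp only [dotProduct, reduce, Pi.sub_apply]
    refine Finset.sum_congr rfl fun y _ => ?_
    linear_combination (d (φ (Sum.inl y)) -
      ((G * Q').map cR *ᵥ fun j => d (φ (Sum.inr j))) y) * x' (φ (Sum.inl y)) *
      units_cast_mul_self (R := R) (τ y)
  have h4 : (fun x => d (φ (Sum.inr x))) ⬝ᵥ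
      (Q'.map cR *ᵥ (G.map cR)ᵀ *ᵥ fun y => x' (φ (Sum.inl y))) =
      ((G * Q').map cR *ᵥ fun j => d (φ (Sum.inr j))) ⬝ᵥ (fun x => x' (φ (Sum.inl x))) := by
    rw [Matrix.mulVec_mulVec, Matrix.dotProduct_mulVec, ← Matrix.mulVec_transpose,
      Matrix.transpose_mul, Matrix.transpose_transpose, ← Matrix.transpose_map, hsymm,
      map_intCast_mul]
  rw [h3, h4]
  ring

end Solve

/-! ### Determinant and inertia under block reduction -/

section Det

open Matrix

variable {V V' k : Type*} [Fintype V] [DecidableEq V] [Fintype k] [DecidableEq k]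
  [Fintype V'] [DecidableEq V']
  {M : Matrix V V ℤ} {M' : Matrix V' V' ℤ} {φ : V ⊕ k ≃ V'} {τ : V → ℤˣ} {G : Matrix V k ℤ}
  {Q Q' : Matrix k k ℤ}

theorem reduce_zero {R : Type*} [CommRing R] : reduce φ τ G Q' (0 : V' → R) = 0 := by
  funext x
  have : (fun j : k => (0 : V' → R) (φ (Sum.inr j))) = 0 := rfl
  rw [reduce, this, Matrix.mulVec_zero]
  simp

theorem map_intCast_self {n : Type*} (A : Matrix n n ℤ) : A.map (Int.cast : ℤ → ℤ) = A := by
  ext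
  simp

theorem det_eq_zero_iff (h : BlockReduction M M' φ τ G Q Q') : M'.det = 0 ↔ M.det = 0 := by
  rw [← Matrix.exists_mulVec_eq_zero_iff, ← Matrix.exists_mulVec_eq_zero_iff]
  constructor
  · rintro ⟨x', hx', h0⟩
    rw [← map_intCast_self M'] at h0
    refine ⟨fun y => ((τ y : ℤ) : ℤ) * x' (φ (Sum.inl y)), ?_, ?_⟩
    · intro h1
      apply hx'
      have h2 : (fun y => x' (φ (Sum.inl y))) = 0 := by
        funext y
        have := congrFun h1 y
        simpa using this
      have h3 := h.apply_inr_eq x'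
      rw [h2, h0] at h3
      funext v
      obtain ⟨w, rfl⟩ := φ.surjective v
      rcases w with x | i
      · exact congrFun h2 x
      · refine (congrFun h3 i).trans ?_
        have h4 : (fun i : k => (0 : V' → ℤ) (φ (Sum.inr i))) = 0 := rfl
        rw [h4, Matrix.mulVec_zero, sub_zero, Matrix.mulVec_zero]
        rfl
    · have h1 := h.reduce_mulVec x'
      rw [h0, reduce_zero, map_intCast_self M] at h1
      exact h1.symm
  · rintro ⟨X, hX, h0⟩
    obtain ⟨x', h1, h2⟩ := h.exists_mulVec_eq (0 : V' → ℤ) X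
      (by rw [map_intCast_self, h0, reduce_zero])
    rw [map_intCast_self] at h1
    refine ⟨x', ?_, h1⟩
    rintro rfl
    apply hX
    funext y
    rw [← h2 y]
    simp

/-- The map `S` embeds the space of `M` isometrically as the orthogonal complement of the `Q`-block,
embedded by `K`. The scalar `c` lets one proof serve both indices, with `c = 1` and `c = -1`. -/
theorem hasPosIndex_top (h : BlockReduction M M' φ τ G Q Q')
    (B : LinearMap.BilinForm ℝ (V → ℝ)) (B' : LinearMap.BilinForm ℝ (V' → ℝ))
    (C : LinearMap.BilinForm ℝ (k → ℝ)) (c : ℝ) (hB : B = c • realForm M)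
    (hB' : B' = c • realForm M') (hC : C = c • realForm Q) (hM' : M'.IsSymm) {p q : ℕ}
    (hp : HasPosIndex B ⊤ p) (hq : HasPosIndex C ⊤ q) : HasPosIndex B' ⊤ (p + q) := by
  set T : (V → ℝ) →ₗ[ℝ] (V → ℝ) :=
    LinearMap.pi fun x => ((τ x : ℤ) : ℝ) • LinearMap.proj x with hT
  have hTa : ∀ X x, T X x = ((τ x : ℤ) : ℝ) * X x := fun X x => by simp [hT]
  have hTT : ∀ X, T (T X) = X := by
    intro X
    funext x
    rw [hTa, hTa, ← mul_assoc, units_cast_mul_self, one_mul]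
  set L : (V → ℝ) →ₗ[ℝ] (k → ℝ) :=
    (Q'.map (Int.cast : ℤ → ℝ)).mulVecLin ∘ₗ (G.map (Int.cast : ℤ → ℝ))ᵀ.mulVecLin with hL
  set S : (V → ℝ) →ₗ[ℝ] (V' → ℝ) := LinearMap.pi fun v =>
    Sum.elim (fun x => LinearMap.proj x ∘ₗ T) (fun i => -(LinearMap.proj i ∘ₗ L ∘ₗ T)) (φ.symm v)
    with hS
  set K : (k → ℝ) →ₗ[ℝ] (V' → ℝ) := LinearMap.pi fun v =>
    Sum.elim (fun _ => 0) (fun i => LinearMap.proj i) (φ.symm v) with hK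
  have hSl : ∀ X, (fun x => S X (φ (Sum.inl x))) = T X := fun X => by funext x; simp [hS]
  have hSr : ∀ X, (fun x => S X (φ (Sum.inr x))) = -L (T X) := fun X => by funext x; simp [hS]
  have hKl : ∀ c, (fun x => K c (φ (Sum.inl x))) = 0 := fun X => by funext x; simp [hK]
  have hKr : ∀ c, (fun x => K c (φ (Sum.inr x))) = c := fun X => by funext x; simp [hK]
  have hQL : ∀ Y, Q.map (Int.cast : ℤ → ℝ) *ᵥ L Y = (G.map (Int.cast : ℤ → ℝ))ᵀ *ᵥ Y := by
    intro Y
    simp only [hL, LinearMap.comp_apply, Matrix.mulVecLin_apply]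
    rw [Matrix.mulVec_mulVec, ← map_intCast_mul, h.mul_inv,
      Matrix.map_one _ Int.cast_zero Int.cast_one, Matrix.one_mulVec]
  have hdot : ∀ x' y' : V' → ℝ, x' ⬝ᵥ y' =
      (fun x => x' (φ (Sum.inl x))) ⬝ᵥ (fun x => y' (φ (Sum.inl x))) +
      (fun x => x' (φ (Sum.inr x))) ⬝ᵥ (fun x => y' (φ (Sum.inr x))) := by
    intro x' y'
    simp only [dotProduct]
    rw [← φ.sum_comp, Fintype.sum_sum_type]
  have hMSr : ∀ X, (fun i => (M'.map (Int.cast : ℤ → ℝ) *ᵥ S X) (φ (Sum.inr i))) = 0 := by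
    intro X
    funext i
    rw [(h.mulVec_eq (S X)).2 i, hSl, hSr, Matrix.mulVec_neg, hQL]
    simp
  have hMSl : ∀ X, (fun i => (M'.map (Int.cast : ℤ → ℝ) *ᵥ S X) (φ (Sum.inl i))) =
      T (M.map (Int.cast : ℤ → ℝ) *ᵥ X) := by
    intro X
    funext i
    have : (fun y => ((τ y : ℤ) : ℝ) * S X (φ (Sum.inl y))) = X := by
      funext y
      rw [congrFun (hSl X) y, ← hTa, hTT]
    rw [(h.mulVec_eq (S X)).1 i, hMSr, this, Matrix.mulVec_zero, hTa, Pi.zero_apply, add_zero]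
  have hSS : ∀ X Y, B' (S X) (S Y) = B X Y := by
    intro X Y
    rw [hB', hB, LinearMap.smul_apply, LinearMap.smul_apply, LinearMap.smul_apply,
      LinearMap.smul_apply, realForm_apply, realForm_apply, hdot, hSl, hMSr, hMSl, dotProduct_zero,
      add_zero]
    congr 1
    simp only [dotProduct, hTa]
    refine Finset.sum_congr rfl fun y _ => ?_
    linear_combination X y * (M.map (Int.cast : ℤ → ℝ) *ᵥ Y) y * units_cast_mul_self (R := ℝ) (τ y)
  have hKS : ∀ c' Y, realForm M' (K c') (S Y) = 0 := by
    intro c' Y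
    rw [realForm_apply, hdot, hKl, hMSr, dotProduct_zero, zero_dotProduct, add_zero]
  have hKK : ∀ c₁ c₂, B' (K c₁) (K c₂) = C c₁ c₂ := by
    intro c₁ c₂
    rw [hB', hC, LinearMap.smul_apply, LinearMap.smul_apply, LinearMap.smul_apply,
      LinearMap.smul_apply, realForm_apply, realForm_apply, hdot, hKl, hKr, zero_dotProduct,
      zero_add]
    congr 2
    funext i
    rw [(h.mulVec_eq (K c₂)).2 i, hKl, hKr, Matrix.mulVec_zero, Pi.zero_apply, zero_add]
  have htop : (⊤ : Submodule ℝ (V → ℝ)).map S ⊔ (⊤ : Submodule ℝ (k → ℝ)).map K = ⊤ := by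
    rw [eq_top_iff]
    intro x' _
    set x₁ : V → ℝ := fun x => x' (φ (Sum.inl x)) with hx₁
    have : x' = S (T x₁) + K ((fun i => x' (φ (Sum.inr i))) + L x₁) := by
      funext v
      obtain ⟨w, rfl⟩ := φ.surjective v
      rw [Pi.add_apply]
      rcases w with x | i
      · rw [congrFun (hSl _) x, congrFun (hKl _) x, hTT]
        simp [hx₁]
      · rw [congrFun (hSr _) i, congrFun (hKr _) i, hTT]
        simp
    rw [this]
    exact Submodule.add_mem_sup (Submodule.mem_map_of_mem trivial)
      (Submodule.mem_map_of_mem trivial)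
  rw [← htop]
  have hsymm : ∀ x y, B' x y = B' y x := by
    intro x y
    rw [hB', LinearMap.smul_apply, LinearMap.smul_apply, LinearMap.smul_apply,
      LinearMap.smul_apply, realForm_symm hM']
  refine (hp.map S hSS).sup hsymm (hq.map K hKK) ?_
  rintro _ ⟨X, -, rfl⟩ _ ⟨c', -, rfl⟩
  rw [hsymm, hB', LinearMap.smul_apply, LinearMap.smul_apply, hKS, smul_zero]

theorem eigenCount_eq (h : BlockReduction M M' φ τ G Q Q') (hM : M.IsSymm) (hM' : M'.IsSymm) :
    posEigenCount M' = posEigenCount M + posEigenCount Q ∧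
      negEigenCount M' = negEigenCount M + negEigenCount Q := by
  obtain ⟨a1, a2⟩ := hasPosIndex_realForm hM
  obtain ⟨b1, b2⟩ := hasPosIndex_realForm hM'
  obtain ⟨c1, c2⟩ := hasPosIndex_realForm h.symm
  exact ⟨b1.unique (h.hasPosIndex_top _ _ _ 1 (one_smul _ _).symm (one_smul _ _).symm (one_smul _ _).symm hM' a1 c1),
    b2.unique (h.hasPosIndex_top _ _ _ (-1) (neg_one_smul ℝ (realForm M)).symm
      (neg_one_smul ℝ (realForm M')).symm (neg_one_smul ℝ (realForm Q)).symm hM' a2 c2)⟩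

end Det
-- Theta functions under block reduction
section Theta

open Matrix Plumbing

variable {V V' : Type u} {k : Type*} [Fintype V] [DecidableEq V] [Fintype k] [DecidableEq k]
  [Fintype V'] [DecidableEq V'] {Γ : Plumbing V} {Γ' : Plumbing V'} {φ : V ⊕ k ≃ V'}
  {τ : V → ℤˣ} {G : Matrix V k ℤ} {Q Q' : Matrix k k ℤ}

theorem _root_.Plumbing.SpincEquiv.symm {a b : V → ℤ} (h : Γ.SpincEquiv a b) :
    Γ.SpincEquiv b a := by
  obtain ⟨n, rfl⟩ := h
  refine ⟨-n, ?_⟩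
  rw [Matrix.mulVec_neg]
  simp

theorem _root_.Plumbing.SpincEquiv.trans {a b c : V → ℤ} (h : Γ.SpincEquiv a b)
    (h' : Γ.SpincEquiv b c) : Γ.SpincEquiv a c := by
  obtain ⟨n, rfl⟩ := h
  obtain ⟨m, rfl⟩ := h'
  refine ⟨n + m, ?_⟩
  rw [Matrix.mulVec_add, smul_add, add_assoc]

theorem _root_.Plumbing.SpincEquiv.two_dvd_sub {a b : V → ℤ} (h : Γ.SpincEquiv a b) (v : V) :
    (2 : ℤ) ∣ b v - a v := by
  obtain ⟨n, rfl⟩ := h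
  exact ⟨(Γ.linkingMatrix.mulVec n) v, by simp⟩

theorem reduce_add_two_smul (b d : V' → ℤ) : reduce φ τ G Q' (b + 2 • d) =
    reduce φ τ G Q' b + 2 • reduce φ τ G Q' d := by
  funext x
  have h1 : (fun j => (b + 2 • d) (φ (Sum.inr j))) =
      (fun j => b (φ (Sum.inr j))) + 2 • fun j => d (φ (Sum.inr j)) := rfl
  change _ * (b (φ (Sum.inl x)) + 2 • d (φ (Sum.inl x)) - _) = _ * (_ - _) + 2 • (_ * (_ - _))
  rw [h1, Matrix.mulVec_add, Matrix.mulVec_smul, Pi.add_apply, Pi.smul_apply]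
  simp only [nsmul_eq_mul]
  push_cast
  ring

theorem reduce_intCast (d : V' → ℤ) : reduce (R := ℚ) φ τ G Q' (fun v => (d v : ℚ)) =
    fun x => ((reduce φ τ G Q' d x : ℤ) : ℚ) := by
  funext x
  simp only [reduce, Matrix.mulVec, dotProduct, Matrix.map_apply]
  push_cast
  ring

/-- The parity hypothesis allows division of `e - b` by two. Then being in the image of `M'` is
equivalent, by elimination and back substitution over `ℤ`, to the reduced vector being in the image
of `M`. -/
theorem spincEquiv_iff (h : BlockReduction Γ.linkingMatrix Γ'.linkingMatrix φ τ G Q Q')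
    {b e : V' → ℤ} (hbe : ∀ v, (2 : ℤ) ∣ e v - b v) : Γ'.SpincEquiv b e ↔
      Γ.SpincEquiv (reduce φ τ G Q' b) (reduce φ τ G Q' e) := by
  choose d hd using hbe
  have he : e = b + 2 • d := by
    funext v
    have := hd v
    change e v = b v + 2 • d v
    rw [nsmul_eq_mul]
    push_cast
    linarith
  have hcancel : ∀ {ι : Type u} (x y z : ι → ℤ), x + 2 • y = x + 2 • z ↔ y = z := by
    intro ι x y z
    rw [add_right_inj]
    constructor
    · intro h1
      funext i
      have h2 : 2 • y i = 2 • z i := congrFun h1 i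
      rw [nsmul_eq_mul, nsmul_eq_mul] at h2
      push_cast at h2
      linarith
    · rintro rfl
      rfl
  rw [he, reduce_add_two_smul, SpincEquiv, SpincEquiv]
  simp only [hcancel]
  constructor
  · rintro ⟨n, rfl⟩
    have h1 := h.reduce_mulVec n
    rw [map_intCast_self, map_intCast_self] at h1
    exact ⟨_, h1⟩
  · rintro ⟨X, hX⟩
    obtain ⟨x', h1, -⟩ := h.exists_mulVec_eq d X (by rw [map_intCast_self, hX])
    rw [map_intCast_self] at h1
    exact ⟨x', h1.symm⟩

theorem dotProduct_inv_eq (h : BlockReduction Γ.linkingMatrix Γ'.linkingMatrix φ τ G Q Q')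
    (hdet : Γ.linkingMatrix.det ≠ 0) (d : V' → ℤ) :
    (fun v => (d v : ℚ)) ⬝ᵥ ((Γ'.linkingMatrix.map (Int.cast : ℤ → ℚ))⁻¹ *ᵥ fun v => (d v : ℚ)) =
      (fun v => ((reduce φ τ G Q' d v : ℤ) : ℚ)) ⬝ᵥ ((Γ.linkingMatrix.map (Int.cast : ℤ → ℚ))⁻¹ *ᵥ
        fun v => ((reduce φ τ G Q' d v : ℤ) : ℚ)) +
      (((fun i => d (φ (Sum.inr i))) ⬝ᵥ (Q' *ᵥ fun i => d (φ (Sum.inr i))) : ℤ) : ℚ) := by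
  have hdet' : Γ'.linkingMatrix.det ≠ 0 := fun h0 => hdet (h.det_eq_zero_iff.1 h0)
  have hu : IsUnit (Γ.linkingMatrix.map (Int.cast : ℤ → ℚ)).det :=
    isUnit_iff_ne_zero.2 (linkingMatrix_map_det_ne_zero hdet)
  have hu' : IsUnit (Γ'.linkingMatrix.map (Int.cast : ℤ → ℚ)).det :=
    isUnit_iff_ne_zero.2 (linkingMatrix_map_det_ne_zero hdet')
  set D : V' → ℚ := fun v => (d v : ℚ) with hD
  set x' := (Γ'.linkingMatrix.map (Int.cast : ℤ → ℚ))⁻¹ *ᵥ D with hx'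
  have h1 : Γ'.linkingMatrix.map (Int.cast : ℤ → ℚ) *ᵥ x' = D := by
    rw [hx', Matrix.mulVec_mulVec, Matrix.mul_nonsing_inv _ hu', Matrix.one_mulVec]
  have h2 := h.reduce_mulVec x'
  have h3 := h.dotProduct_mulVec_eq x'
  rw [h1] at h2 h3
  rw [hD, reduce_intCast] at h2
  have h4 : (Γ.linkingMatrix.map (Int.cast : ℤ → ℚ))⁻¹ *ᵥ
      (fun v => ((reduce φ τ G Q' d v : ℤ) : ℚ)) =
      fun y => ((τ y : ℤ) : ℚ) * x' (φ (Sum.inl y)) := by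
    rw [h2, Matrix.mulVec_mulVec, Matrix.nonsing_inv_mul _ hu, Matrix.one_mulVec]
  rw [h3, h4, hD, reduce_intCast]
  congr 1
  simp only [dotProduct, Matrix.mulVec, Matrix.map_apply]
  push_cast
  rfl

/-- The hypotheses isolate what depends on the move: `he` makes the reduction of exponents a
substitution of variables, `hr` matches the leftover `Q'`-term with the change of `3σ - ∑ m_v`, and
`hs` matches the signs. -/
theorem thetaReduction (h : BlockReduction Γ.linkingMatrix Γ'.linkingMatrix φ τ G Q Q')
    (hdet : Γ.linkingMatrix.det ≠ 0) {a : V → ℤ} {a' b : V' → ℤ} {κ : V' → V} {τ' : V' → ℤˣ}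
    (ha' : ∀ v, (2 : ℤ) ∣ a' v - Γ'.deg v)
    (hba' : Γ'.SpincEquiv b a') (hb : reduce φ τ G Q' b = a)
    (he : ∀ e, Γ'.Admissible e → expHom κ τ' e = reduce φ τ G Q' e)
    (hr : ∀ e, Γ'.Admissible e →
      (fun i => e (φ (Sum.inr i))) ⬝ᵥ (Q' *ᵥ fun i => e (φ (Sum.inr i))) =
        3 * matrixSignature Q - ((∑ v, Γ'.weight v) - ∑ v, Γ.weight v))
    (hs : (-1 : ℤˣ) ^ posEigenCount Q = ∏ v, τ' v ^ Γ'.deg v) :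
    ThetaReduction Γ Γ' a a' κ τ' := by
  obtain ⟨hpos, hneg⟩ := h.eigenCount_eq Γ.linkingMatrix_isSymm Γ'.linkingMatrix_isSymm
  -- Oddness of `reduce` follows from its behaviour under `b + 2d` applied to `-d + 2d = d`.
  have hneg' : ∀ d : V' → ℤ, reduce φ τ G Q' (-d) = -reduce φ τ G Q' d := by
    intro d
    have h1 := reduce_add_two_smul (φ := φ) (τ := τ) (G := G) (Q' := Q') (-d) d
    have h2 : -d + 2 • d = d := by rw [two_nsmul]; abel
    rw [h2] at h1
    rw [eq_neg_iff_add_eq_zero]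
    rw [two_nsmul, ← add_assoc, eq_comm, add_eq_right] at h1
    exact h1
  refine ⟨fun e hadm => ?_, fun e hadm => ?_, ?_⟩
  · have h1 : Γ'.SpincEquiv a' (-e) ↔ Γ'.SpincEquiv b (-e) :=
      ⟨fun h' => hba'.trans h', fun h' => hba'.symm.trans h'⟩
    rw [h1, h.spincEquiv_iff, hb, hneg', he e hadm]
    intro v
    have h2 := hba'.two_dvd_sub v
    have h3 := ha' v
    have h4 := (hadm v).1
    simp only [Pi.neg_apply]
    omega
  · unfold qExponent
    rw [he e hadm, ← hneg', h.dotProduct_inv_eq hdet]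
    have h1 : (fun i => (-e) (φ (Sum.inr i))) ⬝ᵥ (Q' *ᵥ fun i => (-e) (φ (Sum.inr i))) =
        3 * matrixSignature Q - ((∑ v, Γ'.weight v) - ∑ v, Γ.weight v) := by
      rw [← hr e hadm]
      have : (fun i => (-e) (φ (Sum.inr i))) = -fun i => e (φ (Sum.inr i)) := rfl
      rw [this, Matrix.mulVec_neg, neg_dotProduct_neg]
    rw [h1]
    have h2 : matrixSignature Γ'.linkingMatrix =
        matrixSignature Γ.linkingMatrix + matrixSignature Q := by
      unfold matrixSignature
      rw [hpos, hneg]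
      push_cast
      ring
    rw [h2]
    push_cast
    ring
  · rw [hpos, pow_add, hs, mul_comm]

end Theta
end BlockReduction

/-! ### Replacing an edge by a chain -/

namespace Plumbing

section Transfer

variable {V V' : Type u} [Fintype V] [DecidableEq V] [Fintype V'] [DecidableEq V']
  {Γ : Plumbing V} {Γ' : Plumbing V'}

theorem IsPathList.map {l : List V} (hl : Γ.IsPathList l) {ι : V → V'} (hι : Function.Injective ι)
    (h : ∀ l₁ l₂ x y, l = l₁ ++ x :: y :: l₂ → Γ'.graph.Adj (ι x) (ι y)) :
    Γ'.IsPathList (l.map ι) := by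
  refine ⟨?_, hl.2.map hι⟩
  rw [List.isChain_map, List.isChain_iff_forall_rel_of_append_cons_cons]
  intro a b l₁ l₂ he
  exact h _ _ _ _ he

theorem Arc.exists_split {w v x y : V} {i l₁ l₂ : List V} (h : w :: (i ++ [v]) = l₁ ++ x :: y :: l₂) :
    ∃ L R, i = L ++ R ∧ (w :: L).getLast? = some x ∧ (R ++ [v]).head? = some y ∧
      l₁ ++ [x] = w :: L ∧ y :: l₂ = R ++ [v] := by
  obtain ⟨L, hL⟩ : ∃ L, l₁ ++ [x] = w :: L := by
    cases l₁ with
    | nil =>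
      simp only [List.nil_append, List.cons.injEq] at h
      exact ⟨[], by simp [h.1]⟩
    | cons a l =>
      simp only [List.cons_append, List.cons.injEq] at h
      exact ⟨l ++ [x], by simp [h.1]⟩
  obtain ⟨R, hR⟩ : ∃ R, y :: l₂ = R ++ [v] := by
    rcases List.eq_nil_or_concat' (y :: l₂) with h1 | ⟨R, b, hb⟩
    · simp at h1
    · refine ⟨R, ?_⟩
      have h2 := congrArg List.getLast? h
      rw [List.append_cons l₁ x, hb, ← List.append_assoc, ← List.cons_append] at h2
      simp only [List.getLast?_append] at h2
      rw [hb]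
      simpa using h2.symm
  refine ⟨L, R, ?_, ?_, ?_, hL, hR⟩
  · rw [List.append_cons l₁ x, hL, hR, List.cons_append, ← List.append_assoc] at h
    simp only [List.cons.injEq, true_and] at h
    exact List.append_cancel_right h
  · rw [← hL]
    simp
  · rw [← hR]
    simp

/-- An edge `v₁ v₂` of `Γ` is replaced by the chain `new` of vertices of valency two. The continued
fractions along paths through the edge are preserved, up to the corrections `j₁` and `j₂` of the
weights of `v₁` and `v₂`, while the parity of the number of positive eigenvalues changes
according to `s`. -/
structure EdgeMove (Γ : Plumbing V) (Γ' : Plumbing V') (ι : V → V') (new : List V') (v₁ v₂ : V)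
    (τ : V → ℤˣ) (s : ℤˣ) (j₁ j₂ : ℤ) : Prop where
  injective : Function.Injective ι
  notMem : ∀ x, ι x ∉ new
  exists_eq : ∀ y, (∃ x, ι x = y) ∨ y ∈ new
  adj : ∀ {x y}, Γ.graph.Adj x y → s(x, y) ≠ s(v₁, v₂) → Γ'.graph.Adj (ι x) (ι y)
  adj_edge : Γ.graph.Adj v₁ v₂
  isPathList : Γ'.IsPathList (ι v₁ :: (new ++ [ι v₂]))
  deg : ∀ x, Γ'.deg (ι x) = Γ.deg x
  deg_new : ∀ y ∈ new, Γ'.deg y = 2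
  weight_of_ne : ∀ x, x ≠ v₁ → x ≠ v₂ → Γ'.weight (ι x) = Γ.weight x
  weight_left : Γ'.weight (ι v₁) = Γ.weight v₁ + j₁
  weight_right : Γ'.weight (ι v₂) = Γ.weight v₂ + j₂
  rel : ∀ l, ChainRel s j₁ (Γ.weight v₂ :: l) (new.map Γ'.weight ++ (Γ.weight v₂ + j₂) :: l)
  rel_nil : ChainRel s j₁ [] (new.map Γ'.weight)
  rel_reverse : ∀ l,
    ChainRel s j₂ (Γ.weight v₁ :: l) (new.reverse.map Γ'.weight ++ (Γ.weight v₁ + j₁) :: l)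
  rel_reverse_nil : ChainRel s j₂ [] (new.reverse.map Γ'.weight)
  sign_edge : τ v₁ * τ v₂ = s
  sign : ∀ {x y}, Γ.graph.Adj x y → s(x, y) ≠ s(v₁, v₂) → τ x = τ y

namespace EdgeMove

variable {ι : V → V'} {new : List V'} {v₁ v₂ : V} {τ : V → ℤˣ} {s : ℤˣ} {j₁ j₂ : ℤ}

theorem symm (h : EdgeMove Γ Γ' ι new v₁ v₂ τ s j₁ j₂) :
    EdgeMove Γ Γ' ι new.reverse v₂ v₁ τ s j₂ j₁ where
  injective := h.injective
  notMem x := by simpa using h.notMem x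
  exists_eq y := by simpa using h.exists_eq y
  adj hxy hne := h.adj hxy (by rwa [Sym2.eq_swap (a := v₁)])
  adj_edge := h.adj_edge.symm
  isPathList := by simpa using h.isPathList.reverse
  deg := h.deg
  deg_new y hy := h.deg_new y (List.mem_reverse.1 hy)
  weight_of_ne x h₂ h₁ := h.weight_of_ne x h₁ h₂
  weight_left := h.weight_right
  weight_right := h.weight_left
  rel := h.rel_reverse
  rel_nil := h.rel_reverse_nil
  rel_reverse := by simpa using h.rel
  rel_reverse_nil := by simpa using h.rel_nil
  sign_edge := by rw [mul_comm, h.sign_edge]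
  sign hxy hne := h.sign hxy (by rwa [Sym2.eq_swap (a := v₁)])

/-- A path that misses an end of the replaced edge cannot cross it, and signs change only across
that edge. -/
theorem sign_eq_of_isPathList (h : EdgeMove Γ Γ' ι new v₁ v₂ τ s j₁ j₂) {x y : V} {l : List V}
    (hl : Γ.IsPathList (x :: l)) (hv : v₁ ∉ x :: l ∨ v₂ ∉ x :: l) (hy : y ∈ x :: l) : τ x = τ y := by
  induction l generalizing x with
  | nil =>
    rw [List.mem_singleton] at hy
    rw [hy]
  | cons b t ih =>
    have hxb : τ x = τ b := by
      refine h.sign hl.adj_head ?_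
      intro he
      rcases Sym2.eq_iff.1 he with ⟨rfl, rfl⟩ | ⟨rfl, rfl⟩ <;> simp at hv
    rcases List.mem_cons.1 hy with rfl | hy
    · rfl
    · rw [hxb]
      refine ih hl.of_cons ?_ hy
      rcases hv with hv | hv
      · exact Or.inl fun hm => hv (List.mem_cons_of_mem _ hm)
      · exact Or.inr fun hm => hv (List.mem_cons_of_mem _ hm)

theorem isPathList_map (h : EdgeMove Γ Γ' ι new v₁ v₂ τ s j₁ j₂) {l : List V}
    (hl : Γ.IsPathList l) (hv : v₁ ∉ l ∨ v₂ ∉ l) : Γ'.IsPathList (l.map ι) := by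
  refine hl.map h.injective fun l₁ l₂ x y he => ?_
  have hxy : Γ.graph.Adj x y := List.isChain_iff_forall_rel_of_append_cons_cons.1 hl.1 he
  refine h.adj hxy ?_
  intro hs
  subst he
  rcases Sym2.eq_iff.1 hs with ⟨rfl, rfl⟩ | ⟨rfl, rfl⟩ <;> simp at hv

theorem map_weight (h : EdgeMove Γ Γ' ι new v₁ v₂ τ s j₁ j₂) {l : List V} (h₁ : v₁ ∉ l)
    (h₂ : v₂ ∉ l) : (l.map ι).map Γ'.weight = l.map Γ.weight := by
  rw [List.map_map]
  refine List.map_congr_left fun x hx => ?_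
  exact h.weight_of_ne x (by rintro rfl; exact h₁ hx) (by rintro rfl; exact h₂ hx)

theorem chainRel_right (h : EdgeMove Γ Γ' ι new v₁ v₂ τ s j₁ j₂) {r : List V}
    (hr : r = [] ∨ ∃ t, r = v₂ :: t ∧ v₁ ∉ t ∧ v₂ ∉ t) :
    ChainRel s j₁ (r.map Γ.weight) ((new ++ r.map ι).map Γ'.weight) := by
  rcases hr with rfl | ⟨t, rfl, h₁, h₂⟩
  · simpa using h.rel_nil
  · have := h.rel (t.map Γ.weight)
    rw [List.map_append, List.map_cons, List.map_cons, List.map_cons, h.map_weight h₁ h₂,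
      h.weight_right]
    exact this

/-- If the vertex `v₁` is interior to the arc, its corrected weight absorbs `j₁` and the prefix is
unaffected. Otherwise the correction stays with the root, which is harmless for integrality and for
vanishing. -/
theorem exists_chainRel (h : EdgeMove Γ Γ' ι new v₁ v₂ τ s j₁ j₂) {L r : List V}
    (hL : L = [] ∨ ∃ t, L = t ++ [v₁] ∧ v₁ ∉ t ∧ v₂ ∉ t)
    (hr : r = [] ∨ ∃ t, r = v₂ :: t ∧ v₁ ∉ t ∧ v₂ ∉ t) :
    ∃ j, ChainRel s j ((L ++ r).map Γ.weight) ((L.map ι ++ (new ++ r.map ι)).map Γ'.weight) := by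
  rcases hL with rfl | ⟨t, rfl, h₁, h₂⟩
  · exact ⟨j₁, by simpa using h.chainRel_right hr⟩
  · refine ⟨0, ?_⟩
    have h3 := ((h.chainRel_right hr).cons (Γ.weight v₁)).append (t.map Γ.weight)
    have h4 : ((t ++ [v₁]).map ι ++ (new ++ r.map ι)).map Γ'.weight =
        t.map Γ.weight ++ (Γ.weight v₁ + j₁) :: (new ++ r.map ι).map Γ'.weight := by
      rw [List.map_append, List.map_append, List.map_append, h.map_weight h₁ h₂]
      simp [h.weight_left]
    rw [h4]
    simpa using h3

/-- The image of an arc of `Γ` that passes through the edge from `v₁` to `v₂`. -/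
theorem exists_arc_of_crossing (h : EdgeMove Γ Γ' ι new v₁ v₂ τ s j₁ j₂) {w v : V} {i : List V}
    (hi : Γ.Arc w i v) {l₁ l₂ : List V} (he : w :: (i ++ [v]) = l₁ ++ v₁ :: v₂ :: l₂) :
    ∃ i', Γ'.Arc (ι w) i' (ι v) ∧
      (∃ j, ChainRel (τ w * τ v) j (i.map Γ.weight) (i'.map Γ'.weight)) ∧
      ∃ j, ChainRel (τ w * τ v) j ((i ++ [v]).map Γ.weight) ((i' ++ [ι v]).map Γ'.weight) := by
  obtain ⟨L, R, rfl, hL, hR, hL', hR'⟩ := Arc.exists_split he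
  have hp : Γ.IsPathList ((w :: L) ++ (R ++ [v])) := by simpa using hi.1
  have hpl : Γ.IsPathList (w :: L) := hp.of_append_left
  have hpr : Γ.IsPathList (R ++ [v]) := hp.of_append_right
  have hdisj : ∀ x ∈ w :: L, x ∉ R ++ [v] := fun x hx hx' =>
    (List.nodup_append.1 hp.2).2.2 x hx x hx' rfl
  have hv₁ : v₁ ∈ w :: L := List.mem_of_getLast? hL
  have hv₂ : v₂ ∈ R ++ [v] := List.mem_of_mem_head? (by rw [hR]; rfl)
  have hv₁' : v₁ ∉ R ++ [v] := hdisj _ hv₁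
  have hv₂' : v₂ ∉ w :: L := fun h' => hdisj _ h' hv₂
  have hnewR : ∀ x, ι x ∉ new := h.notMem
  have hmr : Γ'.IsPathList ((R ++ [v]).map ι) := h.isPathList_map hpr (Or.inl hv₁')
  have hml : Γ'.IsPathList ((w :: L).map ι) := h.isPathList_map hpl (Or.inr hv₂')
  have hpath : Γ'.IsPathList ((w :: L).map ι ++ (new ++ (R ++ [v]).map ι)) := by
    have hc := h.isPathList.1
    rw [← List.singleton_append, List.isChain_append, List.isChain_append] at hc
    obtain ⟨-, ⟨hn, -, hn2⟩, hn1⟩ := hc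
    have hh : ((R ++ [v]).map ι).head? = some (ι v₂) := by rw [List.head?_map, hR]; rfl
    have hl : ((w :: L).map ι).getLast? = some (ι v₁) := by rw [List.getLast?_map, hL]; rfl
    refine ⟨?_, ?_⟩
    · rw [List.isChain_append, List.isChain_append]
      refine ⟨hml.1, ⟨hn, hmr.1, ?_⟩, ?_⟩
      · intro x hx y hy
        rw [hh] at hy
        exact hn2 x hx y (by simpa using hy)
      · intro x hx y hy
        rw [hl] at hx
        rw [List.head?_append, hh] at hy
        refine hn1 x (by simpa using hx) y ?_
        rw [List.head?_append]
        simpa using hy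
    · have hnd : new.Nodup := (h.isPathList.of_cons.of_append_left).2
      rw [List.nodup_append, List.nodup_append]
      refine ⟨hml.2, ⟨hnd, hmr.2, ?_⟩, ?_⟩
      · rintro x hx y hy rfl
        obtain ⟨z, -, rfl⟩ := List.mem_map.1 hy
        exact h.notMem z hx
      · rintro x hx y hy rfl
        obtain ⟨z, hz, rfl⟩ := List.mem_map.1 hx
        rcases List.mem_append.1 hy with hy | hy
        · exact h.notMem z hy
        · obtain ⟨z', hz', he'⟩ := List.mem_map.1 hy
          exact hdisj z hz (h.injective he' ▸ hz')
  have hsign : τ w * τ v = s := by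
    rw [← h.sign_edge]
    have e1 : τ w = τ v₁ := h.sign_eq_of_isPathList hpl (Or.inr hv₂') hv₁
    have e2 : τ v₂ = τ v := by
      have hpr' := hpr
      rw [← hR'] at hpr'
      refine h.sign_eq_of_isPathList hpr' (Or.inl (by rw [hR']; exact hv₁')) ?_
      rw [hR']
      simp
    rw [e1, e2]
  have hLL : L = [] ∨ ∃ t, L = t ++ [v₁] ∧ v₁ ∉ t ∧ v₂ ∉ t := by
    rcases List.eq_nil_or_concat' L with h1 | ⟨t, b, rfl⟩
    · exact Or.inl h1
    · right
      have hb : b = v₁ := by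
        rw [← List.cons_append, List.getLast?_append] at hL
        simpa using hL
      subst hb
      refine ⟨t, rfl, ?_, fun hm => hv₂' (by simp [hm])⟩
      intro hm
      have := (List.nodup_append.1 (List.nodup_cons.1 hpl.2).2).2.2 _ hm b (by simp)
      exact this rfl
  have hRR : R ++ [v] = [] ∨ ∃ t, R ++ [v] = v₂ :: t ∧ v₁ ∉ t ∧ v₂ ∉ t := by
    refine Or.inr ⟨l₂, hR'.symm, ?_, ?_⟩
    · intro hm
      exact hv₁' (hR' ▸ List.mem_cons_of_mem _ hm)
    · have := hpr.2
      rw [← hR'] at this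
      exact (List.nodup_cons.1 this).1
  have hRR' : R = [] ∨ ∃ t, R = v₂ :: t ∧ v₁ ∉ t ∧ v₂ ∉ t := by
    cases R with
    | nil => exact Or.inl rfl
    | cons b t =>
      have hb : b = v₂ := by simpa using hR
      subst hb
      refine Or.inr ⟨t, rfl, fun hm => hv₁' (by simp [hm]), ?_⟩
      have := (List.nodup_cons.1 hpr.2).1
      exact fun hm => this (by simp [hm])
  refine ⟨L.map ι ++ (new ++ R.map ι), ⟨by simpa using hpath, ?_⟩, ?_, ?_⟩
  · intro x hx
    rcases List.mem_append.1 hx with hx | hx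
    · obtain ⟨z, hz, rfl⟩ := List.mem_map.1 hx
      rw [h.deg]
      exact hi.2 z (by simp [hz])
    · rcases List.mem_append.1 hx with hx | hx
      · exact h.deg_new x hx
      · obtain ⟨z, hz, rfl⟩ := List.mem_map.1 hx
        rw [h.deg]
        exact hi.2 z (by simp [hz])
  · rw [hsign]
    exact h.exists_chainRel hLL hRR'
  · rw [hsign]
    have := h.exists_chainRel hLL hRR
    simpa using this

/-- An arc crossing the edge acquires the new chain and the sign `s = τ w * τ v`; any other arc is
copied, with `τ w * τ v = 1`. The leaf hypothesis ensures that the weight of `v` is unchanged in the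
second case. -/
theorem exists_arc (h : EdgeMove Γ Γ' ι new v₁ v₂ τ s j₁ j₂) {w v : V} {i : List V}
    (hi : Γ.Arc w i v) :
    ∃ i', Γ'.Arc (ι w) i' (ι v) ∧
      (∃ j, ChainRel (τ w * τ v) j (i.map Γ.weight) (i'.map Γ'.weight)) ∧
      (Γ.deg v = 1 → ∃ j, ChainRel (τ w * τ v) j ((i ++ [v]).map Γ.weight)
        ((i' ++ [ι v]).map Γ'.weight)) := by
  by_cases h12 : ∃ l₁ l₂, w :: (i ++ [v]) = l₁ ++ v₁ :: v₂ :: l₂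
  · obtain ⟨l₁, l₂, he⟩ := h12
    obtain ⟨i', h1, h2, h3⟩ := h.exists_arc_of_crossing hi he
    exact ⟨i', h1, h2, fun _ => h3⟩
  by_cases h21 : ∃ l₁ l₂, w :: (i ++ [v]) = l₁ ++ v₂ :: v₁ :: l₂
  · obtain ⟨l₁, l₂, he⟩ := h21
    obtain ⟨i', h1, h2, h3⟩ := h.symm.exists_arc_of_crossing hi he
    exact ⟨i', h1, h2, fun _ => h3⟩
  have hne : ∀ l₁ l₂ x y, w :: (i ++ [v]) = l₁ ++ x :: y :: l₂ → s(x, y) ≠ s(v₁, v₂) := by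
    intro l₁ l₂ x y he hs
    rcases Sym2.eq_iff.1 hs with ⟨rfl, rfl⟩ | ⟨rfl, rfl⟩
    · exact h12 ⟨_, _, he⟩
    · exact h21 ⟨_, _, he⟩
  have hadj : ∀ l₁ l₂ x y, w :: (i ++ [v]) = l₁ ++ x :: y :: l₂ → Γ.graph.Adj x y :=
    fun l₁ l₂ x y he => List.isChain_iff_forall_rel_of_append_cons_cons.1 hi.1.1 he
  have hpath : Γ'.IsPathList ((w :: (i ++ [v])).map ι) :=
    hi.1.map h.injective fun l₁ l₂ x y he => h.adj (hadj _ _ _ _ he) (hne _ _ _ _ he)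
  -- Both neighbours of an interior vertex lie on the arc, so an interior vertex on the replaced
  -- edge would force the arc to cross it.
  have hnot : ∀ x ∈ i, ∀ y, Γ.graph.Adj x y → s(x, y) ≠ s(v₁, v₂) := by
    intro x hx y hxy
    obtain ⟨t₁, t₂, a, b, he, hab, ha, hb⟩ := hi.exists_neighbors hx
    rcases eq_or_eq_of_deg_eq_two (hi.2 x hx) ha hb hab hxy with rfl | rfl
    · rw [Sym2.eq_swap]
      exact hne _ _ _ _ he
    · exact hne (t₁ ++ [a]) _ _ _ (by simpa using he)
  -- The only edge at a leaf is the last edge of the arc.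
  have hleaf : Γ.deg v = 1 → ∀ y, Γ.graph.Adj v y → s(v, y) ≠ s(v₁, v₂) := by
    intro hv y hvy
    obtain ⟨t, a, hta⟩ : ∃ t a, w :: i = t ++ [a] := by
      rcases List.eq_nil_or_concat' (w :: i) with h1 | h1
      · simp at h1
      · exact h1
    have he : w :: (i ++ [v]) = t ++ a :: v :: [] := by
      rw [← List.cons_append, hta]
      simp
    have := eq_of_deg_eq_one hv (hadj _ _ _ _ he).symm hvy
    subst this
    rw [Sym2.eq_swap]
    exact hne _ _ _ _ he
  have hmem : ∀ x, (∀ y, Γ.graph.Adj x y → s(x, y) ≠ s(v₁, v₂)) → x ≠ v₁ ∧ x ≠ v₂ := by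
    intro x hx
    constructor
    · rintro rfl
      exact hx v₂ h.adj_edge rfl
    · rintro rfl
      exact hx v₁ h.adj_edge.symm Sym2.eq_swap
  have hsign : τ w * τ v = 1 := by
    have : τ w = τ v := by
      have hc : (w :: (i ++ [v])).IsChain fun x y => τ x = τ y :=
        List.isChain_iff_forall_rel_of_append_cons_cons.2 fun {a b l₁ l₂} he =>
          h.sign (hadj _ _ _ _ he) (hne _ _ _ _ he)
      have : IsTrans V fun x y => τ x = τ y := ⟨fun _ _ _ h1 h2 => h1.trans h2⟩
      exact (List.pairwise_cons.1 (List.isChain_iff_pairwise.1 hc)).1 v (by simp)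
    rw [this, Int.units_mul_self]
  have h₁ : v₁ ∉ i := fun hm => (hmem v₁ (hnot v₁ hm)).1 rfl
  have h₂ : v₂ ∉ i := fun hm => (hmem v₂ (hnot v₂ hm)).2 rfl
  refine ⟨i.map ι, ⟨by simpa using hpath, ?_⟩, ⟨0, ?_⟩, fun hv => ⟨0, ?_⟩⟩
  · intro x hx
    obtain ⟨z, hz, rfl⟩ := List.mem_map.1 hx
    rw [h.deg]
    exact hi.2 z hz
  · rw [hsign, h.map_weight h₁ h₂]
    exact ChainRel.refl _
  · have h3 := hmem v (hleaf hv)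
    have h4 : (i.map ι ++ [ι v]).map Γ'.weight = (i ++ [v]).map Γ.weight := by
      rw [← h.map_weight (l := i ++ [v]) (by simp [h₁, h3.1.symm]) (by simp [h₂, h3.2.symm])]
      simp
    rw [hsign, h4]
    exact ChainRel.refl _

end EdgeMove
end Transfer
end Plumbing

/-! ### Transferring sign vectors between plumbings -/

namespace Plumbing

section HighTransfer

variable {V V' : Type u} [Fintype V] [DecidableEq V] [Fintype V'] [DecidableEq V']
  {Γ : Plumbing V} {Γ' : Plumbing V'} {ι : V → V'} {τ : V → ℤˣ}

/-- The high-valency vertices of `Γ` and `Γ'` correspond to each other under `ι`, and so do the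
arcs between them, up to the signs `τ`. -/
structure HighTransfer (Γ : Plumbing V) (Γ' : Plumbing V') (ι : V → V') (τ : V → ℤˣ) : Prop where
  injective : Function.Injective ι
  isHigh_iff : ∀ x, Γ'.IsHigh (ι x) ↔ Γ.IsHigh x
  exists_eq : ∀ y, Γ'.IsHigh y → ∃ x, ι x = y
  arc : ∀ w v i, Γ.IsHigh w → Γ.IsHigh v → Γ.Arc w i v → ∃ i', Γ'.Arc (ι w) i' (ι v) ∧
    ∃ j, ChainRel (τ w * τ v) j (i.map Γ.weight) (i'.map Γ'.weight)

namespace HighTransfer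

/-- The correspondence of the high-valency vertices. -/
def highEquiv (h : HighTransfer Γ Γ' ι τ) : Γ.High ≃ Γ'.High :=
  Equiv.ofBijective (fun w => ⟨ι w, (h.isHigh_iff w).2 w.2⟩) (by
    constructor
    · intro w w' hw
      exact Subtype.ext (h.injective (congrArg Subtype.val hw))
    · rintro ⟨y, hy⟩
      obtain ⟨x, rfl⟩ := h.exists_eq y hy
      exact ⟨⟨x, (h.isHigh_iff x).1 hy⟩, rfl⟩)

/-- The correspondence of the sign vectors. -/
def signEquiv (h : HighTransfer Γ Γ' ι τ) : (Γ'.High → ℤˣ) ≃ (Γ.High → ℤˣ) :=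
  (h.highEquiv.arrowCongr (Equiv.refl ℤˣ)).symm.trans (Equiv.mulLeft fun w : Γ.High => τ w)

theorem signEquiv_apply (h : HighTransfer Γ Γ' ι τ) (ξ : Γ'.High → ℤˣ) (w : Γ.High) :
    h.signEquiv ξ w = τ w * ξ ⟨ι w, (h.isHigh_iff w).2 w.2⟩ := rfl

theorem extendSign_signEquiv (h : HighTransfer Γ Γ' ι τ) (ξ : Γ'.High → ℤˣ) {x : V}
    (hx : Γ.IsHigh x) : Γ.extendSign (h.signEquiv ξ) x = τ x * Γ'.extendSign ξ (ι x) := by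
  rw [extendSign_of_isHigh _ hx, extendSign_of_isHigh _ ((h.isHigh_iff x).2 hx), signEquiv_apply]

/-- The factor `τ w * τ v` gained by the product of signs is the change of parity along the bridge.
Conversely, a bridge of `Γ'` comes from `Γ` because two high vertices there are always joined by an
arc. -/
theorem signEquiv_mem_chambers_iff (h : HighTransfer Γ Γ' ι τ) (h2 : Γ.highCount ≤ 2)
    (ξ : Γ'.High → ℤˣ) : h.signEquiv ξ ∈ Γ.chambers ↔ ξ ∈ Γ'.chambers := by
  have key : ∀ (w v : Γ.High) (i : List V) (i' : List V') (j : ℤ),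
      ChainRel (τ w * τ v) j (i.map Γ.weight) (i'.map Γ'.weight) →
      (h.signEquiv ξ w * h.signEquiv ξ v = (-1) ^ (chainPos (i.map Γ.weight) + 1) ↔
        ξ (h.highEquiv w) * ξ (h.highEquiv v) = (-1) ^ (chainPos (i'.map Γ'.weight) + 1)) := by
    intro w v i i' j hr
    rw [pow_succ, pow_succ, hr.2, signEquiv_apply, signEquiv_apply]
    change τ w * ξ (h.highEquiv w) * (τ v * ξ (h.highEquiv v)) = _ ↔ _
    rw [mul_mul_mul_comm]
    constructor
    · intro h1
      rw [mul_assoc, ← h1, ← mul_assoc, Int.units_mul_self, one_mul]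
    · intro h1
      rw [h1, mul_assoc (τ w * τ v : ℤˣ), ← mul_assoc, Int.units_mul_self, one_mul]
  rw [mem_chambers, mem_chambers]
  constructor
  · intro hξ y₁ y₂ i' hi' hz
    obtain ⟨w, rfl⟩ := h.highEquiv.surjective y₁
    obtain ⟨v, rfl⟩ := h.highEquiv.surjective y₂
    have hne : (w : V) ≠ v := fun he => hi'.ne (congrArg ι he)
    obtain ⟨i, hi⟩ := exists_arc_of_highCount_le_two h2 w.2 v.2 hne
    obtain ⟨i'', hi'', j, hj⟩ := h.arc w v i w.2 v.2 hi
    have : i'' = i' := hi''.ext hi'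
    subst this
    exact (key w v i i'' j hj).1 (hξ w v i hi (hj.contFrac_eq_zero_iff.1 hz))
  · intro hξ w v i hi hz
    obtain ⟨i', hi', j, hj⟩ := h.arc w v i w.2 v.2 hi
    exact (key w v i i' j hj).2 (hξ (h.highEquiv w) (h.highEquiv v) i' hi'
      (hj.contFrac_eq_zero_iff.2 hz))

theorem leafExp_eq_zero {ξ : Γ.High → ℤˣ} (hno : ∀ w, ¬Γ.IsHigh w) (v : V) :
    Γ.leafExp ξ v = 0 := by
  have : IsEmpty Γ.High := ⟨fun w => hno w.1 w.2⟩
  rw [leafExp]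
  exact Finset.sum_of_isEmpty _

/-- Here `t` is the sign attached to the leaf; the sign `τ w` of the chain cancels against that of
the transported vector at the root of the branch. -/
theorem leafExp_signEquiv (h : HighTransfer Γ Γ' ι τ) (ξ : Γ'.High → ℤˣ) {v : V} {v' : V'}
    (hv : Γ.deg v = 1) (hv' : Γ'.deg v' = 1) (t : ℤˣ)
    (harc : ∀ w i, Γ.IsHigh w → Γ.Arc w i v → ∃ i', Γ'.Arc (ι w) i' v' ∧
      ∃ j, ChainRel (τ w * t) j ((i ++ [v]).map Γ.weight) ((i' ++ [v']).map Γ'.weight)) :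
    (t : ℤ) * Γ'.leafExp ξ v' = Γ.leafExp (h.signEquiv ξ) v := by
  by_cases hex : ∃ w, Γ.IsHigh w
  · obtain ⟨w₀, hw₀⟩ := hex
    obtain ⟨w, hw⟩ := exists_isBranch hv hw₀
    obtain ⟨hwh, -, i, hi⟩ := isBranch_iff.1 hw
    obtain ⟨i', hi', j, hj⟩ := harc w i hwh hi
    rw [leafExp_of_arc _ hi hwh hv, leafExp_of_arc _ hi' ((h.isHigh_iff w).2 hwh) hv',
      hj.leafSign_eq, signEquiv_apply]
    have h1 : ((t : ℤ)) * t = 1 := by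
      rw [← Units.val_mul, Int.units_mul_self, Units.val_one]
    push_cast
    linear_combination (ξ ⟨ι w, (h.isHigh_iff w).2 hwh⟩ : ℤ) * (τ w : ℤ) *
      leafSign ((i ++ [v]).map Γ.weight) * h1
  · push Not at hex
    rw [leafExp_eq_zero hex, leafExp_eq_zero, mul_zero]
    intro y hy
    obtain ⟨x, rfl⟩ := h.exists_eq y hy
    exact hex x ((h.isHigh_iff x).1 hy)

end HighTransfer

theorem vertexFactor_congr {v : V} {d : ℕ} {s s' : ℤ} {ξ ξ' : ℤˣ} (hs : d = 1 → s = s')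
    (hξ : 3 ≤ d → ξ = ξ') : vertexFactor v d s ξ = vertexFactor v d s' ξ' := by
  have h3 : d = 0 ∨ d = 1 ∨ d = 2 ∨ 3 ≤ d := by omega
  rcases h3 with rfl | rfl | rfl | h3
  · rw [vertexFactor_zero, vertexFactor_zero]
  · rw [hs rfl, vertexFactor_one, vertexFactor_one]
  · rw [vertexFactor_two, vertexFactor_two]
  · rw [hξ h3, vertexFactor_of_three_le v h3, vertexFactor_of_three_le v h3]

namespace EdgeMove

variable {new : List V'} {v₁ v₂ : V} {s : ℤˣ} {j₁ j₂ : ℤ}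

theorem highTransfer (h : EdgeMove Γ Γ' ι new v₁ v₂ τ s j₁ j₂) : HighTransfer Γ Γ' ι τ where
  injective := h.injective
  isHigh_iff x := by rw [IsHigh, IsHigh, h.deg]
  exists_eq y hy := by
    rcases h.exists_eq y with h1 | h1
    · exact h1
    · rw [IsHigh, h.deg_new y h1] at hy
      omega
  arc w v i _ _ hi := by
    obtain ⟨i', h1, h2, -⟩ := h.exists_arc hi
    exact ⟨i', h1, h2⟩

/-- The new vertices have degree two and contribute the factor `1`; all remaining factors correspond
under `τ`. -/
theorem zHatCoeff_eq (h : EdgeMove Γ Γ' ι new v₁ v₂ τ s j₁ j₂) (h2 : Γ.highCount ≤ 2) {a : V → ℤ}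
    {a' : V' → ℤ} {κ : V' → V} {τ' : V' → ℤˣ} (hθ : ThetaReduction Γ Γ' a a' κ τ')
    (hκ : ∀ x, κ (ι x) = x) (hτ : ∀ x, τ' (ι x) = τ x) (n : ℚ) (k : ℤ) :
    Γ'.zHatCoeff a' n k = Γ.zHatCoeff a n k := by
  refine hθ.zHatCoeff_eq_of_equiv h.highTransfer.signEquiv
    (h.highTransfer.signEquiv_mem_chambers_iff h2) (fun ξ _ => ?_) n k
  rw [substDiscriminant, fullDiscriminant]
  refine (Fintype.prod_of_injective ι h.injective _ _ ?_ ?_).symm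
  · intro y hy
    rcases h.exists_eq y with h1 | h1
    · exact absurd h1 hy
    · rw [h.deg_new y h1, vertexFactor_two]
  · intro x
    rw [hκ, hτ, h.deg]
    refine vertexFactor_congr (fun hx => ?_) fun hx => h.highTransfer.extendSign_signEquiv ξ hx
    refine (h.highTransfer.leafExp_signEquiv ξ hx (by rw [h.deg, hx]) (τ x) ?_).symm
    intro w i _ hi
    obtain ⟨i', h3, -, h4⟩ := h.exists_arc hi
    exact ⟨i', h3, h4 hx⟩

end EdgeMove
end HighTransfer

/-! ### Attaching a chain to a vertex -/

section Pendant

variable {V V' : Type u} [Fintype V] [DecidableEq V] [Fintype V'] [DecidableEq V']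
  {Γ : Plumbing V} {Γ' : Plumbing V'} {ι : V → V'} {τ : V → ℤˣ}

/-- A chain with vertices `mid` and `u` is attached to the vertex `v` of `Γ`. The continued fraction
of this chain vanishes up to the correction `j` of the weight of `v`, and the parity of its number
of positive eigenvalues is given by `s`. -/
structure PendantMove (Γ : Plumbing V) (Γ' : Plumbing V') (ι : V → V') (v : V) (mid : List V')
    (u : V') (s : ℤˣ) (j : ℤ) : Prop where
  injective : Function.Injective ι
  notMem : ∀ x, ι x ∉ mid ++ [u]
  exists_eq : ∀ y, (∃ x, ι x = y) ∨ y ∈ mid ++ [u]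
  adj : ∀ {x y}, Γ.graph.Adj x y → Γ'.graph.Adj (ι x) (ι y)
  isPathList : Γ'.IsPathList (ι v :: (mid ++ [u]))
  deg_of_ne : ∀ x, x ≠ v → Γ'.deg (ι x) = Γ.deg x
  deg_self : Γ'.deg (ι v) = Γ.deg v + 1
  deg_mid : ∀ y ∈ mid, Γ'.deg y = 2
  deg_end : Γ'.deg u = 1
  weight_of_ne : ∀ x, x ≠ v → Γ'.weight (ι x) = Γ.weight x
  weight_self : Γ'.weight (ι v) = Γ.weight v + j
  rel : ChainRel s j [] ((mid ++ [u]).map Γ'.weight)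

namespace PendantMove

variable {v : V} {mid : List V'} {u : V'} {s : ℤˣ} {j : ℤ}

theorem map_weight (h : PendantMove Γ Γ' ι v mid u s j) {l : List V} (hv : v ∉ l) :
    (l.map ι).map Γ'.weight = l.map Γ.weight := by
  rw [List.map_map]
  refine List.map_congr_left fun x hx => ?_
  exact h.weight_of_ne x (by rintro rfl; exact hv hx)

theorem isPathList_map (h : PendantMove Γ Γ' ι v mid u s j) {l : List V}
    (hl : Γ.IsPathList l) : Γ'.IsPathList (l.map ι) :=
  hl.map h.injective fun _ _ _ _ he =>
    h.adj (List.isChain_iff_forall_rel_of_append_cons_cons.1 hl.1 he)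

theorem arc_map (h : PendantMove Γ Γ' ι v mid u s j) {w x : V} {i : List V} (hi : Γ.Arc w i x)
    (hv : v ∉ i) : Γ'.Arc (ι w) (i.map ι) (ι x) := by
  refine ⟨by simpa using h.isPathList_map hi.1, ?_⟩
  intro y hy
  obtain ⟨z, hz, rfl⟩ := List.mem_map.1 hy
  rw [h.deg_of_ne z (by rintro rfl; exact hv hz)]
  exact hi.2 z hz

theorem arc_end (h : PendantMove Γ Γ' ι v mid u s j) : Γ'.Arc (ι v) mid u :=
  ⟨h.isPathList, h.deg_mid⟩

/-- Raising the degree of `v` by one changes whether it is high only if that degree was two; hence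
this exclusion. -/
theorem highTransfer (h : PendantMove Γ Γ' ι v mid u s j) (hv : Γ.deg v ≠ 2) :
    HighTransfer Γ Γ' ι 1 where
  injective := h.injective
  isHigh_iff x := by
    rw [IsHigh, IsHigh]
    by_cases hx : x = v
    · subst hx
      rw [h.deg_self]
      omega
    · rw [h.deg_of_ne x hx]
  exists_eq y hy := by
    rcases h.exists_eq y with h1 | h1
    · exact h1
    · rw [IsHigh] at hy
      rcases List.mem_append.1 h1 with h2 | h2
      · rw [h.deg_mid y h2] at hy
        omega
      · rw [List.mem_singleton.1 h2, h.deg_end] at hy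
        omega
  arc w x i _ _ hi := by
    have hvi : v ∉ i := fun hm => hv (hi.2 v hm)
    refine ⟨i.map ι, h.arc_map hi hvi, 0, ?_⟩
    rw [h.map_weight hvi]
    simpa using ChainRel.refl (i.map Γ.weight)

theorem arc_leaf (h : PendantMove Γ Γ' ι v mid u s j) {w : V} {i : List V} (hi : Γ.Arc w i v)
    (hv : Γ.deg v = 1) : Γ'.Arc (ι w) ((i ++ [v]).map ι ++ mid) u ∧
      ∃ j', ChainRel s j' ((i ++ [v]).map Γ.weight)
        (((i ++ [v]).map ι ++ mid ++ [u]).map Γ'.weight) := by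
  have hvi : v ∉ i := fun hm => by
    have := hi.2 v hm
    omega
  refine ⟨⟨⟨?_, ?_⟩, ?_⟩, 0, ?_⟩
  · have h1 := (h.isPathList_map hi.1).1
    have h2 := h.isPathList.1
    have h3 : ι w :: (((i ++ [v]).map ι ++ mid) ++ [u]) =
        (ι w :: i.map ι) ++ ι v :: (mid ++ [u]) := by simp
    rw [h3, List.isChain_split]
    refine ⟨by simpa using h1, h2⟩
  · have h3 : ι w :: (((i ++ [v]).map ι ++ mid) ++ [u]) =
        (w :: (i ++ [v])).map ι ++ (mid ++ [u]) := by simp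
    rw [h3, List.nodup_append]
    refine ⟨(h.isPathList_map hi.1).2, h.isPathList.of_cons.2, ?_⟩
    rintro x hx y hy rfl
    obtain ⟨z, -, rfl⟩ := List.mem_map.1 hx
    exact h.notMem z hy
  · intro x hx
    rcases List.mem_append.1 hx with hx | hx
    · obtain ⟨z, hz, rfl⟩ := List.mem_map.1 hx
      rcases List.mem_append.1 hz with hz' | hz'
      · rw [h.deg_of_ne z (by rintro rfl; exact hvi hz')]
        exact hi.2 z hz'
      · rw [List.mem_singleton.1 hz', h.deg_self, hv]
    · exact h.deg_mid x hx
  · have h3 := (h.rel.cons (Γ.weight v)).append (i.map Γ.weight)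
    have h4 : ((i ++ [v]).map ι ++ mid ++ [u]).map Γ'.weight =
        i.map Γ.weight ++ (Γ.weight v + j) :: (mid ++ [u]).map Γ'.weight := by
      rw [← h.map_weight hvi, ← h.weight_self]
      simp
    rw [h4]
    simpa using h3

theorem prod_eq (h : PendantMove Γ Γ' ι v mid u s j) {M : Type*} [CommMonoid M] (F : V' → M)
    (hF : ∀ y ∈ mid, F y = 1) : ∏ y, F y = F u * ∏ x, F (ι x) := by
  have h1 : Function.Injective (fun o : Option V => o.elim u ι) := by
    rintro (_ | x) (_ | y) hxy
    · rfl
    · exact absurd (by simp at hxy; simp [← hxy]) (h.notMem y)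
    · exact absurd (by simp at hxy; simp [hxy]) (h.notMem x)
    · exact congrArg some (h.injective hxy)
  rw [← Fintype.prod_of_injective _ h1 (fun o => F (o.elim u ι)) F ?_ fun _ => rfl]
  · simp [Fintype.prod_option]
  · intro y hy
    rcases h.exists_eq y with ⟨x, rfl⟩ | h2
    · exact absurd ⟨some x, rfl⟩ hy
    · rcases List.mem_append.1 h2 with h2 | h2
      · exact hF y h2
      · exact absurd ⟨none, (List.mem_singleton.1 h2).symm⟩ hy

theorem prod_vertexFactor_eq (h : PendantMove Γ Γ' ι v mid u s j) {κ : V' → V} {τ' : V' → ℤˣ}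
    (hκ : ∀ x, κ (ι x) = x) (hτ : ∀ x, τ' (ι x) = 1) (hκu : κ u = v) (hτu : τ' u = s)
    (ξ : Γ'.High → ℤˣ) : Γ'.substDiscriminant κ τ' ξ =
      leafFactor v ((s : ℤ) * Γ'.leafExp ξ u) *
      ∏ x, vertexFactor x (Γ'.deg (ι x)) (Γ'.leafExp ξ (ι x)) (Γ'.extendSign ξ (ι x)) := by
  have h1 := h.prod_eq (fun y => vertexFactor (κ y) (Γ'.deg y) ((τ' y : ℤ) * Γ'.leafExp ξ y)
    (τ' y * Γ'.extendSign ξ y)) fun y hy => by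
      rw [h.deg_mid y hy, vertexFactor_two]
  rw [substDiscriminant, h1, h.deg_end, hκu, hτu, vertexFactor_one]
  simp only [hκ, hτ, Units.val_one, one_mul]

/-- The attached chain is equivalent to the empty chain, which is a pseudo branch of sign `1`. So
the new leaf carries, up to `s`, exactly the sign of `v` needed for cancellation. -/
theorem leafExp_end (h : PendantMove Γ Γ' ι v mid u s j) (hv : Γ'.IsHigh (ι v))
    (ξ : Γ'.High → ℤˣ) : (s : ℤ) * Γ'.leafExp ξ u = Γ'.extendSign ξ (ι v) := by
  rw [leafExp_of_arc ξ h.arc_end hv h.deg_end, h.rel.leafSign_eq, extendSign_of_isHigh ξ hv]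
  have h1 : ((s : ℤ)) * s = 1 := by rw [← Units.val_mul, Int.units_mul_self, Units.val_one]
  have h2 : leafSign [] = 1 := by
    rw [leafSign, if_pos ⟨0, by simp [contFrac, subInv_infty]⟩]
    simp [chainPos]
  rw [h2]
  linear_combination (ξ ⟨ι v, hv⟩ : ℤ) * h1

/-- The factor at `v` is checked by degree: an isolated vertex becomes two leaves with equal
factors, a leaf is extended to a longer branch, and at a high vertex the new leaf cancels one power.
-/
theorem zHatCoeff_eq (h : PendantMove Γ Γ' ι v mid u s j) (hv : Γ.deg v ≠ 2)
    (h2 : Γ.highCount ≤ 2) {a : V → ℤ} {a' : V' → ℤ} {κ : V' → V} {τ' : V' → ℤˣ}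
    (hθ : ThetaReduction Γ Γ' a a' κ τ') (hκ : ∀ x, κ (ι x) = x) (hτ : ∀ x, τ' (ι x) = 1)
    (hκu : κ u = v) (hτu : τ' u = s) (n : ℚ) (k : ℤ) :
    Γ'.zHatCoeff a' n k = Γ.zHatCoeff a n k := by
  set H := h.highTransfer hv with hH
  refine hθ.zHatCoeff_eq_of_equiv H.signEquiv (H.signEquiv_mem_chambers_iff h2)
    (fun ξ _ => ?_) n k
  rw [h.prod_vertexFactor_eq hκ hτ hκu hτu, fullDiscriminant,
    ← Finset.mul_prod_erase Finset.univ _ (Finset.mem_univ v),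
    ← Finset.mul_prod_erase Finset.univ _ (Finset.mem_univ v), ← mul_assoc]
  congr 1
  · rw [h.deg_self]
    have hsign : 3 ≤ Γ.deg v → Γ.extendSign (H.signEquiv ξ) v = Γ'.extendSign ξ (ι v) := by
      intro h3
      rw [H.extendSign_signEquiv ξ h3, Pi.one_apply, one_mul]
    have h3 : Γ.deg v = 0 ∨ Γ.deg v = 1 ∨ 3 ≤ Γ.deg v := by omega
    rcases h3 with h3 | h3 | h3
    · have hno : ∀ w, ¬Γ'.IsHigh w := by
        intro y hy
        obtain ⟨x, rfl⟩ := H.exists_eq y hy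
        exact deg_ne_zero_of_isHigh ((H.isHigh_iff x).1 hy) v h3
      rw [h3, zero_add, vertexFactor_one, HighTransfer.leafExp_eq_zero hno,
        HighTransfer.leafExp_eq_zero hno, vertexFactor_zero, mul_zero, pow_two]
    · rw [h3, vertexFactor_two, mul_one, vertexFactor_one]
      congr 1
      refine H.leafExp_signEquiv ξ h3 h.deg_end s fun w i _ hi => ?_
      obtain ⟨h4, h5⟩ := h.arc_leaf hi h3
      exact ⟨_, h4, by simpa using h5⟩
    · rw [h.leafExp_end ((H.isHigh_iff v).2 h3)]
      exact leafFactor_mul_vertexFactor v (by omega) _ _ _ _ hsign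
  · refine Finset.prod_congr rfl fun x hx => ?_
    have hxv : x ≠ v := Finset.ne_of_mem_erase hx
    rw [h.deg_of_ne x hxv]
    refine vertexFactor_congr (fun hx1 => ?_) fun hx3 => ?_
    · have := H.leafExp_signEquiv ξ hx1 (by rw [h.deg_of_ne x hxv, hx1]) 1 fun w i _ hi => by
        have hvi : v ∉ i := fun hm => hv (hi.2 v hm)
        refine ⟨i.map ι, h.arc_map hi hvi, 0, ?_⟩
        have h4 : (i.map ι ++ [ι x]).map Γ'.weight = (i ++ [x]).map Γ.weight := by
          rw [← h.map_weight (l := i ++ [x]) (by simp [hvi, hxv.symm])]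
          simp
        rw [h4]
        simpa using ChainRel.refl ((i ++ [x]).map Γ.weight)
      simpa using this
    · rw [H.extendSign_signEquiv ξ hx3, Pi.one_apply, one_mul]

theorem isHigh_of_isHigh (h : PendantMove Γ Γ' ι v mid u s j) {x : V} (hx : Γ.IsHigh x) :
    Γ'.IsHigh (ι x) := by
  rw [IsHigh] at hx ⊢
  by_cases hxv : x = v
  · rw [hxv] at hx ⊢
    rw [h.deg_self]
    omega
  · rwa [h.deg_of_ne x hxv]

theorem highCount_lt (h : PendantMove Γ Γ' ι v mid u s j) (hv : Γ.deg v = 2) :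
    Γ.highCount < Γ'.highCount := by
  classical
  refine Fintype.card_lt_of_injective_of_notMem
    (fun w : Γ.High => (⟨ι w, h.isHigh_of_isHigh w.2⟩ : Γ'.High))
    (fun w w' hw => Subtype.ext (h.injective (congrArg Subtype.val hw)))
    (b := ⟨ι v, by rw [IsHigh, h.deg_self, hv]⟩) ?_
  rintro ⟨w, hw⟩
  have h1 : (w : V) = v := h.injective (congrArg Subtype.val hw)
  have h2 := w.2
  rw [IsHigh, h1, hv] at h2
  omega

/-- Here `v` becomes a new high vertex and cuts branches, so leaf exponents really can change. The
bound two for `Γ'` leaves at most one high vertex in `Γ`, where values at `t = 1` suffice; the sign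
of `v` is simply forgotten. -/
theorem isRecovered_iff (h : PendantMove Γ Γ' ι v mid u s j) (hv : Γ.deg v = 2)
    (hdet : Γ.linkingMatrix.det ≠ 0) (h2 : Γ'.highCount ≤ 2)
    {a : V → ℤ} {a' : V' → ℤ} {κ : V' → V} {τ' : V' → ℤˣ} (hθ : ThetaReduction Γ Γ' a a' κ τ')
    (hκ : ∀ x, κ (ι x) = x) (hτ : ∀ x, τ' (ι x) = 1) (hκu : κ u = v) (hτu : τ' u = s)
    (c : ℚ → ℝ) : Γ.IsRecovered a c ↔ Γ'.IsRecovered a' c := by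
  have hlt := h.highCount_lt hv
  have hadj : ∃ y, Γ.graph.Adj v y := by
    classical
    rw [deg] at hv
    obtain ⟨y, hy⟩ := (SimpleGraph.degree_pos_iff_exists_adj Γ.graph v).1 (by omega)
    exact ⟨y, hy⟩
  obtain ⟨y, hy⟩ := hadj
  have hv' : Γ'.IsHigh (ι v) := by rw [IsHigh, h.deg_self, hv]
  refine hθ.isRecovered_iff_of_extendSign hdet (deg_ne_zero_of_adj hy) (by omega) h2
    (fun ξ w => ξ ⟨ι w, h.isHigh_of_isHigh w.2⟩) (fun _ => rfl) (fun ξ _ =>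
      ⟨fun x => Γ'.leafExp ξ (ι x), ?_⟩) c
  rw [h.prod_vertexFactor_eq hκ hτ hκu hτu,
    ← Finset.mul_prod_erase Finset.univ _ (Finset.mem_univ v),
    ← Finset.mul_prod_erase Finset.univ _ (Finset.mem_univ v), ← mul_assoc]
  congr 1
  · rw [h.leafExp_end hv', h.deg_self]
    exact leafFactor_mul_vertexFactor v (by omega) _ _ _ _ fun h3 => by omega
  · refine Finset.prod_congr rfl fun x hx => ?_
    have hxv : x ≠ v := Finset.ne_of_mem_erase hx
    rw [h.deg_of_ne x hxv]
    refine vertexFactor_congr (fun _ => rfl) fun hx3 => ?_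
    rw [extendSign_of_isHigh _ (h.isHigh_of_isHigh hx3), extendSign_of_isHigh _ hx3]

end PendantMove
end Pendant
end Plumbing

/-! ### Conjugation of Spin^c structures -/

namespace Plumbing

section Conjugation

variable {V : Type u} [Fintype V] [DecidableEq V] {Γ : Plumbing V}

theorem expHom_id_neg_one (e : V → ℤ) : expHom (id : V → V) (-1) e = -e := by
  funext v
  rw [expHom_apply]
  simp

theorem SpincEquiv.neg {a b : V → ℤ} (h : Γ.SpincEquiv a b) : Γ.SpincEquiv (-a) (-b) := by
  obtain ⟨n, rfl⟩ := h
  refine ⟨-n, ?_⟩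
  rw [Matrix.mulVec_neg, smul_neg, neg_add]

theorem qExponent_neg (e : V → ℤ) : Γ.qExponent (-e) = Γ.qExponent e := by
  have : (fun v => (((-e) v : ℤ) : ℚ)) = -fun v => (e v : ℚ) := by
    funext v
    simp
  rw [qExponent, qExponent, this, Matrix.mulVec_neg, neg_dotProduct_neg]

/-- Inverting all variables produces the sign `(-1)` to the sum of the degrees, which is even. -/
theorem thetaReduction_neg (a : V → ℤ) : ThetaReduction Γ Γ a (-a) id (-1) where
  spinc e _ := by
    rw [expHom_id_neg_one, neg_neg]
    exact ⟨fun h => by simpa using h.neg, fun h => h.neg⟩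
  qExp e _ := by rw [expHom_id_neg_one, neg_neg, qExponent_neg]
  sign := by
    classical
    have h1 : ∑ v, Γ.deg v = 2 * Γ.graph.edgeFinset.card := by
      rw [← SimpleGraph.sum_degrees_eq_twice_card_edges]
      exact Finset.sum_congr rfl fun v _ => by rw [deg]
    simp only [Pi.neg_apply, Pi.one_apply]
    rw [Finset.prod_pow_eq_pow_sum, h1, pow_mul]
    simp

theorem highTransfer_neg (Γ : Plumbing V) : HighTransfer Γ Γ id (-1) where
  injective := Function.injective_id
  isHigh_iff _ := Iff.rfl
  exists_eq y _ := ⟨y, rfl⟩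
  arc w v i _ _ hi := ⟨i, hi, 0, by simpa using ChainRel.refl (i.map Γ.weight)⟩

/-- Conjugation symmetry is needed because in a split the negated side may be chosen to be either
end. -/
theorem zHatCoeff_neg (h2 : Γ.highCount ≤ 2) (a : V → ℤ) (n : ℚ) (k : ℤ) :
    Γ.zHatCoeff (-a) n k = Γ.zHatCoeff a n k := by
  refine (thetaReduction_neg a).zHatCoeff_eq_of_equiv (highTransfer_neg Γ).signEquiv
    ((highTransfer_neg Γ).signEquiv_mem_chambers_iff h2) (fun ξ _ => ?_) n k
  refine Finset.prod_congr rfl fun v _ => ?_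
  refine vertexFactor_congr (fun hv => ?_) fun hv =>
    ((highTransfer_neg Γ).extendSign_signEquiv ξ hv).symm
  exact (highTransfer_neg Γ).leafExp_signEquiv ξ hv hv (-1) fun w i _ hi =>
    ⟨i, hi, 0, by simpa using ChainRel.refl ((i ++ [v]).map Γ.weight)⟩

end Conjugation

open Classical in
theorem deg_eq_sum {V : Type u} [Fintype V] (Γ : Plumbing V) (v : V) :
    Γ.deg v = ∑ y, if Γ.graph.Adj v y then 1 else 0 := by
  rw [deg, ← SimpleGraph.card_neighborFinset_eq_degree, Finset.sum_boole, Nat.cast_id]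
  congr 1
  ext y
  simp

/-! ### Splitting a vertex -/

section VertexSplit

variable {V V' : Type u} [Fintype V] [DecidableEq V] [Fintype V'] [DecidableEq V']

/-- `Γ'` is obtained from `Γ` by replacing `v` by a chain of three vertices, the last of which is
attached to the neighbours of `v` in `A`; the sign `τ` changes along the edges from `v` to `A`. -/
structure VertexSplit (Γ : Plumbing V) (Γ' : Plumbing V') (φ : V ⊕ Bool ≃ V') (v : V) (A : Set V)
    (τ : V → ℤˣ) : Prop where
  adj_of_mem : ∀ y ∈ A, Γ.graph.Adj v y
  adj_inl_inl : ∀ x y, Γ'.graph.Adj (φ (Sum.inl x)) (φ (Sum.inl y)) ↔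
    Γ.graph.Adj x y ∧ ¬(x = v ∧ y ∈ A) ∧ ¬(y = v ∧ x ∈ A)
  adj_inl_false : ∀ x, Γ'.graph.Adj (φ (Sum.inl x)) (φ (Sum.inr false)) ↔ x = v
  adj_inl_true : ∀ x, Γ'.graph.Adj (φ (Sum.inl x)) (φ (Sum.inr true)) ↔ x ∈ A
  adj_false_true : Γ'.graph.Adj (φ (Sum.inr false)) (φ (Sum.inr true))
  weight_false : Γ'.weight (φ (Sum.inr false)) = 0
  weight_self : Γ'.weight (φ (Sum.inl v)) + Γ'.weight (φ (Sum.inr true)) = Γ.weight v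
  weight_of_ne : ∀ x, x ≠ v → Γ'.weight (φ (Sum.inl x)) = Γ.weight x
  sign_self : τ v = 1
  sign_of_mem : ∀ y ∈ A, τ y = -1
  sign_eq : ∀ x y, Γ.graph.Adj x y → ¬(x = v ∧ y ∈ A) → ¬(y = v ∧ x ∈ A) → τ x = τ y

namespace VertexSplit

variable {Γ : Plumbing V} {Γ' : Plumbing V'} {φ : V ⊕ Bool ≃ V'} {v : V} {A : Set V} {τ : V → ℤˣ}

theorem notMem (h : VertexSplit Γ Γ' φ v A τ) : v ∉ A := fun hv => (h.adj_of_mem v hv).ne rfl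

/-- Exchanging the ends replaces `A` by the other neighbours of `v` and negates all signs away from
`v`, that is, it conjugates the structure `a`. -/
theorem symm (h : VertexSplit Γ Γ' φ v A τ) :
    VertexSplit Γ Γ' ((Equiv.swap (Sum.inl v) (Sum.inr true)).trans φ) v
      {y | Γ.graph.Adj v y ∧ y ∉ A} (fun x => if x = v then 1 else -τ x) := by
  have e1 : ∀ x, x ≠ v → ((Equiv.swap (Sum.inl v) (Sum.inr true)).trans φ) (Sum.inl x) =
      φ (Sum.inl x) := by
    intro x hx
    rw [Equiv.trans_apply, Equiv.swap_apply_of_ne_of_ne (by simpa using hx) (by simp)]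
  have e2 : ((Equiv.swap (Sum.inl v) (Sum.inr true)).trans φ) (Sum.inl v) =
      φ (Sum.inr true) := by rw [Equiv.trans_apply, Equiv.swap_apply_left]
  have e3 : ((Equiv.swap (Sum.inl v) (Sum.inr true)).trans φ) (Sum.inr true) =
      φ (Sum.inl v) := by rw [Equiv.trans_apply, Equiv.swap_apply_right]
  have e4 : ((Equiv.swap (Sum.inl v) (Sum.inr true)).trans φ) (Sum.inr false) =
      φ (Sum.inr false) := by
    rw [Equiv.trans_apply, Equiv.swap_apply_of_ne_of_ne (by simp) (by simp)]
  have hv := h.notMem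
  have hloop : ¬Γ.graph.Adj v v := fun hh => hh.ne rfl
  refine ⟨fun y hy => hy.1, fun x y => ?_, fun x => ?_, fun x => ?_, ?_, ?_, ?_, fun x hx => ?_,
    by simp, fun y hy => ?_, fun x y hxy hx hy => ?_⟩
  · by_cases hx : x = v
    · by_cases hy : y = v
      · subst hx; subst hy
        simp
      · subst hx
        rw [e2, e1 y hy, SimpleGraph.adj_comm, h.adj_inl_true]
        have := h.adj_of_mem y
        simp only [Set.mem_ofPred_eq]
        tauto
    · by_cases hy : y = v
      · subst hy
        rw [e2, e1 x hx, h.adj_inl_true]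
        have := h.adj_of_mem x
        simp only [Set.mem_ofPred_eq, SimpleGraph.adj_comm Γ.graph x]
        tauto
      · rw [e1 x hx, e1 y hy, h.adj_inl_inl]
        tauto
  · rw [e4]
    by_cases hx : x = v
    · subst hx
      rw [e2]
      simpa using h.adj_false_true.symm
    · rw [e1 x hx, h.adj_inl_false]
  · rw [e3]
    by_cases hx : x = v
    · subst hx
      rw [e2, SimpleGraph.adj_comm, h.adj_inl_true]
      simp [hv]
    · rw [e1 x hx, SimpleGraph.adj_comm, h.adj_inl_inl]
      simp only [Set.mem_ofPred_eq]
      tauto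
  · rw [e4, e3]
    exact ((h.adj_inl_false v).2 rfl).symm
  · rw [e4, h.weight_false]
  · rw [e2, e3, add_comm, h.weight_self]
  · rw [e1 x hx, h.weight_of_ne x hx]
  · have hyv : y ≠ v := by rintro rfl; exact hloop hy.1
    rw [if_neg hyv, ← h.sign_eq v y hy.1 (by simp [hy.2]) (by simp [hyv]), h.sign_self]
  · simp only [Set.mem_ofPred_eq, not_and, not_not] at hx hy
    by_cases hxv : x = v
    · subst hxv
      have hyA := hx rfl hxy
      have hyv : y ≠ x := by rintro rfl; exact hv hyA
      rw [if_pos rfl, if_neg hyv, h.sign_of_mem y hyA, neg_neg]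
    · by_cases hyv : y = v
      · subst hyv
        have hxA := hy rfl hxy.symm
        rw [if_pos rfl, if_neg hxv, h.sign_of_mem x hxA, neg_neg]
      · rw [if_neg hxv, if_neg hyv, h.sign_eq x y hxy (by simp [hxv]) (by simp [hyv])]

theorem deg_false (h : VertexSplit Γ Γ' φ v A τ) : Γ'.deg (φ (Sum.inr false)) = 2 := by
  classical
  rw [deg_eq_sum, ← φ.sum_comp, Fintype.sum_sum_type, Fintype.sum_bool]
  simp [SimpleGraph.adj_comm _ (φ (Sum.inr false)), h.adj_inl_false, h.adj_false_true.symm]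

open Classical in
theorem deg_true (h : VertexSplit Γ Γ' φ v A τ) :
    Γ'.deg (φ (Sum.inr true)) = (∑ y, if y ∈ A then 1 else 0) + 1 := by
  classical
  rw [deg_eq_sum, ← φ.sum_comp, Fintype.sum_sum_type, Fintype.sum_bool]
  simp [SimpleGraph.adj_comm _ (φ (Sum.inr true)), h.adj_inl_true, h.adj_false_true]

open Classical in
theorem deg_self (h : VertexSplit Γ Γ' φ v A τ) :
    Γ'.deg (φ (Sum.inl v)) = (∑ y, if Γ.graph.Adj v y ∧ y ∉ A then 1 else 0) + 1 := by
  classical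
  rw [deg_eq_sum, ← φ.sum_comp, Fintype.sum_sum_type, Fintype.sum_bool]
  have := h.notMem
  simp [h.adj_inl_true, h.adj_inl_false, h.adj_inl_inl, this]

theorem deg_add_deg (h : VertexSplit Γ Γ' φ v A τ) :
    Γ'.deg (φ (Sum.inl v)) + Γ'.deg (φ (Sum.inr true)) = Γ.deg v + 2 := by
  classical
  rw [h.deg_self, h.deg_true, deg_eq_sum, add_add_add_comm, ← Finset.sum_add_distrib]
  congr 1
  refine Finset.sum_congr rfl fun y _ => ?_
  have := h.adj_of_mem y
  by_cases h1 : y ∈ A <;> by_cases h2 : Γ.graph.Adj v y <;> simp [h1, h2] <;> tauto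

theorem deg_of_ne (h : VertexSplit Γ Γ' φ v A τ) {x : V} (hx : x ≠ v) :
    Γ'.deg (φ (Sum.inl x)) = Γ.deg x := by
  classical
  rw [deg_eq_sum, deg_eq_sum, ← φ.sum_comp, Fintype.sum_sum_type, Fintype.sum_bool]
  simp only [h.adj_inl_true, h.adj_inl_false, h.adj_inl_inl, hx, if_false, add_zero, false_and,
    not_false_eq_true, true_and]
  have h1 : ∀ y, (if Γ.graph.Adj x y then 1 else 0) =
      (if Γ.graph.Adj x y ∧ ¬(y = v ∧ x ∈ A) then 1 else 0) +
        if y = v then (if x ∈ A then 1 else 0) else 0 := by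
    intro y
    by_cases hy : y = v
    · subst hy
      have := fun hA => (h.adj_of_mem x hA).symm
      by_cases h1 : x ∈ A <;> by_cases h2 : Γ.graph.Adj x y <;> simp [h1, h2]
      exact h2 (this h1)
    · simp [hy]
  rw [Finset.sum_congr rfl fun y _ => h1 y, Finset.sum_add_distrib, Finset.sum_ite_eq']
  simp

end VertexSplit
end VertexSplit
end Plumbing

/-- The chain `m, 0` has value `∞` like the empty one, and one positive eigenvalue. -/
theorem chainRel_nil_zero (m : ℤ) : ChainRel (-1) 0 [] [m, 0] := by
  have h1 : contFrac [0] = ((0 : ℚ) : OnePoint ℚ) := by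
    rw [contFrac_cons, contFrac, subInv_infty]
    simp
  have h2 : contFrac [m, 0] = OnePoint.infty := by rw [contFrac_cons, h1, subInv_zero]
  refine ⟨fun m' => ?_, ?_⟩
  · rw [h2, add_zero]
    rfl
  · rw [chainPos_cons, chainPos_cons, h1, h2, posIndicator_infty, posIndicator_coe]
    simp [chainPos]

namespace Plumbing

section VertexSplit

variable {V V' : Type u} [Fintype V] [DecidableEq V] [Fintype V'] [DecidableEq V']

namespace VertexSplit

variable {Γ : Plumbing V} {Γ' : Plumbing V'} {φ : V ⊕ Bool ≃ V'} {v : V} {A : Set V} {τ : V → ℤˣ}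

theorem injective_inl (φ : V ⊕ Bool ≃ V') : Function.Injective fun x => φ (Sum.inl x) :=
  φ.injective.comp Sum.inl_injective

/-! #### One edge is moved -/

/-- Moving one edge amounts to inserting the chain `0, m₂` into it. Read from the far side, the
chain is `m₂, 0` followed by the diminished weight of `v`, which again collapses to the original
weight. -/
theorem edgeMove {y : V} (h : VertexSplit Γ Γ' φ v {y} τ) :
    EdgeMove Γ Γ' (fun x => φ (Sum.inl x)) [φ (Sum.inr false), φ (Sum.inr true)] v y τ (-1)
      (-Γ'.weight (φ (Sum.inr true))) 0 := by
  classical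
  have hvy : Γ.graph.Adj v y := h.adj_of_mem y rfl
  have hyv : y ≠ v := hvy.ne'
  have hw := h.weight_self
  refine ⟨injective_inl φ, fun x => by simp, fun z => ?_, fun {x z} hxz hne => ?_, hvy, ⟨?_, ?_⟩,
    fun x => ?_, fun z hz => ?_, fun x hx hx' => h.weight_of_ne x hx, by linarith,
    by rw [h.weight_of_ne y hyv, add_zero], fun l => ?_, ?_, fun l => ?_, ?_, ?_,
    fun {x z} hxz hne => ?_⟩
  · obtain ⟨w, rfl⟩ := φ.surjective z
    rcases w with x | _ | _
    · exact Or.inl ⟨x, rfl⟩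
    · simp
    · simp
  · rw [h.adj_inl_inl]
    refine ⟨hxz, ?_, ?_⟩
    · rintro ⟨rfl, rfl⟩
      exact hne rfl
    · rintro ⟨rfl, rfl⟩
      exact hne Sym2.eq_swap
  · simp only [List.cons_append, List.nil_append, List.isChain_cons_cons, List.IsChain.singleton,
      and_true]
    exact ⟨(h.adj_inl_false v).2 rfl, h.adj_false_true, ((h.adj_inl_true y).2 rfl).symm⟩
  · simp [hyv.symm]
  · by_cases hx : x = v
    · subst hx
      have h1 := h.deg_add_deg
      have h2 := h.deg_true
      simp only [Set.mem_singleton_iff, Finset.sum_ite_eq', Finset.mem_univ, if_true] at h2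
      rw [h2] at h1
      omega
    · exact h.deg_of_ne hx
  · simp only [List.mem_cons, List.not_mem_nil, or_false] at hz
    rcases hz with rfl | rfl
    · exact h.deg_false
    · rw [h.deg_true]
      simp
  · simp only [List.map_cons, List.map_nil, h.weight_false, List.cons_append, List.nil_append,
      add_zero]
    exact chainRel_zero _ _
  · simp only [List.map_cons, List.map_nil, h.weight_false]
    exact chainRel_zero _ _
  · have h1 := (chainRel_zero (Γ'.weight (φ (Sum.inl v))) l).cons (Γ.weight v)
    have h2 : Γ.weight v + -Γ'.weight (φ (Sum.inl v)) = Γ'.weight (φ (Sum.inr true)) := by linarith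
    have h3 : Γ.weight v + -Γ'.weight (φ (Sum.inr true)) = Γ'.weight (φ (Sum.inl v)) := by linarith
    rw [h2] at h1
    simpa [h.weight_false, h3] using h1
  · simpa [h.weight_false] using chainRel_nil_zero (Γ'.weight (φ (Sum.inr true)))
  · rw [h.sign_self, h.sign_of_mem y rfl, one_mul]
  · refine h.sign_eq x z hxz ?_ ?_
    · rintro ⟨rfl, rfl⟩
      exact hne rfl
    · rintro ⟨rfl, rfl⟩
      exact hne Sym2.eq_swap

/-! #### No edge is moved -/

theorem pendantMove (h : VertexSplit Γ Γ' φ v ∅ τ) :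
    PendantMove Γ Γ' (fun x => φ (Sum.inl x)) v [φ (Sum.inr false)] (φ (Sum.inr true)) (-1)
      (-Γ'.weight (φ (Sum.inr true))) := by
  classical
  have hw := h.weight_self
  have hdt : Γ'.deg (φ (Sum.inr true)) = 1 := by
    rw [h.deg_true]
    simp
  refine ⟨injective_inl φ, fun x => by simp, fun z => ?_, fun {x z} hxz => ?_, ⟨?_, ?_⟩,
    fun x hx => h.deg_of_ne hx, ?_, fun z hz => ?_, hdt, fun x hx => h.weight_of_ne x hx,
    by linarith, ?_⟩
  · obtain ⟨w, rfl⟩ := φ.surjective z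
    rcases w with x | _ | _
    · exact Or.inl ⟨x, rfl⟩
    · simp
    · simp
  · rw [h.adj_inl_inl]
    simpa using hxz
  · simp only [List.cons_append, List.nil_append, List.isChain_cons_cons, List.IsChain.singleton,
      and_true]
    exact ⟨(h.adj_inl_false v).2 rfl, h.adj_false_true⟩
  · simp
  · have := h.deg_add_deg
    omega
  · rw [List.mem_singleton.1 hz, h.deg_false]
  · simp only [List.map_cons, List.map_nil, h.weight_false, List.cons_append, List.nil_append]
    exact chainRel_zero _ _

theorem sign_eq_one (h : VertexSplit Γ Γ' φ v ∅ τ) (x : V) : τ x = 1 := by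
  rw [← h.sign_self]
  obtain ⟨p⟩ := Γ.isTree.1.preconnected x v
  induction p with
  | nil => rfl
  | cons hadj _ ih =>
    rw [h.sign_eq _ _ hadj (by simp) (by simp)]
    exact ih h

/-! #### The reduction of the linking matrix -/

/-- The vertex of `Γ` from which a vertex of `Γ'` originates. -/
def origin (φ : V ⊕ Bool ≃ V') (v : V) (y : V') : V := Sum.elim id (fun _ => v) (φ.symm y)

/-- The signs of the vertices of `Γ'`. -/
def sign (φ : V ⊕ Bool ≃ V') (τ : V → ℤˣ) (y : V') : ℤˣ :=
  Sum.elim τ (fun i => if i then -1 else 1) (φ.symm y)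

open Classical in
/-- The linking numbers between the old and the new vertices. -/
def mixedBlock (v : V) (A : Set V) : Matrix V Bool ℤ :=
  Matrix.of fun x i => if i then (if x ∈ A then 1 else 0) else if x = v then 1 else 0

/-- The linking matrix of the new vertices. -/
def newBlock (m : ℤ) : Matrix Bool Bool ℤ :=
  Matrix.of fun i j => if i then (if j then m else 1) else if j then 1 else 0

/-- The inverse of the linking matrix of the new vertices. -/
def newBlockInv (m : ℤ) : Matrix Bool Bool ℤ :=
  Matrix.of fun i j => if i then (if j then 0 else 1) else if j then 1 else -m

theorem newBlock_isSymm (m : ℤ) : (newBlock m).IsSymm := by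
  ext i j
  cases i <;> cases j <;> rfl

theorem eigenCount_newBlock (m : ℤ) :
    posEigenCount (newBlock m) = 1 ∧ negEigenCount (newBlock m) = 1 := by
  obtain ⟨h1, h2⟩ := hasPosIndex_realForm (newBlock_isSymm m)
  have htop : Submodule.span ℝ {(Pi.single true 1 : Bool → ℝ), Pi.single false 1} = ⊤ := by
    rw [eq_top_iff]
    intro x _
    rw [Submodule.mem_span_pair]
    refine ⟨x true, x false, ?_⟩
    funext i
    cases i <;> simp
  have hn : realForm (newBlock m) (Pi.single false 1) (Pi.single false 1) = 0 := by
    rw [realForm_single]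
    simp [newBlock]
  have hx : realForm (newBlock m) (Pi.single true 1) (Pi.single false 1) = 1 := by
    rw [realForm_single]
    simp [newBlock]
  have hs := realForm_symm (newBlock_isSymm m)
  have h3 := hasPosIndex_hyperbolic hs hn (by rw [hx]; exact one_ne_zero)
  have h4 := hasPosIndex_hyperbolic (B := -realForm (newBlock m))
    (fun x y => by rw [LinearMap.neg_apply, LinearMap.neg_apply, LinearMap.neg_apply,
      LinearMap.neg_apply, hs])
    (x := Pi.single true 1) (n := Pi.single false 1)
    (by rw [LinearMap.neg_apply, LinearMap.neg_apply, hn, neg_zero])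
    (by rw [LinearMap.neg_apply, LinearMap.neg_apply, hx]; norm_num)
  rw [htop] at h3 h4
  exact ⟨h1.unique h3, h2.unique h4⟩

/-- The term `G Q' Gᵀ` restores the weight of `v` on the diagonal and adds `1` between `v` and `A`.
These are the removed edges, whose sign-twisted entry is `-1`, so the sum is `0` as required. -/
theorem blockReduction (h : VertexSplit Γ Γ' φ v A τ) :
    BlockReduction Γ.linkingMatrix Γ'.linkingMatrix φ τ (mixedBlock v A)
      (newBlock (Γ'.weight (φ (Sum.inr true)))) (newBlockInv (Γ'.weight (φ (Sum.inr true)))) := by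
  classical
  set m := Γ'.weight (φ (Sum.inr true)) with hm
  have hv := h.notMem
  have hG : ∀ x y, (mixedBlock v A * newBlockInv m * (mixedBlock v A).transpose) x y =
      (if x ∈ A then 1 else 0) * (if y = v then 1 else 0) +
      (if x = v then 1 else 0) * (if y ∈ A then 1 else 0) -
      m * (if x = v then 1 else 0) * (if y = v then 1 else 0) := by
    intro x y
    simp only [Matrix.mul_apply, Fintype.sum_bool, mixedBlock, newBlockInv, Matrix.of_apply,
      Matrix.transpose_apply, if_true, Bool.false_eq_true, if_false]
    ring
  have hinr : ∀ x j, Γ'.linkingMatrix (φ (Sum.inl x)) (φ (Sum.inr j)) = mixedBlock v A x j := by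
    intro x j
    rw [linkingMatrix_of_ne (by simp)]
    cases j <;> simp [mixedBlock, h.adj_inl_false, h.adj_inl_true]
  refine ⟨newBlock_isSymm m, ?_, fun x y => ?_, hinr, fun x j => ?_, fun i j => ?_⟩
  · ext i j
    rw [Matrix.mul_apply, Fintype.sum_bool]
    cases i <;> cases j <;> simp [newBlock, newBlockInv]
  · rw [hG]
    by_cases hxy : x = y
    · subst hxy
      rw [linkingMatrix_self, linkingMatrix_self, ← Units.val_mul, Int.units_mul_self,
        Units.val_one, one_mul]
      by_cases hx : x = v
      · subst hx
        simp only [hv, if_false, if_true]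
        have := h.weight_self
        linarith
      · simp [hx, h.weight_of_ne x hx]
    · rw [linkingMatrix_of_ne (by simpa using hxy), linkingMatrix_of_ne hxy, h.adj_inl_inl]
      have key : ∀ x y, x ≠ v → y ≠ v → Γ.graph.Adj x y → (τ x : ℤ) * τ y = 1 := by
        intro x y hx hy hadj
        rw [h.sign_eq x y hadj (by simp [hx]) (by simp [hy]), ← Units.val_mul, Int.units_mul_self,
          Units.val_one]
      have key' : ∀ y, Γ.graph.Adj v y → y ∉ A → τ y = 1 := by
        intro y hadj hy
        rw [← h.sign_self]
        exact (h.sign_eq v y hadj (by simp [hy]) (by simp [hv])).symm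
      by_cases hx : x = v
      · subst hx
        have hy : y ≠ x := fun h' => hxy h'.symm
        by_cases hyA : y ∈ A
        · simp [hyA, hv, hy, h.adj_of_mem y hyA, h.sign_self, h.sign_of_mem y hyA]
        · by_cases hadj : Γ.graph.Adj x y
          · simp [hyA, hv, hy, hadj, h.sign_self, key' y hadj hyA]
          · simp [hyA, hv, hy, hadj]
      · by_cases hy : y = v
        · subst hy
          by_cases hxA : x ∈ A
          · simp [hxA, hv, hx, (h.adj_of_mem x hxA).symm, h.sign_self, h.sign_of_mem x hxA]
          · by_cases hadj : Γ.graph.Adj x y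
            · simp [hxA, hv, hx, hadj, h.sign_self, key' x hadj.symm hxA]
            · simp [hxA, hv, hx, hadj]
        · by_cases hadj : Γ.graph.Adj x y
          · simp [hx, hy, hadj, key x y hx hy hadj]
          · simp [hx, hy, hadj]
  · rw [← hinr, ← linkingMatrix_isSymm.apply]
  · cases i <;> cases j
    · rw [linkingMatrix_self, h.weight_false]
      rfl
    · rw [linkingMatrix_of_adj h.adj_false_true]
      rfl
    · rw [linkingMatrix_of_adj h.adj_false_true.symm]
      rfl
    · rw [linkingMatrix_self]
      rfl

theorem reduce_eq (m : ℤ) (e : V' → ℤ) (h0 : e (φ (Sum.inr false)) = 0) (x : V) :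
    BlockReduction.reduce φ τ (mixedBlock v A) (newBlockInv m) e x =
      τ x * (e (φ (Sum.inl x)) - if x = v then e (φ (Sum.inr true)) else 0) := by
  classical
  simp only [BlockReduction.reduce, Matrix.mulVec, dotProduct, Fintype.sum_bool,
    Matrix.map_apply, Matrix.mul_apply, mixedBlock, newBlockInv, Matrix.of_apply, h0]
  split_ifs <;> simp_all

theorem expHom_eq (h : VertexSplit Γ Γ' φ v A τ) (m : ℤ) (e : V' → ℤ)
    (h0 : e (φ (Sum.inr false)) = 0) : expHom (origin φ v) (sign φ τ) e =
      BlockReduction.reduce φ τ (mixedBlock v A) (newBlockInv m) e := by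
  funext x
  rw [reduce_eq m e h0, expHom_apply, ← φ.sum_comp, Fintype.sum_sum_type, Fintype.sum_bool]
  simp only [origin, sign, Equiv.symm_apply_apply, Sum.elim_inl, Sum.elim_inr, id, h0,
    Finset.sum_ite_eq', Finset.mem_univ, if_true]
  by_cases hx : x = v
  · subst hx
    simp [h.sign_self, sub_eq_add_neg]
  · simp [hx, Ne.symm hx]

/-- Nothing is left over: admissible exponents vanish at the middle vertex, which kills the
`Q'`-term, the hyperbolic block has signature zero, and the total weight is unchanged. -/
theorem thetaReduction (h : VertexSplit Γ Γ' φ v A τ) (hdet : Γ.linkingMatrix.det ≠ 0)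
    {a : V → ℤ} {a' b : V' → ℤ} (ha' : ∀ v, (2 : ℤ) ∣ a' v - Γ'.deg v) (hba' : Γ'.SpincEquiv b a')
    (hb₀ : b (φ (Sum.inr false)) = 0) (hb₁ : b (φ (Sum.inl v)) - b (φ (Sum.inr true)) = a v)
    (hb₂ : ∀ x, x ≠ v → b (φ (Sum.inl x)) = τ x * a x) :
    ThetaReduction Γ Γ' a a' (origin φ v) (sign φ τ) := by
  have hadm : ∀ e, Γ'.Admissible e → e (φ (Sum.inr false)) = 0 := fun e he =>
    (he (φ (Sum.inr false))).2.1 h.deg_false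
  refine h.blockReduction.thetaReduction hdet ha' hba' ?_
    (fun e he => h.expHom_eq _ e (hadm e he)) (fun e he => ?_) ?_
  · funext x
    rw [reduce_eq _ b hb₀]
    by_cases hx : x = v
    · subst hx
      rw [if_pos rfl, hb₁, h.sign_self]
      simp
    · rw [if_neg hx, hb₂ x hx, sub_zero, ← mul_assoc, ← Units.val_mul, Int.units_mul_self,
        Units.val_one, one_mul]
  · obtain ⟨h1, h2⟩ := eigenCount_newBlock (Γ'.weight (φ (Sum.inr true)))
    have hsum : ∑ y, Γ'.weight y = ∑ x, Γ.weight x := by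
      rw [← φ.sum_comp, Fintype.sum_sum_type, Fintype.sum_bool, h.weight_false,
        ← Finset.add_sum_erase Finset.univ _ (Finset.mem_univ v),
        ← Finset.add_sum_erase Finset.univ Γ.weight (Finset.mem_univ v),
        Finset.sum_congr rfl fun x hx => h.weight_of_ne x (Finset.ne_of_mem_erase hx),
        ← h.weight_self]
      ring
    rw [matrixSignature, h1, h2, hsum]
    simp [dotProduct, Matrix.mulVec, newBlockInv, hadm e he]
  · rw [(eigenCount_newBlock _).1, prod_pow_deg (sign φ τ) h.adj_false_true]
    · simp [sign]
    · intro y z hyz hne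
      obtain ⟨y, rfl⟩ := φ.surjective y
      obtain ⟨z, rfl⟩ := φ.surjective z
      simp only [sign, Equiv.symm_apply_apply]
      have e1 : ∀ (x : V) (i : Bool), Γ'.graph.Adj (φ (Sum.inl x)) (φ (Sum.inr i)) →
          τ x = if i then -1 else 1 := by
        intro x i hx
        cases i
        · rw [(h.adj_inl_false x).1 hx, h.sign_self]
          simp
        · rw [h.sign_of_mem x ((h.adj_inl_true x).1 hx)]
          simp
      rcases y with x | i <;> rcases z with x' | i'
      · obtain ⟨h1, h2, h3⟩ := (h.adj_inl_inl x x').1 hyz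
        exact h.sign_eq x x' h1 h2 h3
      · exact e1 x i' hyz
      · exact (e1 x' i hyz.symm).symm
      · cases i <;> cases i'
        · exact absurd rfl hyz.ne
        · exact absurd rfl hne
        · exact absurd Sym2.eq_swap hne
        · exact absurd rfl hyz.ne

end VertexSplit
end VertexSplit
end Plumbing

namespace Plumbing

section VertexSplit

variable {V V' : Type u} [Fintype V] [DecidableEq V] [Fintype V'] [DecidableEq V']

namespace VertexSplit

variable {Γ : Plumbing V} {Γ' : Plumbing V'} {φ : V ⊕ Bool ≃ V'} {v : V} {A : Set V} {τ : V → ℤˣ}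

/-! #### At least two edges at both ends -/

theorem eq_or_eq_of_isHigh (h2 : Γ'.highCount ≤ 2)
    (h₁ : Γ'.IsHigh (φ (Sum.inl v))) (h₂ : Γ'.IsHigh (φ (Sum.inr true))) {y : V'}
    (hy : Γ'.IsHigh y) : y = φ (Sum.inl v) ∨ y = φ (Sum.inr true) := by
  classical
  by_contra hne
  push Not at hne
  have h3 : ({⟨y, hy⟩, ⟨_, h₁⟩, ⟨_, h₂⟩} : Finset Γ'.High).card = 3 :=
    Finset.card_eq_three.2 ⟨_, _, _, by simpa using hne.1, by simpa using hne.2, by simp, rfl⟩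
  have h4 : ({⟨y, hy⟩, ⟨_, h₁⟩, ⟨_, h₂⟩} : Finset Γ'.High).card ≤ Fintype.card Γ'.High :=
    Finset.card_le_univ _
  rw [highCount] at h2
  omega

/-- If both ends are high they exhaust the bound of two, so `v` is the only high vertex of `Γ`. -/
theorem eq_of_isHigh (h : VertexSplit Γ Γ' φ v A τ) (h2 : Γ'.highCount ≤ 2)
    (h₁ : Γ'.IsHigh (φ (Sum.inl v))) (h₂ : Γ'.IsHigh (φ (Sum.inr true))) {x : V}
    (hx : Γ.IsHigh x) : x = v := by
  by_contra hne
  have hx' : Γ'.IsHigh (φ (Sum.inl x)) := by rwa [IsHigh, h.deg_of_ne hne]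
  rcases eq_or_eq_of_isHigh h2 h₁ h₂ hx' with h3 | h3
  · exact hne (by simpa using h3)
  · simp at h3

theorem arc_middle (h : VertexSplit Γ Γ' φ v A τ) :
    Γ'.Arc (φ (Sum.inl v)) [φ (Sum.inr false)] (φ (Sum.inr true)) := by
  refine ⟨⟨?_, by simp⟩, fun x hx => ?_⟩
  · simp only [List.cons_append, List.nil_append, List.isChain_cons_cons, List.IsChain.singleton,
      and_true]
    exact ⟨(h.adj_inl_false v).2 rfl, h.adj_false_true⟩
  · rw [List.mem_singleton.1 hx, h.deg_false]

/-- The ends are joined by a pseudo bridge of the single weight `0`, with no positive eigenvalue, so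
their signs must be opposite. -/
theorem mem_chambers_iff (h : VertexSplit Γ Γ' φ v A τ) (h2 : Γ'.highCount ≤ 2)
    (h₁ : Γ'.IsHigh (φ (Sum.inl v))) (h₂ : Γ'.IsHigh (φ (Sum.inr true))) (ξ : Γ'.High → ℤˣ) :
    ξ ∈ Γ'.chambers ↔ ξ ⟨_, h₂⟩ = -ξ ⟨_, h₁⟩ := by
  have hm := h.arc_middle
  have hc : contFrac ([φ (Sum.inr false)].map Γ'.weight) = ((0 : ℚ) : OnePoint ℚ) := by
    rw [List.map_cons, List.map_nil, h.weight_false, contFrac_cons, contFrac, subInv_infty]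
    simp
  have hp : chainPos ([φ (Sum.inr false)].map Γ'.weight) = 0 := by
    rw [List.map_cons, List.map_nil, chainPos_cons, ← List.map_nil (f := Γ'.weight),
      ← List.map_cons, hc, posIndicator_coe]
    simp [chainPos]
  have hiff : ξ ⟨_, h₁⟩ * ξ ⟨_, h₂⟩ = -1 ↔ ξ ⟨_, h₂⟩ = -ξ ⟨_, h₁⟩ := by
    rcases Int.units_eq_one_or (ξ ⟨_, h₁⟩) with h3 | h3 <;>
      rcases Int.units_eq_one_or (ξ ⟨_, h₂⟩) with h4 | h4 <;> rw [h3, h4] <;> decide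
  rw [mem_chambers, ← hiff]
  constructor
  · intro hξ
    have := hξ ⟨_, h₁⟩ ⟨_, h₂⟩ _ hm hc
    rwa [hp, zero_add, pow_one] at this
  · intro hξ w₁ w₂ i hi _
    rcases eq_or_eq_of_isHigh h2 h₁ h₂ w₁.2 with e1 | e1 <;>
      rcases eq_or_eq_of_isHigh h2 h₁ h₂ w₂.2 with e2 | e2
    · exact absurd (e1.trans e2.symm) hi.ne
    · obtain rfl : w₁ = ⟨_, h₁⟩ := Subtype.ext e1
      obtain rfl : w₂ = ⟨_, h₂⟩ := Subtype.ext e2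
      rw [hi.ext hm, hp, hξ, zero_add, pow_one]
    · obtain rfl : w₁ = ⟨_, h₂⟩ := Subtype.ext e1
      obtain rfl : w₂ = ⟨_, h₁⟩ := Subtype.ext e2
      rw [hi.ext hm.reverse, hm.chainPos_reverse, hp, mul_comm, hξ, zero_add, pow_one]
    · exact absurd (e1.trans e2.symm) hi.ne

theorem exists_arc (h : VertexSplit Γ Γ' φ v A τ) {x : V} {i : List V} (hi : Γ.Arc v i x) :
    ∃ (y : V') (t : ℤˣ), (y = φ (Sum.inl v) ∧ t = 1 ∨
      y = φ (Sum.inr true) ∧ t = -1) ∧ τ x = t ∧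
      Γ'.Arc y (i.map fun z => φ (Sum.inl z)) (φ (Sum.inl x)) := by
  have hvi : v ∉ i ++ [x] := (List.nodup_cons.1 hi.1.2).1
  obtain ⟨b, l, hbl⟩ : ∃ b l, i ++ [x] = b :: l := by
    cases i with
    | nil => exact ⟨x, [], rfl⟩
    | cons b t => exact ⟨b, t ++ [x], rfl⟩
  have hpath : Γ.IsPathList (b :: l) := hbl ▸ hi.1.of_cons
  have hvb : Γ.graph.Adj v b := by
    have := hi.1
    rw [hbl] at this
    exact this.adj_head
  have hvl : v ∉ b :: l := hbl ▸ hvi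
  have hstep : ∀ l₁ l₂ y z, b :: l = l₁ ++ y :: z :: l₂ → Γ.graph.Adj y z ∧ y ≠ v ∧ z ≠ v := by
    intro l₁ l₂ y z he
    refine ⟨List.isChain_iff_forall_rel_of_append_cons_cons.1 hpath.1 he, ?_, ?_⟩ <;>
    · rintro rfl
      exact hvl (he ▸ by simp)
  have hmap : Γ'.IsPathList ((b :: l).map fun z => φ (Sum.inl z)) := by
    refine hpath.map (injective_inl φ) fun l₁ l₂ y z he => ?_
    obtain ⟨h1, h2, h3⟩ := hstep l₁ l₂ y z he
    rw [h.adj_inl_inl]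
    exact ⟨h1, by simp [h2], by simp [h3]⟩
  have hτ : τ b = τ x := by
    have hc : (b :: l).IsChain fun y z => τ y = τ z :=
      List.isChain_iff_forall_rel_of_append_cons_cons.2 fun {y z l₁ l₂} he => by
        obtain ⟨h1, h2, h3⟩ := hstep l₁ l₂ y z he
        exact h.sign_eq y z h1 (by simp [h2]) (by simp [h3])
    have : IsTrans V fun x y => τ x = τ y := ⟨fun _ _ _ h1 h2 => h1.trans h2⟩
    have hxm : x ∈ b :: l := hbl ▸ by simp
    rcases List.mem_cons.1 hxm with rfl | hxm
    · rfl
    · exact (List.pairwise_cons.1 (List.isChain_iff_pairwise.1 hc)).1 x hxm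
  have hdeg : ∀ y ∈ i.map (fun z => φ (Sum.inl z)), Γ'.deg y = 2 := by
    intro y hy
    obtain ⟨z, hz, rfl⟩ := List.mem_map.1 hy
    rw [h.deg_of_ne (by rintro rfl; exact hvi (by simp [hz]))]
    exact hi.2 z hz
  have hend : ∀ y, Γ'.graph.Adj y (φ (Sum.inl b)) → y ∉ (b :: l).map (fun z => φ (Sum.inl z)) →
      Γ'.Arc y (i.map fun z => φ (Sum.inl z)) (φ (Sum.inl x)) := by
    intro y hy hy'
    have e1 : i.map (fun z => φ (Sum.inl z)) ++ [φ (Sum.inl x)] =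
        (b :: l).map fun z => φ (Sum.inl z) := by
      rw [← hbl]
      simp
    refine ⟨⟨?_, ?_⟩, hdeg⟩
    · rw [e1, List.map_cons, List.isChain_cons_cons]
      exact ⟨hy, hmap.1⟩
    · rw [e1, List.nodup_cons]
      exact ⟨hy', hmap.2⟩
  by_cases hb : b ∈ A
  · refine ⟨_, -1, Or.inr ⟨rfl, rfl⟩, by rw [← hτ, h.sign_of_mem b hb], hend _ ?_ ?_⟩
    · exact ((h.adj_inl_true b).2 hb).symm
    · intro hm
      obtain ⟨z, -, hz⟩ := List.mem_map.1 hm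
      simp at hz
  · refine ⟨_, 1, Or.inl ⟨rfl, rfl⟩, ?_, hend _ ?_ ?_⟩
    · rw [← hτ, ← h.sign_self]
      exact (h.sign_eq v b hvb (by simp [hb]) (by simp [h.notMem])).symm
    · rw [h.adj_inl_inl]
      exact ⟨hvb, by simp [hb], by simp [h.notMem]⟩
    · intro hm
      obtain ⟨z, hz, hz'⟩ := List.mem_map.1 hm
      have : z = v := by simpa using hz'
      exact hvl (this ▸ hz)

theorem leafExp_eq (h : VertexSplit Γ Γ' φ v A τ) (h2 : Γ'.highCount ≤ 2)
    (h₁ : Γ'.IsHigh (φ (Sum.inl v))) (h₂ : Γ'.IsHigh (φ (Sum.inr true))) (hv : Γ.IsHigh v)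
    {ξ : Γ'.High → ℤˣ} (hξ : ξ ⟨_, h₂⟩ = -ξ ⟨_, h₁⟩) {x : V} (hx : Γ.deg x = 1) :
    (τ x : ℤ) * Γ'.leafExp ξ (φ (Sum.inl x)) = Γ.leafExp (fun _ => ξ ⟨_, h₁⟩) x := by
  have hxv : x ≠ v := by
    rintro rfl
    rw [IsHigh] at hv
    omega
  obtain ⟨w, hw⟩ := exists_isBranch hx hv
  obtain ⟨hwh, -, i, hi⟩ := isBranch_iff.1 hw
  obtain rfl := h.eq_of_isHigh h2 h₁ h₂ hwh
  have hwi : w ∉ i ++ [x] := (List.nodup_cons.1 hi.1.2).1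
  have hweight : (i.map (fun z => φ (Sum.inl z)) ++ [φ (Sum.inl x)]).map Γ'.weight =
      (i ++ [x]).map Γ.weight := by
    have e1 : i.map (fun z => φ (Sum.inl z)) ++ [φ (Sum.inl x)] =
        (i ++ [x]).map fun z => φ (Sum.inl z) := by simp
    rw [e1, List.map_map]
    refine List.map_congr_left fun z hz => ?_
    exact h.weight_of_ne z (by rintro rfl; exact hwi hz)
  have hd : Γ'.deg (φ (Sum.inl x)) = 1 := by rw [h.deg_of_ne hxv, hx]
  obtain ⟨y, t, hyt, hτ, harc⟩ := h.exists_arc hi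
  rw [leafExp_of_arc _ hi hwh hx, hτ]
  rcases hyt with ⟨rfl, rfl⟩ | ⟨rfl, rfl⟩
  · rw [leafExp_of_arc ξ harc h₁ hd, hweight, Units.val_one, one_mul]
  · rw [leafExp_of_arc ξ harc h₂ hd, hweight, hξ]
    push_cast
    ring

/-- The substitution inverts the variable of the second end, turning the opposite signs into equal
ones. The two expansions then multiply to the one at `v`, and the signs of the leaves beyond `A` are
adjusted in the same way. -/
theorem zHatCoeff_eq (h : VertexSplit Γ Γ' φ v A τ) (h2 : Γ'.highCount ≤ 2)
    (h₁ : Γ'.IsHigh (φ (Sum.inl v))) (h₂ : Γ'.IsHigh (φ (Sum.inr true))) {a : V → ℤ}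
    {a' : V' → ℤ} (hθ : ThetaReduction Γ Γ' a a' (origin φ v) (sign φ τ)) (n : ℚ) (k : ℤ) :
    Γ'.zHatCoeff a' n k = Γ.zHatCoeff a n k := by
  have hsum := h.deg_add_deg
  have hv : Γ.IsHigh v := by
    rw [IsHigh] at h₁ h₂ ⊢
    omega
  have hsub : ∀ w : Γ.High, w = ⟨v, hv⟩ := fun w => Subtype.ext (h.eq_of_isHigh h2 h₁ h₂ w.2)
  have hmem := h.mem_chambers_iff h2 h₁ h₂
  have hall : ∀ w : Γ'.High, w = ⟨_, h₁⟩ ∨ w = ⟨_, h₂⟩ := fun w =>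
    (eq_or_eq_of_isHigh h2 h₁ h₂ w.2).imp Subtype.ext Subtype.ext
  refine hθ.zHatCoeff_eq_of_bijOn (fun ξ _ => ξ ⟨_, h₁⟩) ⟨?_, ?_, ?_⟩ (fun ξ hξ => ?_) n k
  · intro ξ _
    refine Finset.mem_coe.2 (mem_chambers.2 fun w₁ w₂ i hi _ => ?_)
    exact absurd (congrArg Subtype.val ((hsub w₁).trans (hsub w₂).symm)) hi.ne
  · intro ξ hξ η hη he
    have h3 : ξ ⟨_, h₁⟩ = η ⟨_, h₁⟩ := congrFun he ⟨v, hv⟩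
    funext w
    rcases hall w with rfl | rfl
    · exact h3
    · rw [(hmem ξ).1 hξ, (hmem η).1 hη, h3]
  · intro η _
    classical
    refine ⟨fun w => if w = ⟨_, h₁⟩ then η ⟨v, hv⟩ else -η ⟨v, hv⟩, ?_, ?_⟩
    · refine Finset.mem_coe.2 ((hmem _).2 ?_)
      simp
    · funext w
      simp [hsub w]
  · have hξ' := (hmem ξ).1 hξ
    rw [substDiscriminant, ← φ.prod_comp, Fintype.prod_sum_type, Fintype.prod_bool,
      fullDiscriminant, ← Finset.mul_prod_erase Finset.univ _ (Finset.mem_univ v),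
      ← Finset.mul_prod_erase Finset.univ (fun x => vertexFactor x _ _ _) (Finset.mem_univ v),
      h.deg_false, vertexFactor_two, mul_one, mul_right_comm]
    simp only [origin, sign, Equiv.symm_apply_apply, Sum.elim_inl, Sum.elim_inr, id, if_true]
    have e1 : vertexFactor v (Γ'.deg (φ (Sum.inl v)))
          ((τ v : ℤ) * Γ'.leafExp ξ (φ (Sum.inl v))) (τ v * Γ'.extendSign ξ (φ (Sum.inl v))) *
        vertexFactor v (Γ'.deg (φ (Sum.inr true)))
          (((-1 : ℤˣ) : ℤ) * Γ'.leafExp ξ (φ (Sum.inr true)))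
          (-1 * Γ'.extendSign ξ (φ (Sum.inr true))) =
        vertexFactor v (Γ.deg v) (Γ.leafExp (fun _ => ξ ⟨_, h₁⟩) v)
          (Γ.extendSign (fun _ => ξ ⟨_, h₁⟩) v) := by
      rw [extendSign_of_isHigh _ h₁, extendSign_of_isHigh _ h₂, extendSign_of_isHigh _ hv, hξ',
        h.sign_self, one_mul, neg_one_mul, neg_neg]
      have h3 : Γ.deg v = Γ'.deg (φ (Sum.inl v)) + Γ'.deg (φ (Sum.inr true)) - 2 := by omega
      rw [h3]
      exact vertexFactor_mul_vertexFactor v h₁ h₂ _ _ _ _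
    rw [e1]
    refine congrArg _ (Finset.prod_congr rfl fun x hx => ?_)
    have hxv : x ≠ v := Finset.ne_of_mem_erase hx
    rw [h.deg_of_ne hxv]
    exact vertexFactor_congr (fun hx1 => h.leafExp_eq h2 h₁ h₂ hv hξ' hx1)
      fun hx3 => absurd (h.eq_of_isHigh h2 h₁ h₂ hx3) hxv

/-! #### The general case -/

theorem isRecovered_iff_of_subsingleton (h : VertexSplit Γ Γ' φ v A τ) (hA : A.Subsingleton)
    (hdet : Γ.linkingMatrix.det ≠ 0) (h2 : Γ.highCount ≤ 2) (h2' : Γ'.highCount ≤ 2)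
    {a : V → ℤ} {a' : V' → ℤ} (hθ : ThetaReduction Γ Γ' a a' (origin φ v) (sign φ τ))
    (c : ℚ → ℝ) : Γ.IsRecovered a c ↔ Γ'.IsRecovered a' c := by
  have hκ : ∀ x, origin φ v (φ (Sum.inl x)) = x := fun x => by simp [origin]
  have hτ : ∀ x, sign φ τ (φ (Sum.inl x)) = τ x := fun x => by simp [sign]
  have hκu : origin φ v (φ (Sum.inr true)) = v := by simp [origin]
  have hτu : sign φ τ (φ (Sum.inr true)) = -1 := by simp [sign]
  rcases hA.eq_empty_or_singleton with rfl | ⟨y, rfl⟩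
  · have hτ' : ∀ x, sign φ τ (φ (Sum.inl x)) = 1 := fun x => by rw [hτ, h.sign_eq_one]
    by_cases hv : Γ.deg v = 2
    · exact h.pendantMove.isRecovered_iff hv hdet h2' hθ hκ hτ' hκu hτu c
    · exact isRecovered_congr (h.pendantMove.zHatCoeff_eq hv h2 hθ hκ hτ' hκu hτu) c
  · exact isRecovered_congr (h.edgeMove.zHatCoeff_eq h2 hθ hκ hτ) c

theorem isHigh_true (h : VertexSplit Γ Γ' φ v A τ) (hA : ¬A.Subsingleton) :
    Γ'.IsHigh (φ (Sum.inr true)) := by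
  classical
  rw [Set.not_subsingleton_iff] at hA
  obtain ⟨x, hx, y, hy, hxy⟩ := hA
  rw [IsHigh, h.deg_true, Finset.sum_boole]
  have h1 : 2 ≤ (Finset.univ.filter (fun y => y ∈ A)).card := by
    rw [← Finset.card_pair hxy]
    refine Finset.card_le_card fun z hz => ?_
    simp only [Finset.mem_insert, Finset.mem_singleton] at hz
    rcases hz with rfl | rfl <;> simpa
  simp only [Nat.cast_id]
  omega

/-- Three cases remain: at most one edge goes to the second end, at most one to the first (reduced
to the former by conjugation), or both ends are high. -/
theorem isRecovered_iff (h : VertexSplit Γ Γ' φ v A τ) (hdet : Γ.linkingMatrix.det ≠ 0)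
    (h2 : Γ.highCount ≤ 2) (h2' : Γ'.highCount ≤ 2) {a : V → ℤ} {a' b : V' → ℤ}
    (ha' : ∀ v, (2 : ℤ) ∣ a' v - Γ'.deg v) (hba' : Γ'.SpincEquiv b a')
    (hb₀ : b (φ (Sum.inr false)) = 0) (hb₁ : b (φ (Sum.inl v)) - b (φ (Sum.inr true)) = a v)
    (hb₂ : ∀ x, x ≠ v → b (φ (Sum.inl x)) = τ x * a x) (c : ℚ → ℝ) :
    Γ.IsRecovered a c ↔ Γ'.IsRecovered a' c := by
  have hθ := h.thetaReduction hdet ha' hba' hb₀ hb₁ hb₂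
  by_cases hA : A.Subsingleton
  · exact h.isRecovered_iff_of_subsingleton hA hdet h2 h2' hθ c
  have hθ' := h.symm.thetaReduction hdet (a := -a) ha' hba'
    (by
      rw [Equiv.trans_apply, Equiv.swap_apply_of_ne_of_ne (by simp) (by simp)]
      exact hb₀)
    (by
      rw [Equiv.trans_apply, Equiv.trans_apply, Equiv.swap_apply_left, Equiv.swap_apply_right,
        Pi.neg_apply, ← hb₁]
      ring)
    (fun x hx => by
      rw [Equiv.trans_apply, Equiv.swap_apply_of_ne_of_ne (by simpa using hx) (by simp), hb₂ x hx,
        if_neg hx, Pi.neg_apply]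
      push_cast
      ring)
  by_cases hA' : {y | Γ.graph.Adj v y ∧ y ∉ A}.Subsingleton
  · rw [← h.symm.isRecovered_iff_of_subsingleton hA' hdet h2 h2' hθ']
    exact isRecovered_congr (fun n k => zHatCoeff_neg h2 a n k) c
  · have h₁ := h.symm.isHigh_true hA'
    rw [Equiv.trans_apply, Equiv.swap_apply_right] at h₁
    exact isRecovered_congr (h.zHatCoeff_eq h2' h₁ (h.isHigh_true hA) hθ) c

end VertexSplit
end VertexSplit
end Plumbing

/-! ### Blowing up by a vertex of weight `±1` -/

namespace Plumbing

theorem eigenCount_unit (ε : ℤˣ) : (-1 : ℤˣ) ^ posEigenCount !![(ε : ℤ)] = -ε ∧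
    matrixSignature !![(ε : ℤ)] = ε := by
  classical
  have hA : (!![(ε : ℤ)] : Matrix (Fin 1) (Fin 1) ℤ).IsSymm := by
    ext i j; fin_cases i; fin_cases j; rfl
  obtain ⟨h1, h2⟩ := hasPosIndex_realForm hA
  have htop : Submodule.span ℝ {(Pi.single (0 : Fin 1) (1 : ℝ) : Fin 1 → ℝ)} = ⊤ := by
    rw [eq_top_iff]
    intro x _
    rw [Submodule.mem_span_singleton]
    refine ⟨x 0, ?_⟩
    ext i
    fin_cases i
    simp
  have h3 := hasPosIndex_span_singleton (B := realForm !![(ε : ℤ)]) (Pi.single (0 : Fin 1) (1 : ℝ))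
  have h4 := hasPosIndex_span_singleton (B := -realForm !![(ε : ℤ)]) (Pi.single (0 : Fin 1) (1 : ℝ))
  rw [htop, LinearMap.neg_apply, LinearMap.neg_apply] at h4
  rw [htop] at h3
  have h5 := h1.unique h3
  have h6 := h2.unique h4
  rw [realForm_single] at h5 h6
  rw [matrixSignature, h5, h6]
  rcases Int.units_eq_one_or ε with rfl | rfl <;> norm_num

section UnitBlowUp

variable {V V' : Type u} [Fintype V] [DecidableEq V] [Fintype V'] [DecidableEq V']

/-- `Γ'` is obtained from `Γ` by attaching a new vertex of weight `ε` to the vertices in `S`,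
removing the edges between these, and adding `ε` to their weights; the sign `τ` changes by `-ε`
along the removed edges. -/
structure UnitBlowUp (Γ : Plumbing V) (Γ' : Plumbing V') (φ : V ⊕ Fin 1 ≃ V') (S : Finset V)
    (ε : ℤˣ) (τ : V → ℤˣ) : Prop where
  adj_inl_inl : ∀ x y, Γ'.graph.Adj (φ (Sum.inl x)) (φ (Sum.inl y)) ↔
    Γ.graph.Adj x y ∧ ¬(x ∈ S ∧ y ∈ S)
  adj_inl_inr : ∀ x, Γ'.graph.Adj (φ (Sum.inl x)) (φ (Sum.inr 0)) ↔ x ∈ S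
  weight_inr : Γ'.weight (φ (Sum.inr 0)) = ε
  weight_inl : ∀ x, Γ'.weight (φ (Sum.inl x)) = Γ.weight x + if x ∈ S then (ε : ℤ) else 0
  adj : ∀ x ∈ S, ∀ y ∈ S, x ≠ y → Γ.graph.Adj x y
  sign_mul : ∀ x ∈ S, ∀ y ∈ S, x ≠ y → τ x * τ y = -ε
  sign_eq : ∀ x y, Γ.graph.Adj x y → ¬(x ∈ S ∧ y ∈ S) → τ x = τ y

namespace UnitBlowUp

variable {Γ : Plumbing V} {Γ' : Plumbing V'} {φ : V ⊕ Fin 1 ≃ V'} {S : Finset V} {ε : ℤˣ}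
  {τ : V → ℤˣ}

/-- The linking numbers between the old vertices and the new one. -/
def mixedBlock (S : Finset V) : Matrix V (Fin 1) ℤ := Matrix.of fun x _ => if x ∈ S then 1 else 0

/-- Here `Q' = (ε)`, so `G Q' Gᵀ` adds `ε` between all vertices of `S`. On the diagonal this is the
change of weight; off it, it cancels the twisted entry `-ε` of a removed edge. -/
theorem blockReduction (h : UnitBlowUp Γ Γ' φ S ε τ) :
    BlockReduction Γ.linkingMatrix Γ'.linkingMatrix φ τ (mixedBlock S) !![(ε : ℤ)] !![(ε : ℤ)] := by
  have hinr : ∀ x j, Γ'.linkingMatrix (φ (Sum.inl x)) (φ (Sum.inr j)) = mixedBlock S x j := by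
    intro x j
    obtain rfl := Subsingleton.elim 0 j
    rw [linkingMatrix_of_ne (by simp)]
    simp [mixedBlock, h.adj_inl_inr]
  refine ⟨?_, ?_, fun x y => ?_, hinr, fun x j => ?_, fun i j => ?_⟩
  · ext i j
    fin_cases i
    fin_cases j
    rfl
  · ext i j
    fin_cases i
    fin_cases j
    simp [Matrix.mul_apply]
  · have hG : (mixedBlock S * !![(ε : ℤ)] * (mixedBlock S).transpose) x y =
        (if x ∈ S then 1 else 0) * ε * (if y ∈ S then 1 else 0) := by
      simp [Matrix.mul_apply, mixedBlock]
    rw [hG]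
    by_cases hxy : x = y
    · subst hxy
      rw [linkingMatrix_self, linkingMatrix_self, ← Units.val_mul, Int.units_mul_self,
        Units.val_one, one_mul, h.weight_inl]
      split_ifs <;> simp
    · rw [linkingMatrix_of_ne (by simpa using hxy), linkingMatrix_of_ne hxy, h.adj_inl_inl]
      by_cases hS : x ∈ S ∧ y ∈ S
      · have := congrArg Units.val (h.sign_mul x hS.1 y hS.2 hxy)
        rw [Units.val_mul] at this
        simp [hS.1, hS.2, h.adj x hS.1 y hS.2 hxy, this]
      · have h0 : (if x ∈ S then (1 : ℤ) else 0) * ε * (if y ∈ S then 1 else 0) = 0 := by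
          by_cases hx : x ∈ S
          · have hy : y ∉ S := fun hy => hS ⟨hx, hy⟩
            simp [hy]
          · simp [hx]
        rw [h0, add_zero]
        by_cases hadj : Γ.graph.Adj x y
        · have h1 : (τ x : ℤ) * τ y = 1 := by
            rw [h.sign_eq x y hadj hS, ← Units.val_mul, Int.units_mul_self, Units.val_one]
          simp [hadj, hS, h1]
        · simp [hadj]
  · rw [← hinr, ← linkingMatrix_isSymm.apply]
  · obtain rfl := Subsingleton.elim 0 i
    obtain rfl := Subsingleton.elim 0 j
    rw [linkingMatrix_self, h.weight_inr]
    rfl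

/-- The vertex of `Γ` from which a vertex of `Γ'` originates. -/
def origin (φ : V ⊕ Fin 1 ≃ V') (v : V) (y : V') : V := Sum.elim id (fun _ => v) (φ.symm y)

/-- The signs of the vertices of `Γ'`. -/
def sign (φ : V ⊕ Fin 1 ≃ V') (τ : V → ℤˣ) (t : ℤˣ) (y : V') : ℤˣ :=
  Sum.elim τ (fun _ => t) (φ.symm y)

theorem reduce_eq (e : V' → ℤ) (x : V) :
    BlockReduction.reduce φ τ (mixedBlock S) !![(ε : ℤ)] e x =
      τ x * (e (φ (Sum.inl x)) - if x ∈ S then ε * e (φ (Sum.inr 0)) else 0) := by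
  simp only [BlockReduction.reduce, Matrix.mulVec, dotProduct, Matrix.map_apply, Matrix.mul_apply,
    mixedBlock, Matrix.of_apply]
  split_ifs <;> simp

theorem deg_inr (h : UnitBlowUp Γ Γ' φ S ε τ) : Γ'.deg (φ (Sum.inr 0)) = S.card := by
  classical
  rw [deg_eq_sum, ← φ.sum_comp, Fintype.sum_sum_type]
  simp [SimpleGraph.adj_comm _ (φ (Sum.inr 0)), h.adj_inl_inr]

open Classical in
theorem deg_inl (h : UnitBlowUp Γ Γ' φ S ε τ) (x : V) : Γ'.deg (φ (Sum.inl x)) =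
    (∑ y, if Γ.graph.Adj x y ∧ ¬(x ∈ S ∧ y ∈ S) then 1 else 0) + if x ∈ S then 1 else 0 := by
  rw [deg_eq_sum, ← φ.sum_comp, Fintype.sum_sum_type]
  simp only [h.adj_inl_inl, h.adj_inl_inr, Finset.univ_unique, Fin.default_eq_zero,
    Finset.sum_singleton]

/-- The new block has signature `ε` and the total weight grows by `ε(|S| + 1)`, so the leftover must
be `ε(2 - |S|)`; this is the form of `hr`. The vertex `z` is the end of the only new edge across
which the sign may change. -/
theorem thetaReduction (h : UnitBlowUp Γ Γ' φ S ε τ) (hdet : Γ.linkingMatrix.det ≠ 0)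
    {a : V → ℤ} {a' b : V' → ℤ} (ha' : ∀ v, (2 : ℤ) ∣ a' v - Γ'.deg v) (hba' : Γ'.SpincEquiv b a')
    (hb : ∀ x, b (φ (Sum.inl x)) - (if x ∈ S then ε * b (φ (Sum.inr 0)) else 0) = τ x * a x)
    {v : V} {t : ℤˣ}
    (he : ∀ e, Γ'.Admissible e → ∀ x, (if v = x then (t : ℤ) * e (φ (Sum.inr 0)) else 0) =
      -(τ x * if x ∈ S then ε * e (φ (Sum.inr 0)) else 0))
    (hr : ∀ e, Γ'.Admissible e → e (φ (Sum.inr 0)) * e (φ (Sum.inr 0)) = 2 - S.card)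
    {z : V} (hz : z ∈ S) (htz : t * τ z = -ε) (ht : ∀ y ∈ S, y ≠ z → τ y = t) :
    ThetaReduction Γ Γ' a a' (origin φ v) (sign φ τ t) := by
  refine h.blockReduction.thetaReduction hdet ha' hba' ?_ (fun e hadm => ?_) (fun e hadm => ?_) ?_
  · funext x
    rw [reduce_eq, hb, ← mul_assoc, ← Units.val_mul, Int.units_mul_self, Units.val_one, one_mul]
  · funext x
    rw [reduce_eq, expHom_apply, ← φ.sum_comp, Fintype.sum_sum_type, mul_sub, sub_eq_add_neg,
      ← he e hadm]
    simp [origin, sign]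
  · have hsum : ∑ y, Γ'.weight y = ∑ x, Γ.weight x + (ε * S.card + ε) := by
      rw [← φ.sum_comp, Fintype.sum_sum_type]
      simp only [h.weight_inl, Finset.univ_unique, Fin.default_eq_zero, Finset.sum_singleton,
        h.weight_inr]
      rw [Finset.sum_add_distrib, Finset.sum_ite_mem, Finset.univ_inter, Finset.sum_const,
        nsmul_eq_mul]
      ring
    have h1 : (fun i : Fin 1 => e (φ (Sum.inr i))) ⬝ᵥ
        (!![(ε : ℤ)].mulVec fun i => e (φ (Sum.inr i))) =
        ε * (e (φ (Sum.inr 0)) * e (φ (Sum.inr 0))) := by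
      simp [dotProduct, Matrix.mulVec]
      ring
    rw [h1, hr e hadm, (eigenCount_unit ε).2, hsum]
    ring
  · rw [(eigenCount_unit ε).1, ← htz, prod_pow_deg (sign φ τ t)
      (x := φ (Sum.inr 0)) (y := φ (Sum.inl z)) ((h.adj_inl_inr z).2 hz).symm]
    · simp [sign]
    · intro y y' hyy' hne
      obtain ⟨y, rfl⟩ := φ.surjective y
      obtain ⟨y', rfl⟩ := φ.surjective y'
      simp only [sign, Equiv.symm_apply_apply]
      rcases y with x | i <;> rcases y' with x' | i'
      · obtain ⟨h1, h2⟩ := (h.adj_inl_inl x x').1 hyy'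
        exact h.sign_eq x x' h1 h2
      · obtain rfl := Subsingleton.elim 0 i'
        refine ht x ((h.adj_inl_inr x).1 hyy') ?_
        rintro rfl
        exact hne Sym2.eq_swap
      · obtain rfl := Subsingleton.elim 0 i
        refine (ht x' ((h.adj_inl_inr x').1 hyy'.symm) ?_).symm
        rintro rfl
        exact hne rfl
      · obtain rfl := Subsingleton.elim i i'
        exact absurd rfl hyy'.ne

theorem injective_inl (φ : V ⊕ Fin 1 ≃ V') : Function.Injective fun x => φ (Sum.inl x) :=
  φ.injective.comp Sum.inl_injective

theorem deg_inl_of_forall_mem_iff (h : UnitBlowUp Γ Γ' φ S ε τ) {x y : V}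
    (hS : ∀ z, z ∈ S ↔ z = x ∨ z = y) (hxy : x ≠ y) : Γ'.deg (φ (Sum.inl x)) = Γ.deg x := by
  classical
  have hx : x ∈ S := (hS x).2 (Or.inl rfl)
  have hy : y ∈ S := (hS y).2 (Or.inr rfl)
  rw [h.deg_inl, deg_eq_sum, if_pos hx]
  have h1 : ∀ z, (if Γ.graph.Adj x z then 1 else 0) =
      (if Γ.graph.Adj x z ∧ ¬(x ∈ S ∧ z ∈ S) then 1 else 0) + if z = y then 1 else 0 := by
    intro z
    by_cases hzy : z = y
    · subst hzy
      simp [hx, hy, h.adj x hx z hy hxy]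
    · by_cases hzx : z = x
      · subst hzx
        simp [hzy]
      · have hz : z ∉ S := fun hz => ((hS z).1 hz).elim hzx hzy
        simp [hz, hzy]
  rw [Finset.sum_congr rfl fun z _ => h1 z, Finset.sum_add_distrib, Finset.sum_ite_eq']
  simp

theorem edgeMove {v₁ v₂ : V} (h : UnitBlowUp Γ Γ' φ {v₁, v₂} ε τ) (hne : v₁ ≠ v₂) :
    EdgeMove Γ Γ' (fun x => φ (Sum.inl x)) [φ (Sum.inr 0)] v₁ v₂ τ (-ε) ε ε := by
  classical
  have hadj : Γ.graph.Adj v₁ v₂ := h.adj v₁ (by simp) v₂ (by simp) hne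
  have hs : ∀ x z, Γ.graph.Adj x z → s(x, z) ≠ s(v₁, v₂) →
      ¬(x ∈ ({v₁, v₂} : Finset V) ∧ z ∈ ({v₁, v₂} : Finset V)) := by
    intro x z hxz hxz'
    simp only [Finset.mem_insert, Finset.mem_singleton]
    rintro ⟨rfl | rfl, rfl | rfl⟩
    · exact hxz.ne rfl
    · exact hxz' rfl
    · exact hxz' Sym2.eq_swap
    · exact hxz.ne rfl
  have hdeg : ∀ x y, x ∈ ({v₁, v₂} : Finset V) → y ∈ ({v₁, v₂} : Finset V) → x ≠ y →
      Γ'.deg (φ (Sum.inl x)) = Γ.deg x := by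
    intro x y hx hy hxy
    have hS : ∀ z, z ∈ ({v₁, v₂} : Finset V) ↔ z = x ∨ z = y := by
      intro z
      simp only [Finset.mem_insert, Finset.mem_singleton] at hx hy ⊢
      rcases hx with rfl | rfl <;> rcases hy with rfl | rfl <;> tauto
    exact h.deg_inl_of_forall_mem_iff hS hxy
  refine ⟨injective_inl φ, fun x => by simp, fun z => ?_, fun {x z} hxz hxz' => ?_, hadj, ⟨?_, ?_⟩,
    fun x => ?_, fun z hz => ?_, fun x hx hx' => ?_, ?_, ?_, fun l => ?_, ?_, fun l => ?_, ?_, ?_,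
    fun {x z} hxz hxz' => h.sign_eq x z hxz (hs x z hxz hxz')⟩
  · obtain ⟨w, rfl⟩ := φ.surjective z
    rcases w with x | i
    · exact Or.inl ⟨x, rfl⟩
    · rw [Subsingleton.elim i 0]
      simp
  · rw [h.adj_inl_inl]
    exact ⟨hxz, hs x z hxz hxz'⟩
  · simp only [List.cons_append, List.nil_append, List.isChain_cons_cons, List.IsChain.singleton,
      and_true]
    exact ⟨(h.adj_inl_inr v₁).2 (by simp), ((h.adj_inl_inr v₂).2 (by simp)).symm⟩
  · simp [hne]
  · by_cases hx : x ∈ ({v₁, v₂} : Finset V)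
    · by_cases hx1 : x = v₁
      · exact hdeg x v₂ hx (by simp) (by rw [hx1]; exact hne)
      · exact hdeg x v₁ hx (by simp) hx1
    · rw [h.deg_inl, deg_eq_sum]
      simp [hx]
  · rw [List.mem_singleton.1 hz, h.deg_inr, Finset.card_pair hne]
  · rw [h.weight_inl, if_neg (by simp [hx, hx']), add_zero]
  · rw [h.weight_inl, if_pos (by simp)]
  · rw [h.weight_inl, if_pos (by simp)]
  · simp only [List.map_cons, List.map_nil, h.weight_inr, List.cons_append, List.nil_append]
    exact chainRel_blowUp ε _ l
  · simp only [List.map_cons, List.map_nil, h.weight_inr]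
    exact chainRel_nil_unit ε
  · simp only [List.reverse_singleton, List.map_cons, List.map_nil, h.weight_inr, List.cons_append,
      List.nil_append]
    exact chainRel_blowUp ε _ l
  · simp only [List.reverse_singleton, List.map_cons, List.map_nil, h.weight_inr]
    exact chainRel_nil_unit ε
  · exact h.sign_mul v₁ (by simp) v₂ (by simp) hne

theorem pendantMove {v : V} (h : UnitBlowUp Γ Γ' φ {v} ε τ) :
    PendantMove Γ Γ' (fun x => φ (Sum.inl x)) v [] (φ (Sum.inr 0)) (-ε) ε := by
  classical
  have hs : ∀ x z, Γ.graph.Adj x z → ¬(x ∈ ({v} : Finset V) ∧ z ∈ ({v} : Finset V)) := by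
    intro x z hxz
    simp only [Finset.mem_singleton]
    rintro ⟨rfl, rfl⟩
    exact hxz.ne rfl
  have hdeg : ∀ x, Γ'.deg (φ (Sum.inl x)) = Γ.deg x + if x = v then 1 else 0 := by
    intro x
    rw [h.deg_inl, deg_eq_sum]
    congr 1
    · exact Finset.sum_congr rfl fun y _ =>
        if_congr ⟨fun h' => h'.1, fun h' => ⟨h', hs x y h'⟩⟩ rfl rfl
    · simp
  refine ⟨injective_inl φ, fun x => by simp, fun z => ?_, fun {x z} hxz => ?_, ⟨?_, ?_⟩,
    fun x hx => by rw [hdeg, if_neg hx, add_zero], by rw [hdeg, if_pos rfl], by simp, ?_,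
    fun x hx => ?_, ?_, ?_⟩
  · obtain ⟨w, rfl⟩ := φ.surjective z
    rcases w with x | i
    · exact Or.inl ⟨x, rfl⟩
    · rw [Subsingleton.elim i 0]
      simp
  · rw [h.adj_inl_inl]
    exact ⟨hxz, hs x z hxz⟩
  · simp only [List.nil_append, List.isChain_cons_cons, List.IsChain.singleton, and_true]
    exact (h.adj_inl_inr v).2 (by simp)
  · simp
  · rw [h.deg_inr, Finset.card_singleton]
  · rw [h.weight_inl, if_neg (by simpa using hx), add_zero]
  · rw [h.weight_inl, if_pos (by simp)]
  · simp only [List.nil_append, List.map_cons, List.map_nil, h.weight_inr]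
    exact chainRel_nil_unit ε

end UnitBlowUp
end UnitBlowUp
end Plumbing

/-! ### The Neumann moves -/

section FarSide

variable {V : Type u} {G : SimpleGraph V} {v w : V}

theorem farSide_right : FarSide G v w w := SimpleGraph.Reachable.refl w

/-- Every edge of a tree is a bridge. -/
theorem not_farSide_left (hG : G.IsTree) (h : G.Adj v w) : ¬FarSide G v w v := by
  have h1 := SimpleGraph.isAcyclic_iff_forall_adj_isBridge.1 hG.2 h
  rw [SimpleGraph.isBridge_iff] at h1
  intro h2
  exact h1 h2.symm

theorem farSide_iff_of_adj {x y : V} (h : G.Adj x y) (hne : s(x, y) ≠ s(v, w)) :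
    FarSide G v w x ↔ FarSide G v w y := by
  have h1 : (G.deleteEdges {s(v, w)}).Adj x y := by
    rw [SimpleGraph.deleteEdges_adj]
    exact ⟨h, hne⟩
  exact ⟨fun h2 => h2.trans h1.reachable, fun h2 => h2.trans h1.symm.reachable⟩

end FarSide

/-- The vertices of a blow-up as a sum type. -/
def sumFinOneEquiv (V : Type u) : V ⊕ Fin 1 ≃ Option V :=
  ((Equiv.refl V).sumCongr (Equiv.ofUnique (Fin 1) PUnit.{1})).trans
    (Equiv.optionEquivSumPUnit.{0, u} V).symm

namespace Plumbing

variable {P P' : SpincPlumbing.{u}}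

/-- The linking matrices of `P` and `P'` are both singular, or both nonsingular, and in the
latter case the two invariants have the same limits. -/
def SameRecovered (P P' : SpincPlumbing.{u}) : Prop :=
  (P'.Γ.linkingMatrix.det = 0 ↔ P.Γ.linkingMatrix.det = 0) ∧
    (P.Γ.linkingMatrix.det ≠ 0 → ∀ c, P.Γ.IsRecovered P.a c ↔ P'.Γ.IsRecovered P'.a c)

theorem sameRecovered_of_moveA (h : MoveA P P') (h2 : P.Γ.highCount ≤ 2) : SameRecovered P P' := by
  classical
  obtain ⟨v₁, v₂, ε, f, b, hadj, hw₀, hw₁, hw₂, hw, hb₀, hb₁, hb₂, hb⟩ := h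
  have hne := hadj.ne
  set φ : P.V ⊕ Fin 1 ≃ P'.V := (sumFinOneEquiv P.V).trans f.toEquiv with hφ
  have hφl : ∀ x, φ (Sum.inl x) = f (some x) := fun _ => rfl
  have hφr : φ (Sum.inr 0) = f none := rfl
  set τ : P.V → ℤˣ := fun x => if FarSide P.Γ.graph v₁ v₂ x then -ε else 1 with hτ
  have hτ₁ : τ v₁ = 1 := if_neg (not_farSide_left P.Γ.isTree hadj)
  have hτ₂ : τ v₂ = -ε := if_pos farSide_right
  have hs : ∀ x y, P.Γ.graph.Adj x y → (s(x, y) ≠ s(v₁, v₂) ↔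
      ¬(x ∈ ({v₁, v₂} : Finset P.V) ∧ y ∈ ({v₁, v₂} : Finset P.V))) := by
    intro x y hxy
    have := hxy.ne
    simp only [Finset.mem_insert, Finset.mem_singleton, ne_eq, Sym2.eq_iff]
    constructor
    · rintro h1 ⟨rfl | rfl, rfl | rfl⟩ <;> simp_all
    · rintro h1 (⟨rfl, rfl⟩ | ⟨rfl, rfl⟩) <;> simp at h1
  have hU : UnitBlowUp P.Γ P'.Γ φ {v₁, v₂} ε τ := by
    refine ⟨fun x y => ?_, fun x => ?_, hw₀, fun x => ?_, ?_, ?_, fun x y hxy hS => ?_⟩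
    · rw [hφl, hφl, f.map_adj_iff, subdivideGraph, SimpleGraph.fromRel_adj]
      simp only [ne_eq, Option.some.injEq, SimpleGraph.deleteEdges_adj, Set.mem_singleton_iff,
        SimpleGraph.adj_comm P.Γ.graph y x, Sym2.eq_swap (a := y) (b := x), or_self]
      constructor
      · rintro ⟨-, h1, h3⟩
        exact ⟨h1, (hs x y h1).1 h3⟩
      · rintro ⟨h1, h3⟩
        exact ⟨h1.ne, h1, (hs x y h1).2 h3⟩
    · rw [hφl, hφr, f.map_adj_iff, subdivideGraph, SimpleGraph.fromRel_adj]
      simp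
    · rw [hφl]
      by_cases h1 : x = v₁
      · rw [h1, hw₁, if_pos (by simp)]
      · by_cases h3 : x = v₂
        · rw [h3, hw₂, if_pos (by simp)]
        · rw [hw x h1 h3, if_neg (by simp [h1, h3]), add_zero]
    · intro x hx y hy hxy
      simp only [Finset.mem_insert, Finset.mem_singleton] at hx hy
      rcases hx with rfl | rfl <;> rcases hy with rfl | rfl
      · exact absurd rfl hxy
      · exact hadj
      · exact hadj.symm
      · exact absurd rfl hxy
    · intro x hx y hy hxy
      simp only [Finset.mem_insert, Finset.mem_singleton] at hx hy
      rcases hx with rfl | rfl <;> rcases hy with rfl | rfl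
      · exact absurd rfl hxy
      · rw [hτ₁, hτ₂, one_mul]
      · rw [hτ₁, hτ₂, mul_one]
      · exact absurd rfl hxy
    · simp only [hτ, farSide_iff_of_adj hxy ((hs x y hxy).2 hS)]
  have he₀ : ∀ e, P'.Γ.Admissible e → e (φ (Sum.inr 0)) = 0 := fun e he =>
    (he (φ (Sum.inr 0))).2.1 (by rw [hU.deg_inr, Finset.card_pair hne])
  refine ⟨hU.blockReduction.det_eq_zero_iff, fun hdet c => ?_⟩
  -- The image of the new vertex is arbitrary, since admissible exponents vanish there. Its sign `1`
  -- places the jump on the edge to `v₂`.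
  have hθ : ThetaReduction P.Γ P'.Γ P.a P'.a (UnitBlowUp.origin φ v₁) (UnitBlowUp.sign φ τ 1) := by
    refine hU.thetaReduction hdet P'.parity hb (fun x => ?_) (fun e he x => ?_) (fun e he => ?_)
      (z := v₂) (by simp) (by rw [hτ₂, one_mul]) (fun y hy hy' => ?_)
    · rw [hφl, hφr, hb₀, mul_zero, ite_self, sub_zero]
      by_cases hx : FarSide P.Γ.graph v₁ v₂ x
      · rw [hb₂ x hx, hτ]
        simp [hx]
      · rw [hb₁ x hx, hτ]
        simp [hx]
    · simp [he₀ e he]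
    · rw [he₀ e he, Finset.card_pair hne]
      norm_num
    · simp only [Finset.mem_insert, Finset.mem_singleton] at hy
      rcases hy with rfl | rfl
      · exact hτ₁
      · exact absurd rfl hy'
  exact isRecovered_congr ((hU.edgeMove hne).zHatCoeff_eq h2 hθ
    (fun x => by simp [UnitBlowUp.origin]) (fun x => by simp [UnitBlowUp.sign])) c

theorem sameRecovered_of_moveB (h : MoveB P P') (h2 : P.Γ.highCount ≤ 2)
    (h2' : P'.Γ.highCount ≤ 2) : SameRecovered P P' := by
  classical
  obtain ⟨v, ε, f, b, hw₀, hw₁, hw, hb₀, hb₁, hb₂, hb⟩ := h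
  set φ : P.V ⊕ Fin 1 ≃ P'.V := (sumFinOneEquiv P.V).trans f.toEquiv with hφ
  have hφl : ∀ x, φ (Sum.inl x) = f (some x) := fun _ => rfl
  have hφr : φ (Sum.inr 0) = f none := rfl
  have hεε : (ε : ℤ) * ε = 1 := by rw [← Units.val_mul, Int.units_mul_self, Units.val_one]
  have hU : UnitBlowUp P.Γ P'.Γ φ {v} ε 1 := by
    refine ⟨fun x y => ?_, fun x => ?_, hw₀, fun x => ?_, ?_, ?_, fun x y hxy hS => rfl⟩
    · rw [hφl, hφl, f.map_adj_iff, pendantGraph, SimpleGraph.fromRel_adj]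
      simp only [ne_eq, Option.some.injEq, SimpleGraph.adj_comm P.Γ.graph y x, or_self,
        Finset.mem_singleton]
      constructor
      · rintro ⟨-, h1⟩
        refine ⟨h1, ?_⟩
        rintro ⟨rfl, rfl⟩
        exact h1.ne rfl
      · rintro ⟨h1, -⟩
        exact ⟨h1.ne, h1⟩
    · rw [hφl, hφr, f.map_adj_iff, pendantGraph, SimpleGraph.fromRel_adj]
      simp
    · rw [hφl]
      by_cases h1 : x = v
      · rw [h1, hw₁, if_pos (by simp)]
      · rw [hw x h1, if_neg (by simpa using h1), add_zero]
    · intro x hx y hy hxy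
      rw [Finset.mem_singleton] at hx hy
      exact absurd (hx.trans hy.symm) hxy
    · intro x hx y hy hxy
      rw [Finset.mem_singleton] at hx hy
      exact absurd (hx.trans hy.symm) hxy
  refine ⟨hU.blockReduction.det_eq_zero_iff, fun hdet c => ?_⟩
  -- The new leaf must be sent to `v` with sign `-ε`, because elimination subtracts `ε` times its
  -- exponent from that at `v`.
  have hθ : ThetaReduction P.Γ P'.Γ P.a P'.a (UnitBlowUp.origin φ v)
      (UnitBlowUp.sign φ 1 (-ε)) := by
    refine hU.thetaReduction hdet P'.parity hb (fun x => ?_) (fun e he x => ?_) (fun e he => ?_)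
      (z := v) (by simp) (by simp) (fun y hy hy' => ?_)
    · rw [hφl, hφr, hb₀, hεε]
      by_cases hx : x = v
      · simp [hx, hb₁]
      · simp [hx, hb₂ x hx]
    · by_cases hx : x = v
      · simp [hx]
      · simp [hx, Ne.symm hx]
    · rcases (he (φ (Sum.inr 0))).2.2 (by rw [hU.deg_inr, Finset.card_singleton]) with h1 | h1 <;>
        rw [h1, Finset.card_singleton] <;> norm_num
    · exact absurd (Finset.mem_singleton.1 hy) hy'
  have hκ : ∀ x, UnitBlowUp.origin φ v (φ (Sum.inl x)) = x := fun x => by simp [UnitBlowUp.origin]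
  have hτ : ∀ x, UnitBlowUp.sign φ 1 (-ε) (φ (Sum.inl x)) = 1 := fun x => by
    simp [UnitBlowUp.sign]
  have hκu : UnitBlowUp.origin φ v (φ (Sum.inr 0)) = v := by simp [UnitBlowUp.origin]
  have hτu : UnitBlowUp.sign φ 1 (-ε) (φ (Sum.inr 0)) = -ε := by simp [UnitBlowUp.sign]
  by_cases hv : P.Γ.deg v = 2
  · exact hU.pendantMove.isRecovered_iff hv hdet h2' hθ hκ hτ hκu hτu c
  · exact isRecovered_congr (hU.pendantMove.zHatCoeff_eq hv h2 hθ hκ hτ hκu hτu) c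

theorem sameRecovered_of_moveC (h : MoveC P P') (h2 : P.Γ.highCount ≤ 2)
    (h2' : P'.Γ.highCount ≤ 2) : SameRecovered P P' := by
  classical
  obtain ⟨v, A, f, b, hA, hw₀, hw₁, hw, hb₀, hb₁, hb₂, hb₃, hb⟩ := h
  set τ : P.V → ℤˣ := fun x => if ∃ y ∈ A, FarSide P.Γ.graph v y x then -1 else 1 with hτ
  have hvA : v ∉ A := fun hv => (hA hv).ne rfl
  have hS : VertexSplit P.Γ P'.Γ f.toEquiv v A τ := by
    refine ⟨fun y hy => hA hy, fun x y => ?_, fun x => ?_, fun x => ?_, ?_, hw₀, hw₁, hw, ?_,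
      fun y hy => ?_, fun x y hxy hx hy => ?_⟩
    · change P'.Γ.graph.Adj (f (Sum.inl x)) (f (Sum.inl y)) ↔ _
      rw [f.map_adj_iff, splitGraph, SimpleGraph.fromRel_adj]
      simp only [ne_eq, Sum.inl.injEq, SimpleGraph.adj_comm P.Γ.graph y x]
      constructor
      · rintro ⟨-, h1 | h1⟩
        · exact h1
        · exact ⟨h1.1, h1.2.2, h1.2.1⟩
      · intro h1
        exact ⟨h1.1.ne, Or.inl h1⟩
    · change P'.Γ.graph.Adj (f (Sum.inl x)) (f (Sum.inr false)) ↔ _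
      rw [f.map_adj_iff, splitGraph, SimpleGraph.fromRel_adj]
      simp
    · change P'.Γ.graph.Adj (f (Sum.inl x)) (f (Sum.inr true)) ↔ _
      rw [f.map_adj_iff, splitGraph, SimpleGraph.fromRel_adj]
      simp
    · change P'.Γ.graph.Adj (f (Sum.inr false)) (f (Sum.inr true))
      rw [f.map_adj_iff, splitGraph, SimpleGraph.fromRel_adj]
      simp
    · refine if_neg ?_
      rintro ⟨y, hy, h1⟩
      exact not_farSide_left P.Γ.isTree (hA hy) h1
    · exact if_pos ⟨y, hy, farSide_right⟩
    -- An edge other than those from `v` to `A` stays within one side of each removed edge, so it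
    -- does not change the sign.
    · have h1 : (∃ z ∈ A, FarSide P.Γ.graph v z x) ↔ ∃ z ∈ A, FarSide P.Γ.graph v z y := by
        refine exists_congr fun z => and_congr_right fun hz => farSide_iff_of_adj hxy ?_
        intro h3
        rcases Sym2.eq_iff.1 h3 with ⟨rfl, rfl⟩ | ⟨rfl, rfl⟩
        · exact hx ⟨rfl, hz⟩
        · exact hy ⟨rfl, hz⟩
      simp only [hτ, h1]
  refine ⟨hS.blockReduction.det_eq_zero_iff, fun hdet c => ?_⟩
  refine hS.isRecovered_iff hdet h2 h2' P'.parity hb hb₀ hb₁ (fun x hx => ?_) c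
  by_cases hex : ∃ y ∈ A, FarSide P.Γ.graph v y x
  · obtain ⟨y, hy, hyx⟩ := hex
    have h1 : τ x = -1 := if_pos ⟨y, hy, hyx⟩
    rw [h1]
    change b (f (Sum.inl x)) = _
    rw [hb₃ y hy x hyx]
    simp
  · have h1 : τ x = 1 := if_neg hex
    push Not at hex
    rw [h1]
    change b (f (Sum.inl x)) = _
    rw [hb₂ x hx hex]
    simp

/-- Equality of recovered series is proved only for nonsingular matrices, and the equivalence of
determinants in `SameRecovered` transmits this along the sequence in both directions. -/
theorem sameRecovered_of_neumannRelated (h : NeumannRelated P P') : SameRecovered P P' := by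
  induction h with
  | rel x y h =>
    obtain ⟨h | h | h, h2, h2'⟩ := h
    · exact sameRecovered_of_moveA h h2
    · exact sameRecovered_of_moveB h h2 h2'
    · exact sameRecovered_of_moveC h h2 h2'
  | refl x => exact ⟨Iff.rfl, fun _ _ => Iff.rfl⟩
  | symm x y _ ih => exact ⟨ih.1.symm, fun hy c => (ih.2 (fun h0 => hy (ih.1.2 h0)) c).symm⟩
  | trans x y z _ _ ih₁ ih₂ =>
    exact ⟨ih₂.1.trans ih₁.1, fun hx c =>
      (ih₁.2 hx c).trans (ih₂.2 (fun h0 => hx (ih₁.1.1 h0)) c)⟩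

end Plumbing

end

theorem proposition4p5 (P Q : SpincPlumbing.{u}) (hM : P.Γ.linkingMatrix.det ≠ 0)
    (hPQ : NeumannRelated P Q) (c : ℚ → ℝ) (hc : P.Γ.IsRecovered P.a c) :
    Q.Γ.IsRecovered Q.a c :=
  ((Plumbing.sameRecovered_of_neumannRelated hPQ).2 hM c).1 hc
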